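/- Let $(\mathsf{Y},\mathcal{Y})$ be a measurable space and let $\alpha\in(0,\infty]$. For nonzero finite measures $W,Q$ with a common dominating measure $\nu$, the Rényi divergence is $D_\alpha(W\|Q)=\frac{1}{\alpha-1}\ln\int (\frac{dW}{d\nu})^{\alpha}(\frac{dQ}{d\nu})^{1-\alpha}\,d\nu$ for $\alpha\ne 1,\infty$, $D_1(W\|Q)=\int \frac{dW}{d\nu}\left(\ln\frac{dW}{d\nu}-\ln\frac{dQ}{d\nu}\right)d\nu$, and $D_\infty(W\|Q)=\ln\operatorname{ess\,sup}_\nu \frac{dW/d\nu}{dQ/d\nu}$. A prior on a set $\mathcal{W}$ of probability measures is a probability mass function $P$ whose support is a finite subset of $\mathcal{W}$. Its mean measure $\mu_{\alpha,P}$ has $\nu$-density $\left(\sum_{W}P(W)(\frac{dW}{d\nu})^{\alpha}\right)^{1/\alpha}$ for $\alpha<\infty$ and $\max_{W:P(W)>0}\frac{dW}{d\nu}$ for $\alpha=\infty$, where $\nu$ is any $\sigma$-finite measure dominating the support of $P$. The Rényi mean is $q_{\alpha,P}=\mu_{\alpha,P}/\mu_{\alpha,P}(\mathsf{Y})$. The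 Rényi information is $I_\alpha(P)=\frac{\alpha}{\alpha-1}\ln\mu_{\alpha,P}(\mathsf{Y})$ for $\alpha\neq1,\infty$, $I_\infty(P)=\ln\mu_{\infty,P}(\mathsf{Y})$, and $I_1(P)=\int\sum_W \pi(W|y)\ln\frac{\pi(W|y)}{P(W)}\,\mu_{1,P}(dy)$ with $\pi(W|y)=P(W)\frac{dW}{d\mu_{1,P}}(y)$. The Rényi capacity $C_\alpha(\mathcal{W})$ is the supremum of $I_\alpha(P)$ over all priors $P$ on $\mathcal{W}$. The Rényi center of $\mathcal{W}$ is the unique probability measure $q_{\alpha,\mathcal{W}}$ on $(\mathsf{Y},\mathcal{Y})$ with $C_\alpha(\mathcal{W})=\sup_{W\in\mathcal{W}}D_\alpha(W\|q_{\alpha,\mathcal{W}})$. **Lemma.** Let $\mathcal{W}$ be a nonempty set of probability measures on $(\mathsf{Y},\mathcal{Y})$ with $C_\alpha(\mathcal{W})<\infty$. Then the Rényi center $q_{\alpha,\mathcal{W}}$ exists. For real $\varepsilon\ge0$ put $$\mathcal{W}_{\alpha,\varepsilon}=\{W\in\mathcal{W}: D_\alpha(W\|q_{\alpha,\mathcal{W}})\ge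 C_\alpha(\mathcal{W})-\varepsilon\}.$$ For every $\varepsilon>0$, and also for $\varepsilon=0$ if $\mathcal{W}$ is a finite set, the following hold: 1. $C_\alpha(\mathcal{W}_{\alpha,\varepsilon})=C_\alpha(\mathcal{W})$, and the Rényi center of $\mathcal{W}_{\alpha,\varepsilon}$ exists and equals $q_{\alpha,\mathcal{W}}$. 2. For every prior $P$ on $\mathcal{W}_{\alpha,\varepsilon}$, $$0\le C_\alpha(\mathcal{W})-I_\alpha(P)-D_\alpha(q_{\alpha,P}\|q_{\alpha,\mathcal{W}})\le\varepsilon .$$ 3. If $\alpha=\infty$, then the inequalities in 2 hold for every prior $P$ on $\mathcal{W}$ that assigns positive mass to $\mathcal{W}_{\infty,\varepsilon}$. -/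

import Mathlib

open MeasureTheory
open scoped ENNReal NNReal

noncomputable section

/-- `renyiFinPMF S` is the set of all probability mass functions with finite support contained in
`S`, written as finitely supported weight functions of total mass one. -/
def renyiFinPMF {X : Type*} (S : Set X) : Set (X →₀ ℝ≥0) :=
  {P | (P.support : Set X) ⊆ S ∧ ∑ x ∈ P.support, P x = 1}

/-- The Rényi divergence `D_α(W‖Q)` of order `α ∈ (0, ∞]` between two nonzero finite measures.
The reference measure is `ν = W + Q`; the value does not depend on this choice.
For `α = 1` this is the integral of `log (dW/dQ)` against `W`. Its negative part is always
integrable, so the integral is `⊤` exactly if `W` is not absolutely continuous with respect to `Q`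
or the log-likelihood ratio is not integrable. -/
def renyiDiv {Ω : Type*} [MeasurableSpace Ω] (α : ℝ≥0∞) (W Q : Measure Ω) : EReal :=
  open Classical in
  if α = ⊤ then
    ENNReal.log (essSup (fun y => W.rnDeriv (W + Q) y / Q.rnDeriv (W + Q) y) (W + Q))
  else if α = 1 then
    if W ≪ Q ∧ Integrable (llr W Q) W then ((∫ y, llr W Q y ∂W : ℝ) : EReal) else ⊤
  else
    ((1 / (α.toReal - 1) : ℝ) : EReal) *
      ENNReal.log (∫⁻ y, W.rnDeriv (W + Q) y ^ α.toReal *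
        Q.rnDeriv (W + Q) y ^ (1 - α.toReal) ∂(W + Q))

/-- The mixture `∑ P(W) W`. It dominates every `W` in the support of `P`, and it is the order one
mean measure of `P`. -/
def renyiMixture {Ω : Type*} [MeasurableSpace Ω] (P : ProbabilityMeasure Ω →₀ ℝ≥0) : Measure Ω :=
  ∑ W ∈ P.support, P W • (W : Measure Ω)

/-- The order `α ∈ (0, ∞]` mean of the Radon–Nikodym derivatives `dW/dν` for the prior `P`. -/
def renyiMeanDensity {Ω : Type*} [MeasurableSpace Ω] (α : ℝ≥0∞)
    (P : ProbabilityMeasure Ω →₀ ℝ≥0) (ν : Measure Ω) (y : Ω) : ℝ≥0∞ :=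
  open Classical in
  if α = ⊤ then
    P.support.sup fun W => (W : Measure Ω).rnDeriv ν y
  else
    (∑ W ∈ P.support, (P W : ℝ≥0∞) * (W : Measure Ω).rnDeriv ν y ^ α.toReal) ^ (1 / α.toReal)

/-- The order `α ∈ (0, ∞]` mean measure for the prior `P`. The reference measure is the mixture
`∑ P(W) W`; the mean measure does not depend on this choice. -/
def renyiMeanMeasure {Ω : Type*} [MeasurableSpace Ω] (α : ℝ≥0∞)
    (P : ProbabilityMeasure Ω →₀ ℝ≥0) : Measure Ω :=
  (renyiMixture P).withDensity (renyiMeanDensity α P (renyiMixture P))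

/-- The order one posterior: the probability mass `P(W) dW/dμ_{1,P}(y)` of `W` given `y`. -/
def renyiPosterior {Ω : Type*} [MeasurableSpace Ω]
    (P : ProbabilityMeasure Ω →₀ ℝ≥0) (W : ProbabilityMeasure Ω) (y : Ω) : ℝ :=
  (P W : ℝ) * ((W : Measure Ω).rnDeriv (renyiMeanMeasure 1 P) y).toReal

/-- The Rényi information `I_α(P)` of order `α ∈ (0, ∞]` for the prior `P`. -/
def renyiInfo {Ω : Type*} [MeasurableSpace Ω] (α : ℝ≥0∞)
    (P : ProbabilityMeasure Ω →₀ ℝ≥0) : EReal :=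
  open Classical in
  if α = ⊤ then
    ENNReal.log (renyiMeanMeasure ⊤ P Set.univ)
  else if α = 1 then
    ((∫ y, ∑ W ∈ P.support, renyiPosterior P W y *
        Real.log (renyiPosterior P W y / (P W : ℝ)) ∂(renyiMeanMeasure 1 P) : ℝ) : EReal)
  else
    ((α.toReal / (α.toReal - 1) : ℝ) : EReal) * ENNReal.log (renyiMeanMeasure α P Set.univ)

/-- The Rényi mean `q_{α,P}` of order `α ∈ (0, ∞]`: the mean measure normalized to total mass one. -/
def renyiMean {Ω : Type*} [MeasurableSpace Ω] (α : ℝ≥0∞)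
    (P : ProbabilityMeasure Ω →₀ ℝ≥0) : Measure Ω :=
  (renyiMeanMeasure α P Set.univ)⁻¹ • renyiMeanMeasure α P

/-- The Rényi capacity `C_α(𝒲)`: the supremum of the Rényi information over all finitely supported
priors on `𝒲`. It is `⊥` for the empty family. -/
def renyiCapacity {Ω : Type*} [MeasurableSpace Ω] (α : ℝ≥0∞)
    (𝒲 : Set (ProbabilityMeasure Ω)) : EReal :=
  ⨆ P ∈ renyiFinPMF 𝒲, renyiInfo α P

/-- `q` is the Rényi center of order `α` of `𝒲`: the unique probability measure with
`C_α(𝒲) = sup_{W ∈ 𝒲} D_α(W‖q)`. -/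
def IsRenyiCenter {Ω : Type*} [MeasurableSpace Ω] (α : ℝ≥0∞)
    (𝒲 : Set (ProbabilityMeasure Ω)) (q : ProbabilityMeasure Ω) : Prop :=
  renyiCapacity α 𝒲 = ⨆ W ∈ 𝒲, renyiDiv α (W : Measure Ω) (q : Measure Ω) ∧
  ∀ q' : ProbabilityMeasure Ω,
    renyiCapacity α 𝒲 = ⨆ W ∈ 𝒲, renyiDiv α (W : Measure Ω) (q' : Measure Ω) → q' = q

/-- The subfamily `{W ∈ 𝒲 : D_α(W‖q) ≥ C_α(𝒲) - ε}`. -/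
def renyiSubfamily {Ω : Type*} [MeasurableSpace Ω] (α : ℝ≥0∞)
    (𝒲 : Set (ProbabilityMeasure Ω)) (q : ProbabilityMeasure Ω) (ε : ℝ) :
    Set (ProbabilityMeasure Ω) :=
  {W | W ∈ 𝒲 ∧ renyiDiv α (W : Measure Ω) (q : Measure Ω) ≥ renyiCapacity α 𝒲 - (ε : EReal)}

end

namespace RenyiCenter

open Filter Topology InformationTheory

/-! For finite `α`, with `a = α.toReal`, the Rényi divergence D is replaced by the Tsallis
divergence T (`tsallis a`), an f-divergence with nonnegative convex generator and values in `ℝ≥0∞`.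
The strictly increasing map `level a` turns bounds on D by nonnegative reals into bounds on T
(`renyiDiv_le_coe_iff`, `coe_le_renyiDiv_iff`). The engine is Sibson's identity (`sibson`): the
P-average of T(W‖Q) equals level(I) + exp((a-1)I) · T(q_P‖Q), where I is the information and q_P the
mean of P. Since level(c+d) = level(c) + exp((a-1)c) · level(d) (`level_add`), a bound c on D(W‖q)
over the support of P becomes the bound c - I on D(q_P‖q), from above as well as from below. This
yields item 2, and it also shows that the capacity is at most c as soon as one q has D(W‖q) ≤ c on
the family (`renyiCapacity_le`).

Existence of a q with D(W‖q) ≤ C on the family: the mean r of a mixture of two priors makes the last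
term of Sibson's identity vanish, so the mixed average of T(W‖r) is at most level(C)
(`exists_mix_tsallis_le`). For two nearly optimal priors this forces their means to be close in
total variation, hence means of an optimal sequence converge to some q. Mixing in a point mass at W
with small weight bounds T(W‖r) for some r close to q, and lower semicontinuity passes to the limit.
Uniqueness holds because every such q is close to the mean of every nearly optimal prior.

Item 1: if the subfamily had capacity C' < C, with q' bounding its divergences by C', then a mixture
of q with a little q' would beat C on the whole family. On the subfamily convexity gives the gain;
off it there is a slack ε that pays for the small loss (`exists_improvement`). This contradicts
`renyiCapacity_le`. For a finite family, the subfamily for ε = 0 contains the one for some positive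
ε.

For `α = ⊤` the same scheme runs on the order of measures: D ≤ c means W ≤ exp(c) Q, and the mean
measure is the least upper bound of the support. A single W in the support then already bounds the
divergence of the mean from below, which is item 3. -/

/-! ### Tsallis generators and their perspectives -/

/-- The generator of the Tsallis divergence of order `a`, normalized so that it vanishes at `1`
together with its derivative. -/
noncomputable def tsallisFun (a x : ℝ) : ℝ :=
  open Classical in if a = 1 then klFun x else (x ^ a - a * x + (a - 1)) / (a - 1)

/-- The slope at infinity of `tsallisFun a`. -/
noncomputable def tsallisSlope (a : ℝ) : ℝ≥0∞ :=
  open Classical in if a < 1 then ENNReal.ofReal (a / (1 - a)) else ⊤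

/-- The perspective `q * f (w / q)` of the function `f = tsallisFun a`. -/
noncomputable def phi (a : ℝ) (w q : ℝ≥0) : ℝ≥0∞ :=
  open Classical in
  if q = 0 then w * tsallisSlope a else ENNReal.ofReal (q * tsallisFun a (w / q))

lemma tsallisFun_of_ne {a : ℝ} (ha : a ≠ 1) (x : ℝ) :
    tsallisFun a x = (x ^ a - a * x + (a - 1)) / (a - 1) := by simp [tsallisFun, ha]

lemma tsallisFun_order_one : tsallisFun 1 = klFun := by ext; simp [tsallisFun]

lemma continuous_tsallisFun {a : ℝ} (ha : 0 < a) : Continuous (tsallisFun a) := by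
  by_cases h : a = 1
  · subst h; rw [tsallisFun_order_one]; exact continuous_klFun
  · have : tsallisFun a = fun x => (x ^ a - a * x + (a - 1)) / (a - 1) :=
      funext (tsallisFun_of_ne h)
    rw [this]
    have := Real.continuous_rpow_const ha.le
    fun_prop

lemma tsallisFun_one (a : ℝ) : tsallisFun a 1 = 0 := by
  by_cases h : a = 1
  · subst h; simp [tsallisFun_order_one, klFun_one]
  · simp [tsallisFun_of_ne h]

lemma convexOn_tsallisFun {a : ℝ} (ha : 0 < a) : ConvexOn ℝ (Set.Ici 0) (tsallisFun a) := by
  rcases lt_trichotomy a 1 with h | h | h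
  · have h1 := (Real.strictConcaveOn_rpow ha h).concaveOn
    refine ⟨convex_Ici 0, fun x hx y hy s t hs ht hst => ?_⟩
    have := h1.2 hx hy hs ht hst
    simp only [tsallisFun_of_ne h.ne, smul_eq_mul] at this ⊢
    have h1a : a - 1 ≠ 0 := by linarith
    have e : s * ((x ^ a - a * x + (a - 1)) / (a - 1)) + t * ((y ^ a - a * y + (a - 1)) / (a - 1))
        = (s * x ^ a + t * y ^ a - a * (s * x + t * y) + (a - 1)) / (a - 1) := by
      obtain rfl : t = 1 - s := by linarith
      field_simp; ring
    rw [e, div_le_div_right_of_neg (by linarith)]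
    linarith
  · subst h; rw [tsallisFun_order_one]; exact convexOn_klFun
  · have h1 := (strictConvexOn_rpow h).convexOn
    refine ⟨convex_Ici 0, fun x hx y hy s t hs ht hst => ?_⟩
    have := h1.2 hx hy hs ht hst
    simp only [tsallisFun_of_ne h.ne', smul_eq_mul] at this ⊢
    have h1a : a - 1 ≠ 0 := by linarith
    have e : s * ((x ^ a - a * x + (a - 1)) / (a - 1)) + t * ((y ^ a - a * y + (a - 1)) / (a - 1))
        = (s * x ^ a + t * y ^ a - a * (s * x + t * y) + (a - 1)) / (a - 1) := by
      obtain rfl : t = 1 - s := by linarith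
      field_simp; ring
    rw [e]
    have : 0 < a - 1 := by linarith
    gcongr

/-- Strict Bernoulli inequality for (1 + (x - 1)) ^ a; it reverses for a < 1, and so does the sign
of the denominator a - 1. -/
lemma tsallisFun_pos {a : ℝ} (ha : 0 < a) {x : ℝ} (hx : 0 ≤ x) (hx1 : x ≠ 1) :
    0 < tsallisFun a x := by
  rcases lt_trichotomy a 1 with h | h | h
  · rw [tsallisFun_of_ne h.ne]
    have := rpow_one_add_lt_one_add_mul_self (s := x - 1) (by linarith)
      (sub_ne_zero.2 hx1) ha h
    rw [add_sub_cancel] at this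
    apply div_pos_of_neg_of_neg <;> linarith
  · subst h; rw [tsallisFun_order_one]
    exact lt_of_le_of_ne (klFun_nonneg hx) fun h => hx1 ((klFun_eq_zero_iff hx).1 h.symm)
  · rw [tsallisFun_of_ne h.ne']
    have := one_add_mul_self_lt_rpow_one_add (s := x - 1) (by linarith) (sub_ne_zero.2 hx1) h
    rw [add_sub_cancel] at this
    apply div_pos <;> linarith

lemma tsallisFun_nonneg {a : ℝ} (ha : 0 < a) {x : ℝ} (hx : 0 ≤ x) : 0 ≤ tsallisFun a x := by
  by_cases h : x = 1
  · simp [h, tsallisFun_one]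
  · exact (tsallisFun_pos ha hx h).le

lemma tendsto_tsallisFun_div_atTop {a : ℝ} (ha : 0 < a) :
    Tendsto (fun x : ℝ => ENNReal.ofReal (tsallisFun a x / x)) atTop (𝓝 (tsallisSlope a)) := by
  have hinv : Tendsto (fun x : ℝ => x⁻¹) atTop (𝓝 0) := tendsto_inv_atTop_zero
  rcases lt_trichotomy a 1 with h | h | h
  · have h1 : Tendsto (fun x : ℝ => x ^ (-(1 - a))) atTop (𝓝 0) :=
      tendsto_rpow_neg_atTop (by linarith)
    have h2 : Tendsto (fun x : ℝ => (x ^ (-(1 - a)) - a + (a - 1) * x⁻¹) / (a - 1)) atTop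
        (𝓝 ((0 - a + (a - 1) * 0) / (a - 1))) :=
      ((h1.sub_const a).add (hinv.const_mul (a - 1))).div_const _
    have h3 : (0 - a + (a - 1) * 0) / (a - 1) = a / (1 - a) := by
      rw [div_eq_div_iff] <;> [ring; linarith; linarith]
    rw [h3] at h2
    simp only [tsallisSlope, h, if_true]
    refine ENNReal.tendsto_ofReal (h2.congr' ?_)
    filter_upwards [eventually_gt_atTop 0] with x hx
    rw [tsallisFun_of_ne h.ne, neg_sub, Real.rpow_sub_one hx.ne']
    field_simp
  · subst h
    simp only [tsallisSlope, lt_irrefl, if_false]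
    refine ENNReal.tendsto_ofReal_atTop.comp ?_
    have h2 : Tendsto (fun x : ℝ => Real.log x + (x⁻¹ - 1)) atTop atTop :=
      Real.tendsto_log_atTop.atTop_add (hinv.sub_const 1)
    refine h2.congr' ?_
    filter_upwards [eventually_gt_atTop 0] with x hx
    rw [tsallisFun_order_one, klFun_apply]
    field_simp
    ring
  · simp only [tsallisSlope, not_lt.2 h.le, if_false]
    refine ENNReal.tendsto_ofReal_atTop.comp ?_
    have h1 : Tendsto (fun x : ℝ => x ^ (a - 1)) atTop atTop := tendsto_rpow_atTop (by linarith)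
    have h2 : Tendsto (fun x : ℝ => (x ^ (a - 1) + (-a + (a - 1) * x⁻¹)) / (a - 1)) atTop atTop :=
      (h1.atTop_add ((hinv.const_mul (a - 1)).const_add (-a))).atTop_div_const (by linarith)
    refine h2.congr' ?_
    filter_upwards [eventually_gt_atTop 0] with x hx
    rw [tsallisFun_of_ne h.ne', Real.rpow_sub_one hx.ne']
    field_simp
    ring

lemma phi_self (a : ℝ) (w : ℝ≥0) : phi a w w = 0 := by
  by_cases h : w = 0
  · simp [phi, h]
  · have : (w : ℝ) ≠ 0 := by exact_mod_cast h
    simp [phi, h, tsallisFun_one]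

lemma phi_zero_left {a : ℝ} (ha : 0 < a) (q : ℝ≥0) : phi a 0 q = q := by
  by_cases h : q = 0
  · simp [phi, h]
  · have : tsallisFun a 0 = 1 := by
      by_cases h1 : a = 1
      · subst h1; simp [tsallisFun_order_one, klFun_zero]
      · have : a - 1 ≠ 0 := sub_ne_zero.2 h1
        rw [tsallisFun_of_ne h1, Real.zero_rpow ha.ne']; field_simp; ring
    simp [phi, h, this]

lemma phi_smul (a : ℝ) (s w q : ℝ≥0) : phi a (s * w) (s * q) = s * phi a w q := by
  by_cases hs : s = 0
  · simp [phi, hs]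
  by_cases h : q = 0
  · simp [phi, h, mul_assoc]
  · have h1 : s * q ≠ 0 := mul_ne_zero hs h
    have hs' : (s : ℝ) ≠ 0 := by exact_mod_cast hs
    simp only [phi, h, h1, if_false, NNReal.coe_mul]
    rw [mul_div_mul_left _ _ hs', mul_assoc, ENNReal.ofReal_mul s.coe_nonneg, ENNReal.ofReal_coe_nnreal]

lemma measurable_phi {a : ℝ} (ha : 0 < a) : Measurable fun p : ℝ≥0 × ℝ≥0 => phi a p.1 p.2 := by
  unfold phi
  refine Measurable.ite (measurable_snd (measurableSet_singleton 0)) ?_ ?_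
  · fun_prop
  · have := (continuous_tsallisFun ha).measurable
    fun_prop

/-- At q = 0 with w ≠ 0, put x = w / q: the perspective is w · f(x) / x, whose limit for x → ∞ is w
times the slope at infinity. For w = 0 the perspective is just q. -/
lemma continuous_phi_right {a : ℝ} (ha : 0 < a) (w : ℝ≥0) : Continuous (phi a w) := by
  rw [continuous_iff_continuousAt]
  intro q
  by_cases hq : q = 0
  · subst hq
    by_cases hw : w = 0
    · subst hw
      have : phi a 0 = fun q : ℝ≥0 => (q : ℝ≥0∞) := funext (phi_zero_left ha)
      rw [this]
      exact ENNReal.continuous_coe.continuousAt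
    have hw' : (0 : ℝ) < w := by positivity
    rw [continuousAt_iff_punctured_nhds]
    have h1 : Tendsto (fun q : ℝ≥0 => (w : ℝ) / q) (𝓝[≠] 0) atTop := by
      refine Tendsto.const_mul_atTop hw' ?_
      refine tendsto_inv_nhdsGT_zero.comp ?_
      refine tendsto_nhdsWithin_iff.2 ⟨?_, ?_⟩
      · exact (NNReal.continuous_coe.tendsto' 0 0 rfl).mono_left nhdsWithin_le_nhds
      · filter_upwards [self_mem_nhdsWithin] with q hq
        exact NNReal.coe_pos.2 (pos_iff_ne_zero.2 hq)
    have h2 := ENNReal.Tendsto.const_mul (a := (w : ℝ≥0∞))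
      ((tendsto_tsallisFun_div_atTop ha).comp h1) (Or.inr ENNReal.coe_ne_top)
    have e : phi a w 0 = w * tsallisSlope a := by simp [phi]
    rw [e]
    refine h2.congr' ?_
    filter_upwards [self_mem_nhdsWithin] with q hq
    have hq0 : q ≠ 0 := hq
    have hq' : (q : ℝ) ≠ 0 := by exact_mod_cast hq0
    simp only [phi, hq0, if_false, Function.comp_apply]
    rw [← ENNReal.ofReal_coe_nnreal, ← ENNReal.ofReal_mul w.coe_nonneg]
    congr 1
    field_simp
  · have hq' : (q : ℝ) ≠ 0 := by exact_mod_cast hq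
    have h1 : ContinuousAt (fun q : ℝ≥0 => ENNReal.ofReal (q * tsallisFun a (w / q))) q := by
      refine ENNReal.continuous_ofReal.continuousAt.comp ?_
      refine NNReal.continuous_coe.continuousAt.mul ?_
      refine (continuous_tsallisFun ha).continuousAt.comp ?_
      exact continuousAt_const.div NNReal.continuous_coe.continuousAt hq'
    refine h1.congr ?_
    filter_upwards [isOpen_ne.mem_nhds hq] with x hx
    have hx : x ≠ 0 := hx
    simp [phi, hx]

/-- The usual argument for perspectives: w / (sq + tr) is the convex combination of w / q and w / r
with weights proportional to sq and tr. -/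
lemma phi_convex_right_of_pos {a : ℝ} (ha : 0 < a) (w : ℝ≥0) {q r s t : ℝ≥0} (hq : q ≠ 0)
    (hr : r ≠ 0) (hst : s + t = 1) :
    phi a w (s * q + t * r) ≤ s * phi a w q + t * phi a w r := by
  have hq' : (0 : ℝ) < q := by positivity
  have hr' : (0 : ℝ) < r := by positivity
  have hst' : (s : ℝ) + t = 1 := by exact_mod_cast hst
  have hm' : (0 : ℝ) < s * q + t * r := by
    rcases eq_or_ne s 0 with h | h
    · have : (t : ℝ) = 1 := by simpa [h] using hst'
      simp [h, this, hr']
    · positivity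
  have hm : s * q + t * r ≠ 0 := by
    intro h; rw [← NNReal.coe_inj] at h; push_cast at h; linarith
  simp only [phi, hq, hr, hm, if_false]
  rw [← ENNReal.ofReal_coe_nnreal, ← ENNReal.ofReal_coe_nnreal, ← ENNReal.ofReal_mul s.coe_nonneg,
    ← ENNReal.ofReal_mul t.coe_nonneg, ← ENNReal.ofReal_add]
  rotate_left
  · exact mul_nonneg s.coe_nonneg (mul_nonneg q.coe_nonneg (tsallisFun_nonneg ha (by positivity)))
  · exact mul_nonneg t.coe_nonneg (mul_nonneg r.coe_nonneg (tsallisFun_nonneg ha (by positivity)))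
  apply ENNReal.ofReal_le_ofReal
  push_cast
  have h := (convexOn_tsallisFun ha).2 
    (show (w / q : ℝ) ∈ Set.Ici 0 from Set.mem_Ici.2 (by positivity))
    (show (w / r : ℝ) ∈ Set.Ici 0 from Set.mem_Ici.2 (by positivity))
    (show 0 ≤ (s * q / (s * q + t * r) : ℝ) by positivity)
    (show 0 ≤ (t * r / (s * q + t * r) : ℝ) by positivity) (by field_simp)
  simp only [smul_eq_mul] at h
  have e : (s * q / (s * q + t * r) * (w / q) + t * r / (s * q + t * r) * (w / r) : ℝ)
      = w / (s * q + t * r) := by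
    field_simp
    rw [hst', mul_one]
  rw [e] at h
  calc _ ≤ (s * q + t * r : ℝ) * (s * q / (s * q + t * r) * tsallisFun a (w / q) +
        t * r / (s * q + t * r) * tsallisFun a (w / r)) := by gcongr
    _ = _ := by field_simp

/-- Zero arguments are reached by shifting q and r by a positive e and letting e tend to 0. -/
lemma phi_convex_right {a : ℝ} (ha : 0 < a) (w : ℝ≥0) (q r : ℝ≥0) {s t : ℝ≥0}
    (hst : s + t = 1) :
    phi a w (s * q + t * r) ≤ s * phi a w q + t * phi a w r := by
  have h1 : Tendsto (fun e : ℝ≥0 => phi a w (s * (q + e) + t * (r + e))) (𝓝[≠] 0)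
      (𝓝 (phi a w (s * q + t * r))) := by
    have : Continuous fun e : ℝ≥0 => phi a w (s * (q + e) + t * (r + e)) :=
      (continuous_phi_right ha w).comp (by fun_prop)
    exact (this.tendsto' 0 _ (by simp)).mono_left nhdsWithin_le_nhds
  have h2 : Tendsto (fun e : ℝ≥0 => s * phi a w (q + e) + t * phi a w (r + e)) (𝓝[≠] 0)
      (𝓝 (s * phi a w q + t * phi a w r)) := by
    have c : ∀ x : ℝ≥0, Continuous fun e : ℝ≥0 => phi a w (x + e) := fun x =>
      (continuous_phi_right ha w).comp (by fun_prop)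
    have : Continuous fun e : ℝ≥0 => s * phi a w (q + e) + t * phi a w (r + e) :=
      ((ENNReal.continuous_const_mul ENNReal.coe_ne_top).comp (c q)).add
        ((ENNReal.continuous_const_mul ENNReal.coe_ne_top).comp (c r))
    exact (this.tendsto' 0 _ (by simp)).mono_left nhdsWithin_le_nhds
  refine le_of_tendsto_of_tendsto h1 h2 ?_
  filter_upwards [self_mem_nhdsWithin] with e he
  have he : e ≠ 0 := he
  exact phi_convex_right_of_pos ha w (by simp [he]) (by simp [he]) hst

/-- The generator f vanishes at 1 and is positive at 1 + δ, so by convexity it grows at least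
linearly beyond 1 + δ. Integrated over an event, this replaces Pinsker's inequality for all orders
at once. -/
lemma exists_le_add_mul_phi {a : ℝ} (ha : 0 < a) {δ : ℝ≥0} (hδ : 0 < δ) :
    ∃ c : ℝ≥0, ∀ w q : ℝ≥0, (w : ℝ≥0∞) ≤ (1 + δ) * q + c * phi a w q := by
  have hf := tsallisFun_pos ha (x := 1 + δ) (by positivity) (by simp [hδ.ne'])
  obtain ⟨c, hc⟩ : ∃ c : ℝ≥0, (c : ℝ) = δ / tsallisFun a (1 + δ) :=
    ⟨⟨δ / tsallisFun a (1 + δ), by positivity⟩, rfl⟩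
  have hpos : ∀ w q : ℝ≥0, q ≠ 0 → (w : ℝ≥0∞) ≤ (1 + δ) * q + c * phi a w q := by
    intro w q hq
    have hq' : (0 : ℝ) < q := by positivity
    have key : ∀ x : ℝ, 0 ≤ x → x ≤ 1 + δ + c * tsallisFun a x := by
      intro x hx
      rcases le_total x (1 + δ) with h | h
      · have : 0 ≤ (c : ℝ) * tsallisFun a x := mul_nonneg c.coe_nonneg (tsallisFun_nonneg ha hx)
        linarith
      · have hδ' : (0 : ℝ) < δ := hδ
        have hx1 : 0 < x - 1 := by linarith
        -- The weight δ / (x - 1) places the combination of 1 and x exactly at 1 + δ.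
        have := (convexOn_tsallisFun ha).2 (show (1 : ℝ) ∈ Set.Ici 0 from Set.mem_Ici.2 zero_le_one)
          (show x ∈ Set.Ici 0 from hx)
          (show 0 ≤ 1 - (δ : ℝ) / (x - 1) by rw [sub_nonneg, div_le_one hx1]; linarith)
          (show 0 ≤ (δ : ℝ) / (x - 1) by positivity) (by ring)
        simp only [smul_eq_mul, tsallisFun_one, mul_zero, zero_add, mul_one] at this
        rw [show 1 - δ / (x - 1) + δ / (x - 1) * x = 1 + δ by field_simp; ring] at this
        have h2 : x - 1 ≤ c * tsallisFun a x := by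
          rw [hc, div_mul_eq_mul_div, le_div_iff₀ hf]
          rw [div_mul_eq_mul_div, le_div_iff₀ hx1] at this
          linarith
        have h3 : (0 : ℝ) ≤ δ := δ.coe_nonneg
        linarith
    have h := key (w / q) (by positivity)
    have h' : (w : ℝ) ≤ (1 + δ) * q + c * (q * tsallisFun a (w / q)) := by
      rw [div_le_iff₀ hq'] at h
      linarith
    simp only [phi, hq, if_false]
    have h0 : 0 ≤ (q : ℝ) * tsallisFun a (w / q) :=
      mul_nonneg q.coe_nonneg (tsallisFun_nonneg ha (by positivity))
    calc (w : ℝ≥0∞) = ENNReal.ofReal w := by simp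
      _ ≤ ENNReal.ofReal ((1 + δ) * q + c * (q * tsallisFun a (w / q))) :=
        ENNReal.ofReal_le_ofReal h'
      _ = _ := by
        rw [ENNReal.ofReal_add (by positivity) (mul_nonneg c.coe_nonneg h0),
          ENNReal.ofReal_mul (by positivity), ENNReal.ofReal_mul c.coe_nonneg,
          ENNReal.ofReal_add zero_le_one δ.coe_nonneg]
        simp
  refine ⟨c, fun w q => ?_⟩
  have hc1 : Continuous fun q : ℝ≥0 => (1 + δ : ℝ≥0∞) * q + c * phi a w q :=
    ((ENNReal.continuous_const_mul (by simp)).comp ENNReal.continuous_coe).add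
      ((ENNReal.continuous_const_mul ENNReal.coe_ne_top).comp (continuous_phi_right ha w))
  by_cases hq : q = 0
  · have := (hc1.tendsto q).mono_left (nhdsWithin_le_nhds (s := {q}ᶜ))
    refine ge_of_tendsto this ?_
    filter_upwards [self_mem_nhdsWithin] with r hr
    subst hq
    exact hpos w r hr
  · exact hpos w q hq

/-! ### Finite-valued densities and integrals of homogeneous functions of them -/

variable {Ω : Type*} [MeasurableSpace Ω]

/-- The Radon–Nikodym derivative as a function with finite values. -/
noncomputable def dens (W ν : Measure Ω) (y : Ω) : ℝ≥0 := (W.rnDeriv ν y).toNNReal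

lemma measurable_dens (W ν : Measure Ω) : Measurable (dens W ν) :=
  (Measure.measurable_rnDeriv W ν).ennreal_toNNReal

lemma coe_dens (W ν : Measure Ω) [IsFiniteMeasure W] :
    ∀ᵐ y ∂ν, (dens W ν y : ℝ≥0∞) = W.rnDeriv ν y := by
  filter_upwards [Measure.rnDeriv_lt_top W ν] with y hy
  exact ENNReal.coe_toNNReal hy.ne

lemma withDensity_dens {W ν : Measure Ω} [IsFiniteMeasure W] [IsFiniteMeasure ν] (h : W ≪ ν) :
    ν.withDensity (fun y => (dens W ν y : ℝ≥0∞)) = W := by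
  rw [withDensity_congr_ae (coe_dens W ν), Measure.withDensity_rnDeriv_eq _ _ h]

lemma lintegral_dens_mul {W ν : Measure Ω} [IsFiniteMeasure W] [IsFiniteMeasure ν] (h : W ≪ ν)
    {f : Ω → ℝ≥0∞} (hf : Measurable f) : ∫⁻ y, dens W ν y * f y ∂ν = ∫⁻ y, f y ∂W := by
  rw [← lintegral_rnDeriv_mul h hf.aemeasurable]
  apply lintegral_congr_ae
  filter_upwards [coe_dens W ν] with y hy
  rw [hy]

lemma setLIntegral_dens {W ν : Measure Ω} [IsFiniteMeasure W] [IsFiniteMeasure ν] (h : W ≪ ν)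
    {A : Set Ω} (hA : MeasurableSet A) : ∫⁻ y in A, dens W ν y ∂ν = W A := by
  rw [← withDensity_apply _ hA, withDensity_dens h]

lemma lintegral_dens {W ν : Measure Ω} [IsFiniteMeasure W] [IsFiniteMeasure ν] (h : W ≪ ν) :
    ∫⁻ y, dens W ν y ∂ν = W Set.univ := by
  rw [← setLIntegral_dens h MeasurableSet.univ, Measure.restrict_univ]

lemma dens_ae_eq {W ν : Measure Ω} [IsFiniteMeasure W] [IsFiniteMeasure ν] {w : Ω → ℝ≥0}
    (hw : Measurable w) (h : ν.withDensity (fun y => (w y : ℝ≥0∞)) = W) : dens W ν =ᵐ[ν] w := by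
  subst h
  filter_upwards [Measure.rnDeriv_withDensity ν hw.coe_nnreal_ennreal] with y hy
  simp [dens, hy]

lemma dens_self (ν : Measure Ω) [IsFiniteMeasure ν] : dens ν ν =ᵐ[ν] fun _ => 1 :=
  dens_ae_eq measurable_const (by simp)

lemma dens_mul_dens {W μ ν : Measure Ω} [IsFiniteMeasure W] [IsFiniteMeasure μ]
    [IsFiniteMeasure ν] (h : W ≪ μ) :
    ∀ᵐ y ∂ν, dens W μ y * dens μ ν y = dens W ν y := by
  filter_upwards [Measure.rnDeriv_mul_rnDeriv (κ := ν) h] with y hy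
  simp only [dens, ← hy, Pi.mul_apply, ENNReal.toNNReal_mul]

lemma dens_add {W Q ν : Measure Ω} [IsFiniteMeasure W] [IsFiniteMeasure Q] [IsFiniteMeasure ν]
    (hW : W ≪ ν) (hQ : Q ≪ ν) : dens (W + Q) ν =ᵐ[ν] fun y => dens W ν y + dens Q ν y := by
  refine dens_ae_eq ((measurable_dens _ _).add (measurable_dens _ _)) ?_
  simp only [ENNReal.coe_add]
  have := withDensity_add_left (μ := ν) (measurable_dens W ν).coe_nnreal_ennreal
    fun y => (dens Q ν y : ℝ≥0∞)
  rw [withDensity_dens hW, withDensity_dens hQ] at this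
  exact this

lemma dens_smul {W ν : Measure Ω} [IsFiniteMeasure W] [IsFiniteMeasure ν]
    (hW : W ≪ ν) (c : ℝ≥0) : dens (c • W) ν =ᵐ[ν] fun y => c * dens W ν y := by
  refine dens_ae_eq ((measurable_dens _ _).const_mul c) ?_
  simp only [ENNReal.coe_mul]
  have := withDensity_smul (μ := ν) (c : ℝ≥0∞) (measurable_dens W ν).coe_nnreal_ennreal
  rw [withDensity_dens hW] at this
  exact this

/-- The integral of a homogeneous function of two densities. -/
noncomputable def homInt (ψ : ℝ≥0 → ℝ≥0 → ℝ≥0∞) (W Q : Measure Ω) : ℝ≥0∞ :=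
  ∫⁻ y, ψ (dens W (W + Q) y) (dens Q (W + Q) y) ∂(W + Q)

/-- By the chain rule both densities are multiplied by the density of `W + Q` with respect to `ν`,
and homogeneity pulls that factor out. Hence several measures can be compared over one common `ν`.
-/
lemma homInt_eq {ψ : ℝ≥0 → ℝ≥0 → ℝ≥0∞} (hψ : Measurable fun p : ℝ≥0 × ℝ≥0 => ψ p.1 p.2)
    (hs : ∀ s w q, ψ (s * w) (s * q) = s * ψ w q) {W Q ν : Measure Ω} [IsFiniteMeasure W]
    [IsFiniteMeasure Q] [IsFiniteMeasure ν] (hW : W ≪ ν) (hQ : Q ≪ ν) :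
    homInt ψ W Q = ∫⁻ y, ψ (dens W ν y) (dens Q ν y) ∂ν := by
  have hμ : W + Q ≪ ν := Measure.AbsolutelyContinuous.add_left hW hQ
  rw [homInt, ← lintegral_dens_mul hμ]
  · apply lintegral_congr_ae
    filter_upwards [dens_mul_dens (ν := ν) (Measure.AbsolutelyContinuous.rfl.add_right Q : W ≪ W + Q),
      dens_mul_dens (ν := ν) (show Q ≪ W + Q from
        add_comm Q W ▸ Measure.AbsolutelyContinuous.rfl.add_right W)] with y h1 h2
    rw [← hs, mul_comm, h1, mul_comm, h2]
  · exact hψ.comp ((measurable_dens _ _).prodMk (measurable_dens _ _))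

/-! ### Tsallis divergence, Hellinger integral and Kullback–Leibler divergence -/

/-- The Tsallis divergence of order `a`. -/
noncomputable def tsallis (a : ℝ) (W Q : Measure Ω) : ℝ≥0∞ := homInt (phi a) W Q

lemma tsallis_eq {a : ℝ} (ha : 0 < a) {W Q ν : Measure Ω} [IsFiniteMeasure W]
    [IsFiniteMeasure Q] [IsFiniteMeasure ν] (hW : W ≪ ν) (hQ : Q ≪ ν) :
    tsallis a W Q = ∫⁻ y, phi a (dens W ν y) (dens Q ν y) ∂ν :=
  homInt_eq (measurable_phi ha) (phi_smul a) hW hQ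

lemma measurable_phi_dens {a : ℝ} (ha : 0 < a) (W Q ν : Measure Ω) :
    Measurable fun y => phi a (dens W ν y) (dens Q ν y) :=
  (measurable_phi ha).comp ((measurable_dens _ _).prodMk (measurable_dens _ _))

/-- The integrand of the Hellinger integral of order `a`. -/
noncomputable def hell (a : ℝ) (w q : ℝ≥0) : ℝ≥0∞ := (w : ℝ≥0∞) ^ a * (q : ℝ≥0∞) ^ (1 - a)

lemma measurable_hell (a : ℝ) : Measurable fun p : ℝ≥0 × ℝ≥0 => hell a p.1 p.2 := by
  unfold hell; fun_prop

lemma hell_smul {a : ℝ} (ha : 0 < a) (s w q : ℝ≥0) : hell a (s * w) (s * q) = s * hell a w q := by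
  unfold hell
  rcases eq_or_ne s 0 with rfl | hs
  · simp [ENNReal.zero_rpow_of_pos ha]
  push_cast
  have hs' : (s : ℝ≥0∞) ≠ 0 := by simpa
  rw [ENNReal.mul_rpow_of_nonneg _ _ ha.le]
  have : ((s : ℝ≥0∞) * q) ^ (1 - a) = (s : ℝ≥0∞) ^ (1 - a) * (q : ℝ≥0∞) ^ (1 - a) :=
    ENNReal.mul_rpow_of_ne_top ENNReal.coe_ne_top ENNReal.coe_ne_top _
  rw [this, mul_mul_mul_comm, ← ENNReal.rpow_add _ _ hs' ENNReal.coe_ne_top]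
  simp

lemma hell_smul_left {a : ℝ} (ha : 0 < a) (s w q : ℝ≥0) :
    hell a (s * w) q = (s : ℝ≥0∞) ^ a * hell a w q := by
  unfold hell
  push_cast
  rw [ENNReal.mul_rpow_of_nonneg _ _ ha.le, mul_assoc]

/-- The Hellinger integral of order `a`. -/
noncomputable def hellInt (a : ℝ) (W Q : Measure Ω) : ℝ≥0∞ := homInt (hell a) W Q

lemma hellInt_eq {a : ℝ} (ha : 0 < a) {W Q ν : Measure Ω} [IsFiniteMeasure W]
    [IsFiniteMeasure Q] [IsFiniteMeasure ν] (hW : W ≪ ν) (hQ : Q ≪ ν) :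
    hellInt a W Q = ∫⁻ y, hell a (dens W ν y) (dens Q ν y) ∂ν :=
  homInt_eq (measurable_hell a) (hell_smul ha) hW hQ

lemma measurable_hell_dens (a : ℝ) (W Q ν : Measure Ω) :
    Measurable fun y => hell a (dens W ν y) (dens Q ν y) :=
  (measurable_hell a).comp ((measurable_dens _ _).prodMk (measurable_dens _ _))

lemma ac_add_left (W Q : Measure Ω) : W ≪ W + Q := Measure.AbsolutelyContinuous.rfl.add_right Q

lemma ac_add_right (W Q : Measure Ω) : Q ≪ W + Q := add_comm Q W ▸ ac_add_left Q W

lemma tsallis_self {a : ℝ} (W : Measure Ω) : tsallis a W W = 0 := by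
  simp [tsallis, homInt, phi_self]

/-- Up to linear terms the Hellinger integrand is (a - 1) times the perspective; the additive form
avoids truncated subtraction. At q = 0 < w both sides are `⊤`. -/
lemma hell_of_one_lt {a : ℝ} (ha : 1 < a) (w q : ℝ≥0) :
    hell a w q + ENNReal.ofReal (a - 1) * q
      = ENNReal.ofReal (a - 1) * phi a w q + ENNReal.ofReal a * w := by
  have ha1 : 0 < a - 1 := by linarith
  have ha0 : 0 < a := by linarith
  rcases eq_or_ne q 0 with rfl | hq
  · rcases eq_or_ne w 0 with rfl | hw
    · simp [hell, phi, ha0]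
    · simp [hell, phi, tsallisSlope, not_lt.2 ha.le, hw, ENNReal.zero_rpow_of_neg (sub_neg.2 ha),
        ENNReal.mul_top, (ENNReal.rpow_pos (ENNReal.coe_pos.2 (pos_iff_ne_zero.2 hw))
          ENNReal.coe_ne_top).ne']
      rw [ENNReal.mul_top (by simpa using ha), top_add]
  · have hq' : (0 : ℝ) < q := by positivity
    have h1 : hell a w q = ENNReal.ofReal ((w : ℝ) ^ a * (q : ℝ) ^ (1 - a)) := by
      rw [hell, ENNReal.ofReal_mul (by positivity), ← ENNReal.ofReal_coe_nnreal,
        ← ENNReal.ofReal_coe_nnreal, ENNReal.ofReal_rpow_of_nonneg w.coe_nonneg ha0.le,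
        ENNReal.ofReal_rpow_of_pos hq']
    have h2 := tsallisFun_nonneg ha0 (x := w / q) (by positivity)
    simp only [phi, hq, if_false, h1]
    rw [← ENNReal.ofReal_coe_nnreal, ← ENNReal.ofReal_coe_nnreal, ← ENNReal.ofReal_mul ha1.le,
      ← ENNReal.ofReal_mul ha1.le, ← ENNReal.ofReal_mul ha0.le, ← ENNReal.ofReal_add
      (by positivity) (by positivity), ← ENNReal.ofReal_add (by positivity) (by positivity)]
    congr 1
    rw [tsallisFun_of_ne ha.ne', Real.div_rpow w.coe_nonneg q.coe_nonneg,
      Real.rpow_sub hq', Real.rpow_one]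
    have := ha1.ne'
    have : (q : ℝ) ^ a ≠ 0 := by positivity
    field_simp
    ring

/-- For a < 1 the perspective moves to the side of the Hellinger integrand to keep all coefficients
nonnegative. At q = 0 the finite slope a / (1 - a) accounts for the whole term a · w. -/
lemma hell_of_lt_one {a : ℝ} (ha0 : 0 < a) (ha : a < 1) (w q : ℝ≥0) :
    hell a w q + ENNReal.ofReal (1 - a) * phi a w q
      = ENNReal.ofReal a * w + ENNReal.ofReal (1 - a) * q := by
  have ha1 : 0 < 1 - a := by linarith
  rcases eq_or_ne q 0 with rfl | hq
  · simp only [hell, phi, tsallisSlope, ha, if_true, ENNReal.coe_zero, mul_zero, add_zero,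
      ENNReal.zero_rpow_of_pos ha1, zero_add]
    rw [mul_comm (w : ℝ≥0∞), ← mul_assoc, ← ENNReal.ofReal_mul ha1.le]
    congr 2; field_simp
  · have hq' : (0 : ℝ) < q := by positivity
    have h1 : hell a w q = ENNReal.ofReal ((w : ℝ) ^ a * (q : ℝ) ^ (1 - a)) := by
      rw [hell, ENNReal.ofReal_mul (by positivity), ← ENNReal.ofReal_coe_nnreal,
        ← ENNReal.ofReal_coe_nnreal, ENNReal.ofReal_rpow_of_nonneg w.coe_nonneg ha0.le,
        ENNReal.ofReal_rpow_of_pos hq']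
    have h2 := tsallisFun_nonneg ha0 (x := w / q) (by positivity)
    simp only [phi, hq, if_false, h1]
    rw [← ENNReal.ofReal_coe_nnreal, ← ENNReal.ofReal_coe_nnreal, ← ENNReal.ofReal_mul ha1.le,
      ← ENNReal.ofReal_mul ha1.le, ← ENNReal.ofReal_mul ha0.le, ← ENNReal.ofReal_add
      (by positivity) (by positivity), ← ENNReal.ofReal_add (by positivity) (by positivity)]
    congr 1
    rw [tsallisFun_of_ne ha.ne, Real.div_rpow w.coe_nonneg q.coe_nonneg,
      Real.rpow_sub hq', Real.rpow_one]
    have : a - 1 ≠ 0 := by linarith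
    have : (q : ℝ) ^ a ≠ 0 := by positivity
    field_simp
    ring

lemma hellInt_of_one_lt {a : ℝ} (ha : 1 < a) (W Q : Measure Ω) [IsProbabilityMeasure W]
    [IsProbabilityMeasure Q] :
    hellInt a W Q = 1 + ENNReal.ofReal (a - 1) * tsallis a W Q := by
  have ha0 : 0 < a := by linarith
  have h : ∫⁻ y, (hell a (dens W (W + Q) y) (dens Q (W + Q) y)
      + ENNReal.ofReal (a - 1) * dens Q (W + Q) y) ∂(W + Q)
      = ∫⁻ y, (ENNReal.ofReal (a - 1) * phi a (dens W (W + Q) y) (dens Q (W + Q) y)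
        + ENNReal.ofReal a * dens W (W + Q) y) ∂(W + Q) :=
    lintegral_congr fun y => hell_of_one_lt ha _ _
  rw [lintegral_add_left (measurable_hell_dens a W Q _),
    lintegral_add_left ((measurable_phi_dens ha0 W Q _).const_mul _),
    lintegral_const_mul _ (measurable_dens _ _).coe_nnreal_ennreal,
    lintegral_const_mul _ (measurable_dens _ _).coe_nnreal_ennreal,
    lintegral_const_mul _ (measurable_phi_dens ha0 W Q _),
    lintegral_dens (ac_add_left W Q), lintegral_dens (ac_add_right W Q), measure_univ,
    measure_univ, mul_one, mul_one] at h
  have e : ENNReal.ofReal a = 1 + ENNReal.ofReal (a - 1) := by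
    rw [← ENNReal.ofReal_one, ← ENNReal.ofReal_add zero_le_one (by linarith)]; congr 1; ring
  rw [e, ← add_assoc] at h
  rw [hellInt, tsallis, homInt, homInt, (ENNReal.add_left_inj ENNReal.ofReal_ne_top).1 h, add_comm]

lemma hellInt_of_lt_one {a : ℝ} (ha0 : 0 < a) (ha : a < 1) (W Q : Measure Ω)
    [IsProbabilityMeasure W] [IsProbabilityMeasure Q] :
    hellInt a W Q + ENNReal.ofReal (1 - a) * tsallis a W Q = 1 := by
  have h : ∫⁻ y, (hell a (dens W (W + Q) y) (dens Q (W + Q) y)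
      + ENNReal.ofReal (1 - a) * phi a (dens W (W + Q) y) (dens Q (W + Q) y)) ∂(W + Q)
      = ∫⁻ y, (ENNReal.ofReal a * dens W (W + Q) y
        + ENNReal.ofReal (1 - a) * dens Q (W + Q) y) ∂(W + Q) :=
    lintegral_congr fun y => hell_of_lt_one ha0 ha _ _
  rw [lintegral_add_left (measurable_hell_dens a W Q _),
    lintegral_add_left ((measurable_dens _ _).coe_nnreal_ennreal.const_mul _),
    lintegral_const_mul _ (measurable_dens _ _).coe_nnreal_ennreal,
    lintegral_const_mul _ (measurable_dens _ _).coe_nnreal_ennreal,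
    lintegral_const_mul _ (measurable_phi_dens ha0 W Q _),
    lintegral_dens (ac_add_left W Q), lintegral_dens (ac_add_right W Q), measure_univ,
    measure_univ, mul_one, mul_one] at h
  have e : ENNReal.ofReal a + ENNReal.ofReal (1 - a) = 1 := by
    rw [← ENNReal.ofReal_add ha0.le (by linarith)]; simp
  rw [e] at h
  exact h

/-- Without absolute continuity both sides are `⊤`: a finite integral makes the integrand finite
a.e., and the infinite slope then forces the density of `W` to vanish wherever that of `Q` does. -/
lemma tsallis_one_eq_klDiv (W Q : Measure Ω) [IsFiniteMeasure W] [IsFiniteMeasure Q] :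
    tsallis 1 W Q = klDiv W Q := by
  by_cases h : W ≪ Q
  · rw [klDiv_eq_lintegral_klFun, if_pos h, tsallis_eq one_pos h Measure.AbsolutelyContinuous.rfl]
    apply lintegral_congr_ae
    filter_upwards [dens_self Q] with y hy
    rw [hy]
    simp [phi, tsallisFun_order_one, dens, ENNReal.coe_toNNReal_eq_toReal]
  · rw [klDiv_of_not_ac h]
    by_contra ht
    apply h
    have h1 := ae_lt_top (measurable_phi_dens one_pos W Q (W + Q)) ht
    intro A hA
    obtain ⟨B, hAB, hB, hB0⟩ := exists_measurable_superset_of_null hA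
    refine measure_mono_null hAB ?_
    have h2 := setLIntegral_dens (ac_add_right W Q) hB
    rw [hB0, lintegral_eq_zero_iff (measurable_dens _ _).coe_nnreal_ennreal] at h2
    rw [← setLIntegral_dens (ac_add_left W Q) hB,
      lintegral_eq_zero_iff (measurable_dens _ _).coe_nnreal_ennreal]
    filter_upwards [h2, ae_restrict_of_ae h1] with y hy1 hy2
    have hq : dens Q (W + Q) y = 0 := by simpa using hy1
    by_contra hw
    have hw : dens W (W + Q) y ≠ 0 := by simpa using hw
    rw [hq] at hy2
    simp [phi, tsallisSlope, ENNReal.mul_top, hw] at hy2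

/-! ### Total variation: control by the divergence, completeness, lower semicontinuity -/

lemma exists_forall_tsallis_le {a : ℝ} (ha : 0 < a) {δ : ℝ≥0} (hδ : 0 < δ) :
    ∃ η : ℝ, 0 < η ∧ ∀ p q : Measure Ω, IsProbabilityMeasure p → IsProbabilityMeasure q →
      tsallis a p q ≤ ENNReal.ofReal η → ∀ A, MeasurableSet A → p A ≤ q A + δ := by
  have hδ2 : 0 < δ / 2 := by positivity
  obtain ⟨c, hc⟩ := exists_le_add_mul_phi ha hδ2
  -- This makes c · T at most δ / 2, with c + 1 as a safe denominator. The other δ / 2 covers the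
  -- factor 1 + δ / 2, because q A ≤ 1.
  refine ⟨(δ / 2 / (c + 1) : ℝ≥0), by positivity, fun p q _ _ h A hA => ?_⟩
  rw [ENNReal.ofReal_coe_nnreal] at h
  set ν := p + q
  have h1 : p A ≤ (1 + (δ / 2 : ℝ≥0)) * q A + c * tsallis a p q := by
    calc p A = ∫⁻ y in A, dens p ν y ∂ν := (setLIntegral_dens (ac_add_left p q) hA).symm
      _ ≤ ∫⁻ y in A, ((1 + (δ / 2 : ℝ≥0)) * dens q ν y
          + c * phi a (dens p ν y) (dens q ν y)) ∂ν := lintegral_mono fun y => hc _ _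
      _ = (1 + (δ / 2 : ℝ≥0)) * q A + c * ∫⁻ y in A, phi a (dens p ν y) (dens q ν y) ∂ν := by
        rw [lintegral_add_left ((measurable_dens _ _).coe_nnreal_ennreal.const_mul _),
          lintegral_const_mul _ (measurable_dens _ _).coe_nnreal_ennreal,
          lintegral_const_mul _ (measurable_phi_dens ha _ _ _),
          setLIntegral_dens (ac_add_right p q) hA]
      _ ≤ _ := by
        gcongr
        exact lintegral_mono' Measure.restrict_le_self le_rfl
  have h2 : (c : ℝ≥0∞) * tsallis a p q ≤ (δ / 2 : ℝ≥0) := by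
    calc (c : ℝ≥0∞) * tsallis a p q ≤ c * (δ / 2 / (c + 1) : ℝ≥0) := by gcongr
      _ ≤ _ := by
        rw [← ENNReal.coe_mul, ENNReal.coe_le_coe, mul_div_assoc', div_le_iff₀ (by positivity),
          mul_comm]
        gcongr
        exact le_self_add
  calc p A ≤ _ := h1
    _ ≤ q A + (δ / 2 : ℝ≥0) * 1 + (δ / 2 : ℝ≥0) := by
      rw [add_mul, one_mul]
      gcongr
      exact prob_le_one
    _ = q A + δ := by
      rw [mul_one, add_assoc, ← ENNReal.coe_add, add_halves]

/-- Passing to complements shows that a one-sided uniform bound already controls total variation. -/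
lemma le_add_symm_of_forall {p q : Measure Ω} [IsProbabilityMeasure p] [IsProbabilityMeasure q]
    {δ : ℝ≥0} (h : ∀ A, MeasurableSet A → p A ≤ q A + δ) {A : Set Ω} (hA : MeasurableSet A) :
    q A ≤ p A + δ := by
  have h1 := h Aᶜ hA.compl
  have h2 : (1 : ℝ≥0∞) = p A + p Aᶜ := (prob_add_prob_compl hA).symm
  have h3 : q A + q Aᶜ = 1 := prob_add_prob_compl hA
  have : q A + q Aᶜ ≤ p A + δ + q Aᶜ := by
    rw [h3, h2, add_assoc, add_comm (δ : ℝ≥0∞)]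
    gcongr
  exact (ENNReal.add_le_add_iff_right (measure_ne_top q _)).1 this

lemma exists_isFiniteMeasure_forall_ac (p : ℕ → Measure Ω) [∀ n, IsProbabilityMeasure (p n)] :
    ∃ ν : Measure Ω, IsFiniteMeasure ν ∧ ∀ n, p n ≪ ν :=
  ⟨(Measure.sum p).toFinite, inferInstance, fun n =>
    (Measure.absolutelyContinuous_sum_right n Measure.AbsolutelyContinuous.rfl).trans
      (absolutelyContinuous_toFinite _)⟩

lemma mul_measure_le_of_add_le {p q ν : Measure Ω} [IsFiniteMeasure p] [IsFiniteMeasure q]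
    [IsFiniteMeasure ν] (hp : p ≪ ν) (hq : q ≪ ν) {δ ε : ℝ≥0}
    (h : ∀ A, MeasurableSet A → p A ≤ q A + δ) :
    (ε : ℝ≥0∞) * ν {y | dens q ν y + ε ≤ dens p ν y} ≤ δ := by
  have hA : MeasurableSet {y | dens q ν y + ε ≤ dens p ν y} :=
    measurableSet_le ((measurable_dens _ _).add_const _) (measurable_dens _ _)
  set A := {y | dens q ν y + ε ≤ dens p ν y}
  have h1 : q A + ε * ν A ≤ p A := by
    rw [← setLIntegral_dens hq hA, ← setLIntegral_dens hp hA, ← setLIntegral_const,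
      ← lintegral_add_left (measurable_dens _ _).coe_nnreal_ennreal]
    refine setLIntegral_mono (measurable_dens _ _).coe_nnreal_ennreal fun y hy => ?_
    exact_mod_cast hy
  exact (ENNReal.add_le_add_iff_left (measure_ne_top q A)).1 (h1.trans (h A hA))

/-- Where two densities differ by at least ε, one exceeds the other; on each of the two one-sided
sets the measures differ by at least ε times the `ν`-mass. Convergence in measure supplies the a.e.
convergent subsequence needed for Fatou. -/
lemma tendstoInMeasure_dens {p : ℕ → Measure Ω} {q ν : Measure Ω}
    [∀ n, IsProbabilityMeasure (p n)] [IsProbabilityMeasure q] [IsFiniteMeasure ν]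
    (hp : ∀ n, p n ≪ ν) (hq : q ≪ ν)
    (h : ∀ δ : ℝ≥0, 0 < δ → ∃ N, ∀ n ≥ N, ∀ A, MeasurableSet A → p n A ≤ q A + δ) :
    TendstoInMeasure ν (fun n => dens (p n) ν) atTop (dens q ν) := by
  rw [tendstoInMeasure_iff_dist]
  intro ε hε
  lift ε to ℝ≥0 using hε.le
  have hε' : 0 < ε := hε
  rw [ENNReal.tendsto_atTop_zero]
  intro η hη
  obtain ⟨η', hη', hle⟩ : ∃ η' : ℝ≥0, 0 < η' ∧ (η' : ℝ≥0∞) ≤ η := by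
    obtain ⟨r, h1, h2⟩ := ENNReal.lt_iff_exists_nnreal_btwn.1 hη
    exact ⟨r, by simpa using h1, h2.le⟩
  obtain ⟨N, hN⟩ := h (ε * η' / 2) (by positivity)
  refine ⟨N, fun n hn => le_trans ?_ hle⟩
  have h1 := mul_measure_le_of_add_le (hp n) hq (ε := ε) (hN n hn)
  have h2 := mul_measure_le_of_add_le hq (hp n) (ε := ε)
    (fun A hA => le_add_symm_of_forall (hN n hn) hA)
  have h3 : {y | (ε : ℝ) ≤ dist (dens (p n) ν y) (dens q ν y)} ⊆
      {y | dens q ν y + ε ≤ dens (p n) ν y} ∪ {y | dens (p n) ν y + ε ≤ dens q ν y} := by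
    intro y hy
    simp only [Set.mem_ofPred_eq, NNReal.dist_eq] at hy
    rcases le_abs.1 hy with h | h
    · left
      simp only [Set.mem_ofPred_eq, ← NNReal.coe_le_coe]; push_cast; linarith
    · right
      simp only [Set.mem_ofPred_eq, ← NNReal.coe_le_coe]; push_cast; linarith
  have h4 : (ε : ℝ≥0∞) * ν {y | (ε : ℝ) ≤ dist (dens (p n) ν y) (dens q ν y)} ≤ ε * η' := by
    calc _ ≤ (ε : ℝ≥0∞) * (ν {y | dens q ν y + ε ≤ dens (p n) ν y}
          + ν {y | dens (p n) ν y + ε ≤ dens q ν y}) := by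
          gcongr
          exact (measure_mono h3).trans (measure_union_le _ _)
      _ ≤ (ε * η' / 2 : ℝ≥0) + (ε * η' / 2 : ℝ≥0) := by rw [mul_add]; gcongr
      _ = _ := by rw [← ENNReal.coe_add, add_halves, ENNReal.coe_mul]
  exact (ENNReal.mul_le_mul_iff_right (by simpa using hε'.ne') ENNReal.coe_ne_top).1 h4

/-- Lower semicontinuity of the divergence in its second argument: Fatou's lemma along a subsequence
of densities, using continuity of the perspective. -/
lemma tsallis_le_of_tendsto {a : ℝ} (ha : 0 < a) {p : ℕ → Measure Ω} {W q : Measure Ω}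
    [∀ n, IsProbabilityMeasure (p n)] [IsProbabilityMeasure W] [IsProbabilityMeasure q]
    (h : ∀ δ : ℝ≥0, 0 < δ → ∃ N, ∀ n ≥ N, ∀ A, MeasurableSet A → p n A ≤ q A + δ)
    {c : ℕ → ℝ≥0∞} {K : ℝ≥0∞} (hc : Tendsto c atTop (𝓝 K))
    (hW : ∀ n, tsallis a W (p n) ≤ c n) : tsallis a W q ≤ K := by
  obtain ⟨ν₀, _, hν₀⟩ := exists_isFiniteMeasure_forall_ac p
  obtain ⟨ν, hν⟩ : ∃ ν, ν = ν₀ + (W + q) := ⟨_, rfl⟩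
  have : IsFiniteMeasure ν := by rw [hν]; infer_instance
  have hp : ∀ n, p n ≪ ν := fun n => by rw [hν]; exact (hν₀ n).trans (ac_add_left _ _)
  have hWν : W ≪ ν := by rw [hν]; exact (ac_add_left W q).trans (ac_add_right _ _)
  have hq : q ≪ ν := by rw [hν]; exact (ac_add_right W q).trans (ac_add_right _ _)
  obtain ⟨ns, hns, hae⟩ := (tendstoInMeasure_dens hp hq h).exists_seq_tendsto_ae
  calc tsallis a W q = ∫⁻ y, phi a (dens W ν y) (dens q ν y) ∂ν := tsallis_eq ha hWν hq
    _ = ∫⁻ y, liminf (fun k => phi a (dens W ν y) (dens (p (ns k)) ν y)) atTop ∂ν := by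
      apply lintegral_congr_ae
      filter_upwards [hae] with y hy
      exact (((continuous_phi_right ha _).tendsto _).comp hy).liminf_eq.symm
    _ ≤ liminf (fun k => ∫⁻ y, phi a (dens W ν y) (dens (p (ns k)) ν y) ∂ν) atTop :=
      lintegral_liminf_le fun k => measurable_phi_dens ha _ _ _
    _ ≤ liminf (fun k => c (ns k)) atTop := by
      refine liminf_le_liminf (Eventually.of_forall fun k => ?_)
      rw [← tsallis_eq ha hWν (hp _)]
      exact hW _
    _ = K := (hc.comp hns.tendsto_atTop).liminf_eq

/-- Completeness in total variation. Setwise limits exist, and since the convergence is uniform over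
events, countable additivity is inherited from one late `p N`. -/
lemma exists_measure_forall_le_add {p : ℕ → Measure Ω} [∀ n, IsProbabilityMeasure (p n)]
    (h : ∀ δ : ℝ≥0, 0 < δ → ∃ N, ∀ m ≥ N, ∀ n ≥ N, ∀ A, MeasurableSet A → p m A ≤ p n A + δ) :
    ∃ q : Measure Ω, IsProbabilityMeasure q ∧
      ∀ δ : ℝ≥0, 0 < δ → ∃ N, ∀ n ≥ N, ∀ A, MeasurableSet A → p n A ≤ q A + δ := by
  have hreal : ∀ δ : ℝ, 0 < δ → ∃ N, ∀ m ≥ N, ∀ n ≥ N, ∀ A, MeasurableSet A →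
      |(p m).real A - (p n).real A| ≤ δ := by
    intro δ hδ
    lift δ to ℝ≥0 using hδ.le
    obtain ⟨N, hN⟩ := h δ hδ
    have aux : ∀ m ≥ N, ∀ n ≥ N, ∀ A, MeasurableSet A → (p m).real A ≤ (p n).real A + δ := by
      intro m hm n hn A hA
      have := ENNReal.toReal_mono (by finiteness) (hN m hm n hn A hA)
      rwa [ENNReal.toReal_add (by finiteness) (by finiteness)] at this
    refine ⟨N, fun m hm n hn A hA => abs_sub_le_iff.2 ⟨?_, ?_⟩⟩
    · linarith [aux m hm n hn A hA]
    · linarith [aux n hn m hm A hA]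
  have hlim : ∀ A, ∃ l : ℝ, MeasurableSet A → Tendsto (fun n => (p n).real A) atTop (𝓝 l) := by
    intro A
    by_cases hA : MeasurableSet A
    · obtain ⟨l, hl⟩ := cauchySeq_tendsto_of_complete (u := fun n => (p n).real A) <| by
        rw [Metric.cauchySeq_iff]
        intro ε hε
        obtain ⟨N, hN⟩ := hreal (ε / 2) (by positivity)
        exact ⟨N, fun m hm n hn => (hN m hm n hn A hA).trans_lt (by linarith)⟩
      exact ⟨l, fun _ => hl⟩
    · exact ⟨0, fun h => absurd h hA⟩
  choose l hl using hlim
  have hl0 : ∀ A, MeasurableSet A → 0 ≤ l A := fun A hA =>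
    ge_of_tendsto' (hl A hA) fun n => measureReal_nonneg
  have hclose : ∀ δ : ℝ, 0 < δ → ∃ N, ∀ n ≥ N, ∀ A, MeasurableSet A → |(p n).real A - l A| ≤ δ := by
    intro δ hδ
    obtain ⟨N, hN⟩ := hreal δ hδ
    refine ⟨N, fun n hn A hA => ?_⟩
    refine le_of_tendsto (((hl A hA).const_sub ((p n).real A)).abs) ?_
    filter_upwards [eventually_ge_atTop N] with m hm using hN n hn m hm A hA
  have hsum : ∀ f : ℕ → Set Ω, (∀ i, MeasurableSet (f i)) → Pairwise (Function.onFun Disjoint f) →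
      HasSum (fun i => l (f i)) (l (⋃ i, f i)) := by
    intro f hf hd
    have hU := MeasurableSet.iUnion hf
    rw [hasSum_iff_tendsto_nat_of_nonneg fun i => hl0 _ (hf i)]
    rw [Metric.tendsto_atTop]
    intro ε hε
    -- Three errors of ε / 4 occur: `l` against `p N` on the partial union and on the full union,
    -- and the tail of the series of `p N`.
    obtain ⟨N, hN⟩ := hclose (ε / 4) (by positivity)
    have hpart : ∀ k n, (p n).real (⋃ i ∈ Finset.range k, f i)
        = ∑ i ∈ Finset.range k, (p n).real (f i) := fun k n =>
      measureReal_biUnion_finset (fun i _ j _ hij => hd hij) (fun i _ => hf i)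
    have hBm : ∀ k, MeasurableSet (⋃ i ∈ Finset.range k, f i) := fun k =>
      Finset.measurableSet_biUnion _ fun i _ => hf i
    have hlpart : ∀ k, l (⋃ i ∈ Finset.range k, f i) = ∑ i ∈ Finset.range k, l (f i) := by
      intro k
      refine tendsto_nhds_unique (hl _ (hBm k)) ?_
      simp only [hpart]
      exact tendsto_finsetSum _ fun i _ => hl _ (hf i)
    have hs : HasSum (fun i => (p N).real (f i)) ((p N).real (⋃ i, f i)) := by
      have h1 := measure_iUnion (μ := p N) hd hf
      have h2 : ∑' i, p N (f i) ≠ ⊤ := h1 ▸ measure_ne_top _ _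
      have := ENNReal.hasSum_toReal h2
      rwa [← ENNReal.tsum_toReal_eq fun i => measure_ne_top _ _, ← h1] at this
    obtain ⟨M, hM⟩ := (Metric.tendsto_atTop.1 hs.tendsto_sum_nat) (ε / 4) (by positivity)
    refine ⟨M, fun k hk => ?_⟩
    have h1 := hM k hk
    have h2 := hN N le_rfl _ (hBm k)
    have h3 := hN N le_rfl _ hU
    rw [hlpart, hpart] at h2
    rw [Real.dist_eq] at h1 ⊢
    rw [abs_lt] at h1 ⊢
    rw [abs_le] at h2 h3
    constructor <;> linarith [h1.1, h1.2, h2.1, h2.2, h3.1, h3.2]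
  let q : Measure Ω := Measure.ofMeasurable (fun A _ => ENNReal.ofReal (l A))
    (by
      have : l ∅ = 0 := tendsto_nhds_unique (hl ∅ MeasurableSet.empty) (by simp)
      simp [this])
    (fun f hf hd => by
      have h1 := hsum f hf hd
      rw [← h1.tsum_eq, ENNReal.ofReal_tsum_of_nonneg (fun i => hl0 _ (hf i)) h1.summable])
  have hq : ∀ A, MeasurableSet A → q A = ENNReal.ofReal (l A) := fun A hA =>
    Measure.ofMeasurable_apply A hA
  refine ⟨q, ⟨?_⟩, fun δ hδ => ?_⟩
  · have : l Set.univ = 1 := tendsto_nhds_unique (hl _ MeasurableSet.univ) (by simp)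
    simp [hq _ MeasurableSet.univ, this]
  · obtain ⟨N, hN⟩ := hclose δ hδ
    refine ⟨N, fun n hn A hA => ?_⟩
    have := (abs_le.1 (hN n hn A hA)).2
    rw [hq A hA, ← ofReal_measureReal (μ := p n) (s := A), ← ENNReal.ofReal_coe_nnreal,
      ← ENNReal.ofReal_add (hl0 A hA) δ.coe_nonneg]
    exact ENNReal.ofReal_le_ofReal (by linarith)

lemma eq_of_forall_le_add {p q : Measure Ω} [IsProbabilityMeasure p] [IsProbabilityMeasure q]
    (h : ∀ δ : ℝ≥0, 0 < δ → ∀ A, MeasurableSet A → p A ≤ q A + δ) : p = q := by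
  ext A hA
  refine le_antisymm (ENNReal.le_of_forall_pos_le_add fun δ hδ _ => h δ hδ A hA)
    (ENNReal.le_of_forall_pos_le_add fun δ hδ _ => le_add_symm_of_forall (h δ hδ) hA)

lemma tsallis_convex_right {a : ℝ} (ha : 0 < a) (W Q R : Measure Ω) [IsFiniteMeasure W]
    [IsFiniteMeasure Q] [IsFiniteMeasure R] {s t : ℝ≥0} (hst : s + t = 1) :
    tsallis a W (s • Q + t • R) ≤ s * tsallis a W Q + t * tsallis a W R := by
  obtain ⟨ν, hν⟩ : ∃ ν, ν = W + (Q + R) := ⟨_, rfl⟩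
  have : IsFiniteMeasure ν := by rw [hν]; infer_instance
  have hW : W ≪ ν := by rw [hν]; exact ac_add_left _ _
  have hQ : Q ≪ ν := by rw [hν]; exact (ac_add_left Q R).trans (ac_add_right _ _)
  have hR : R ≪ ν := by rw [hν]; exact (ac_add_right Q R).trans (ac_add_right _ _)
  have hsQ : s • Q ≪ ν := hQ.smul_left s
  have htR : t • R ≪ ν := hR.smul_left t
  rw [tsallis_eq ha hW hQ, tsallis_eq ha hW hR, tsallis_eq ha hW (hsQ.add_left htR),
    ← lintegral_const_mul _ (measurable_phi_dens ha _ _ _),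
    ← lintegral_const_mul _ (measurable_phi_dens ha _ _ _),
    ← lintegral_add_left ((measurable_phi_dens ha _ _ _).const_mul _)]
  apply lintegral_mono_ae
  filter_upwards [dens_add hsQ htR, dens_smul hQ s, dens_smul hR t] with y h1 h2 h3
  rw [h1, h2, h3]
  exact phi_convex_right ha _ _ _ hst

/-! ### Translation between Rényi and Tsallis divergence -/

/-- The value of the Tsallis divergence of order `a` at Rényi divergence `c`. -/
noncomputable def level (a c : ℝ) : ℝ :=
  open Classical in if a = 1 then c else (Real.exp ((a - 1) * c) - 1) / (a - 1)

lemma level_of_ne {a : ℝ} (ha : a ≠ 1) (c : ℝ) :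
    level a c = (Real.exp ((a - 1) * c) - 1) / (a - 1) := by simp [level, ha]

lemma level_order_one (c : ℝ) : level 1 c = c := by simp [level]

lemma level_zero (a : ℝ) : level a 0 = 0 := by simp [level]

/-- The factor exp((a - 1) c) is the one appearing in `sibson`, so Sibson's identity becomes
additive on the Rényi scale. -/
lemma level_add (a c d : ℝ) :
    level a (c + d) = level a c + Real.exp ((a - 1) * c) * level a d := by
  by_cases h : a = 1
  · subst h; simp [level_order_one]
  · have : a - 1 ≠ 0 := sub_ne_zero.2 h
    simp only [level_of_ne h, mul_add, Real.exp_add]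
    field_simp
    ring

lemma level_strictMono (a : ℝ) : StrictMono (level a) := by
  intro c d hcd
  rcases lt_trichotomy a 1 with h | h | h
  · simp only [level_of_ne h.ne]
    rw [div_lt_div_right_of_neg (by linarith)]
    have : Real.exp ((a - 1) * d) < Real.exp ((a - 1) * c) := by
      rw [Real.exp_lt_exp]; nlinarith
    linarith
  · subst h; simpa [level_order_one]
  · simp only [level_of_ne h.ne']
    have h1 : 0 < a - 1 := by linarith
    have : Real.exp ((a - 1) * c) < Real.exp ((a - 1) * d) := by
      rw [Real.exp_lt_exp]; nlinarith
    gcongr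

lemma continuous_level (a : ℝ) : Continuous (level a) := by
  by_cases h : a = 1
  · subst h
    have : level 1 = id := funext level_order_one
    rw [this]; exact continuous_id
  · have : level a = fun c => (Real.exp ((a - 1) * c) - 1) / (a - 1) := funext (level_of_ne h)
    rw [this]; fun_prop

lemma level_nonneg {a c : ℝ} (hc : 0 ≤ c) : 0 ≤ level a c := by
  rw [← level_zero a]; exact (level_strictMono a).monotone hc

lemma coe_mul_log_le_iff {k : ℝ} (hk : 0 < k) (H : ℝ≥0∞) (c : ℝ) :
    (k : EReal) * ENNReal.log H ≤ c ↔ H ≤ ENNReal.ofReal (Real.exp (c / k)) := by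
  rcases eq_or_ne H 0 with rfl | h0
  · simp [EReal.coe_mul_bot_of_pos hk]
  rcases eq_or_ne H ⊤ with rfl | ht
  · simp [EReal.coe_mul_top_of_pos hk]
  have hpos := ENNReal.toReal_pos h0 ht
  rw [← ENNReal.ofReal_toReal ht, ENNReal.log_ofReal_of_pos hpos, ← EReal.coe_mul,
    EReal.coe_le_coe_iff, ENNReal.ofReal_le_ofReal_iff (Real.exp_pos _).le,
    ← Real.log_le_iff_le_exp hpos, le_div_iff₀ hk, mul_comm]

lemma le_coe_mul_log_iff {k : ℝ} (hk : 0 < k) (H : ℝ≥0∞) (c : ℝ) :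
    (c : EReal) ≤ (k : EReal) * ENNReal.log H ↔ ENNReal.ofReal (Real.exp (c / k)) ≤ H := by
  rcases eq_or_ne H 0 with rfl | h0
  · simp [EReal.coe_mul_bot_of_pos hk, Real.exp_pos]
  rcases eq_or_ne H ⊤ with rfl | ht
  · simp [EReal.coe_mul_top_of_pos hk]
  have hpos := ENNReal.toReal_pos h0 ht
  rw [← ENNReal.ofReal_toReal ht, ENNReal.log_ofReal_of_pos hpos, ← EReal.coe_mul,
    EReal.coe_le_coe_iff, ENNReal.ofReal_le_ofReal_iff hpos.le,
    ← Real.le_log_iff_exp_le hpos, div_le_iff₀ hk, mul_comm]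

lemma coe_mul_log_le_iff_of_neg {k : ℝ} (hk : k < 0) (H : ℝ≥0∞) (c : ℝ) :
    (k : EReal) * ENNReal.log H ≤ c ↔ ENNReal.ofReal (Real.exp (c / k)) ≤ H := by
  have h := le_coe_mul_log_iff (neg_pos.2 hk) H (-c)
  rw [neg_div_neg_eq, EReal.coe_neg, EReal.coe_neg, EReal.neg_mul, EReal.neg_le_neg_iff] at h
  exact h

lemma le_coe_mul_log_iff_of_neg {k : ℝ} (hk : k < 0) (H : ℝ≥0∞) (c : ℝ) :
    (c : EReal) ≤ (k : EReal) * ENNReal.log H ↔ H ≤ ENNReal.ofReal (Real.exp (c / k)) := by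
  have h := coe_mul_log_le_iff (neg_pos.2 hk) H (-c)
  rw [neg_div_neg_eq, EReal.coe_neg, EReal.coe_neg, EReal.neg_mul, EReal.neg_le_neg_iff] at h
  exact h

lemma renyiDiv_order_one (W Q : Measure Ω) [IsProbabilityMeasure W] [IsProbabilityMeasure Q] :
    renyiDiv 1 W Q = (tsallis 1 W Q : EReal) := by
  rw [tsallis_one_eq_klDiv, renyiDiv, if_neg ENNReal.one_ne_top, if_pos rfl]
  split_ifs with h
  · rw [← toReal_klDiv_of_measure_eq h.1 (by simp),
      EReal.coe_ennreal_toReal (klDiv_ne_top h.1 h.2)]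
  · rw [← klDiv_ne_top_iff, not_not] at h
    rw [h]; rfl

lemma renyiDiv_of_ne {α : ℝ≥0∞} (hα : α ≠ ⊤) (h1 : α ≠ 1) (W Q : Measure Ω)
    [IsProbabilityMeasure W] [IsProbabilityMeasure Q] :
    renyiDiv α W Q = ((1 / (α.toReal - 1) : ℝ) : EReal) * ENNReal.log (hellInt α.toReal W Q) := by
  rw [renyiDiv, if_neg hα, if_neg h1, hellInt, homInt]
  congr 2
  apply lintegral_congr_ae
  filter_upwards [coe_dens W (W + Q), coe_dens Q (W + Q)] with y h1 h2
  rw [hell, h1, h2]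

lemma toReal_ne_one {α : ℝ≥0∞} (h1 : α ≠ 1) : α.toReal ≠ 1 := by
  intro h
  exact h1 ((ENNReal.toReal_eq_one_iff α).1 h)

section
variable {α : ℝ≥0∞} (hα0 : 0 < α) (hα : α ≠ ⊤) (W Q : Measure Ω)
    [IsProbabilityMeasure W] [IsProbabilityMeasure Q] {c : ℝ} (hc : 0 ≤ c)
include hα0 hα hc

/-- The Hellinger integral is 1 + (a - 1) T. For a < 1 both the prefactor of the logarithm and this
slope are negative, so the direction is preserved. With `0 ≤ c` the level is nonnegative and
`ENNReal.ofReal` does not truncate it. -/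
lemma renyiDiv_le_coe_iff :
    renyiDiv α W Q ≤ c ↔ tsallis α.toReal W Q ≤ ENNReal.ofReal (level α.toReal c) := by
  have ha0 := ENNReal.toReal_pos hα0.ne' hα
  rcases eq_or_ne α 1 with rfl | h1
  · rw [renyiDiv_order_one, ENNReal.toReal_one, level_order_one, ← EReal.coe_ennreal_le_coe_ennreal_iff,
      EReal.coe_ennreal_ofReal, max_eq_left hc]
  rw [renyiDiv_of_ne hα h1]
  have h1' := toReal_ne_one h1
  rw [level_of_ne h1']
  set a := α.toReal
  rcases lt_or_gt_of_ne h1' with h | h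
  · have hH := hellInt_of_lt_one ha0 h W Q
    have hk : 1 / (a - 1) < 0 := by rw [one_div]; exact inv_lt_zero.2 (by linarith)
    rw [coe_mul_log_le_iff_of_neg hk, div_div_eq_mul_div, div_one, mul_comm c]
    have h1a : 0 < 1 - a := by linarith
    have hT : tsallis a W Q ≠ ⊤ := by
      intro hT
      rw [hT, ENNReal.mul_top (by simpa using h), add_top] at hH
      exact ENNReal.one_ne_top hH.symm
    have hHt : hellInt a W Q ≠ ⊤ := by
      intro hT
      rw [hT, top_add] at hH
      exact ENNReal.one_ne_top hH.symm
    have hE : Real.exp ((a - 1) * c) ≤ 1 := by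
      rw [Real.exp_le_one_iff]; nlinarith
    have hr := congrArg ENNReal.toReal hH
    rw [ENNReal.toReal_add hHt (ENNReal.mul_ne_top ENNReal.ofReal_ne_top hT), ENNReal.toReal_mul,
      ENNReal.toReal_ofReal h1a.le, ENNReal.toReal_one] at hr
    rw [ENNReal.ofReal_le_iff_le_toReal hHt, ENNReal.le_ofReal_iff_toReal_le hT
      (div_nonneg_of_nonpos (by linarith) (by linarith)), le_div_iff_of_neg (by linarith)]
    constructor <;> intro <;> linarith
  · have hH := hellInt_of_one_lt h W Q
    have hk : 0 < 1 / (a - 1) := one_div_pos.2 (by linarith)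
    rw [coe_mul_log_le_iff hk, div_div_eq_mul_div, div_one, mul_comm c]
    have h1a : 0 < a - 1 := by linarith
    have hE : 1 ≤ Real.exp ((a - 1) * c) := by
      rw [Real.one_le_exp_iff]; positivity
    rw [hH]
    rcases eq_or_ne (tsallis a W Q) ⊤ with hT | hT
    · simp [hT, ENNReal.mul_top, h]
    rw [ENNReal.le_ofReal_iff_toReal_le (by finiteness) (by positivity),
      ENNReal.le_ofReal_iff_toReal_le hT (div_nonneg (by linarith) h1a.le),
      ENNReal.toReal_add (by finiteness) (by finiteness), ENNReal.toReal_mul,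
      ENNReal.toReal_ofReal h1a.le, ENNReal.toReal_one, le_div_iff₀ h1a]
    constructor <;> intro <;> linarith

lemma coe_le_renyiDiv_iff :
    c ≤ renyiDiv α W Q ↔ ENNReal.ofReal (level α.toReal c) ≤ tsallis α.toReal W Q := by
  have ha0 := ENNReal.toReal_pos hα0.ne' hα
  rcases eq_or_ne α 1 with rfl | h1
  · rw [renyiDiv_order_one, ENNReal.toReal_one, level_order_one, ← EReal.coe_ennreal_le_coe_ennreal_iff,
      EReal.coe_ennreal_ofReal, max_eq_left hc]
  rw [renyiDiv_of_ne hα h1]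
  have h1' := toReal_ne_one h1
  rw [level_of_ne h1']
  set a := α.toReal
  rcases lt_or_gt_of_ne h1' with h | h
  · have hH := hellInt_of_lt_one ha0 h W Q
    have hk : 1 / (a - 1) < 0 := by rw [one_div]; exact inv_lt_zero.2 (by linarith)
    rw [le_coe_mul_log_iff_of_neg hk, div_div_eq_mul_div, div_one, mul_comm c]
    have h1a : 0 < 1 - a := by linarith
    have hT : tsallis a W Q ≠ ⊤ := by
      intro hT
      rw [hT, ENNReal.mul_top (by simpa using h), add_top] at hH
      exact ENNReal.one_ne_top hH.symm
    have hHt : hellInt a W Q ≠ ⊤ := by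
      intro hT
      rw [hT, top_add] at hH
      exact ENNReal.one_ne_top hH.symm
    have hr := congrArg ENNReal.toReal hH
    rw [ENNReal.toReal_add hHt (ENNReal.mul_ne_top ENNReal.ofReal_ne_top hT), ENNReal.toReal_mul,
      ENNReal.toReal_ofReal h1a.le, ENNReal.toReal_one] at hr
    rw [ENNReal.ofReal_le_iff_le_toReal hT, ENNReal.le_ofReal_iff_toReal_le hHt
      (by positivity), div_le_iff_of_neg (by linarith)]
    constructor <;> intro <;> linarith
  · have hH := hellInt_of_one_lt h W Q
    have hk : 0 < 1 / (a - 1) := one_div_pos.2 (by linarith)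
    rw [le_coe_mul_log_iff hk, div_div_eq_mul_div, div_one, mul_comm c]
    have h1a : 0 < a - 1 := by linarith
    rw [hH]
    rcases eq_or_ne (tsallis a W Q) ⊤ with hT | hT
    · simp [hT, ENNReal.mul_top, h]
    rw [ENNReal.ofReal_le_iff_le_toReal (by finiteness),
      ENNReal.ofReal_le_iff_le_toReal hT,
      ENNReal.toReal_add (by finiteness) (by finiteness), ENNReal.toReal_mul,
      ENNReal.toReal_ofReal h1a.le, ENNReal.toReal_one, div_le_iff₀ h1a]
    constructor <;> intro <;> linarith

end

lemma renyiDiv_nonneg_of_ne_top {α : ℝ≥0∞} (hα0 : 0 < α) (hα : α ≠ ⊤) (W Q : Measure Ω)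
    [IsProbabilityMeasure W] [IsProbabilityMeasure Q] : 0 ≤ renyiDiv α W Q := by
  have := (coe_le_renyiDiv_iff hα0 hα W Q le_rfl).2
  rw [level_zero] at this
  simpa using this

lemma dens_mono {W Q ν : Measure Ω} [IsFiniteMeasure W] [IsFiniteMeasure Q] [IsFiniteMeasure ν]
    (hQ : Q ≪ ν) (h : W ≤ Q) : ∀ᵐ y ∂ν, dens W ν y ≤ dens Q ν y := by
  have hW : W ≪ ν := (Measure.absolutelyContinuous_of_le h).trans hQ
  have hs : Q - W ≪ ν := (Measure.absolutelyContinuous_of_le Measure.sub_le).trans hQ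
  have h1 := dens_add hs hW
  rw [Measure.sub_add_cancel_of_le h] at h1
  filter_upwards [h1] with y hy
  rw [hy]
  exact le_add_self

/-- Monotonicity of the logarithm: log r ≥ log s + log q. The extra terms q and r have equal
integrals for probability measures and cancel after integration. -/
lemma phi_order_one_le {w q r s : ℝ≥0} (hs0 : 0 < s) (h : s * q ≤ r) :
    phi 1 w r + q ≤ phi 1 w q + ENNReal.ofReal (-Real.log s) * w + r := by
  rcases eq_or_ne q 0 with rfl | hq
  · rcases eq_or_ne w 0 with rfl | hw
    · simp [phi_zero_left]
    · have : phi 1 w 0 = ⊤ := by simp [phi, tsallisSlope, ENNReal.mul_top, hw]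
      simp [this]
  have hq' : (0 : ℝ) < q := by positivity
  have hs' : (0 : ℝ) < s := hs0
  have hr : (0 : ℝ) < r := lt_of_lt_of_le (by positivity) (NNReal.coe_le_coe.2 h)
  have hr0 : r ≠ 0 := by rintro rfl; simp at hr
  have h2 := tsallisFun_nonneg one_pos (x := w / q) (by positivity)
  have h3 := tsallisFun_nonneg one_pos (x := w / r) (by positivity)
  have hlog : (w : ℝ) * (Real.log s + Real.log q) ≤ w * Real.log r := by
    rw [← Real.log_mul hs'.ne' hq'.ne']
    gcongr
    exact_mod_cast h
  simp only [phi, hq, hr0, if_false]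
  rcases eq_or_ne w 0 with rfl | hw
  · simp [tsallisFun_order_one, klFun_zero, add_comm]
  have hw' : (0 : ℝ) < w := by positivity
  have hl : ENNReal.ofReal (-Real.log s * w) ≤ ENNReal.ofReal (-Real.log s) * w := by
    rw [ENNReal.ofReal_mul' w.coe_nonneg, ENNReal.ofReal_coe_nnreal]
  calc ENNReal.ofReal (r * tsallisFun 1 (w / r)) + q
      = ENNReal.ofReal (r * tsallisFun 1 (w / r) + q) := by
        rw [ENNReal.ofReal_add (by positivity) (by positivity), ENNReal.ofReal_coe_nnreal]
    _ ≤ ENNReal.ofReal (q * tsallisFun 1 (w / q) + -Real.log s * w + r) := by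
        apply ENNReal.ofReal_le_ofReal
        rw [tsallisFun_order_one, klFun_apply, klFun_apply, Real.log_div hw'.ne' hr.ne',
          Real.log_div hw'.ne' hq'.ne']
        field_simp
        linarith
    _ ≤ ENNReal.ofReal (q * tsallisFun 1 (w / q)) + ENNReal.ofReal (-Real.log s * w) + r := by
        refine ENNReal.ofReal_add_le.trans ?_
        rw [ENNReal.ofReal_coe_nnreal]
        gcongr
        exact ENNReal.ofReal_add_le
    _ ≤ _ := by gcongr

/-- If `s • Q ≤ R`, then replacing `Q` by `R` increases the divergence by at most `-log s`. -/
lemma renyiDiv_le_sub_log_of_smul_le {α : ℝ≥0∞} (hα0 : 0 < α) (hα : α ≠ ⊤) {W Q R : Measure Ω}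
    [IsProbabilityMeasure W] [IsProbabilityMeasure Q] [IsProbabilityMeasure R] {s : ℝ≥0}
    (hs0 : 0 < s) (hs : s • Q ≤ R) {c : ℝ} (hc : 0 ≤ c) (h : renyiDiv α W Q ≤ c) :
    renyiDiv α W R ≤ (c - Real.log s : ℝ) := by
  have ha0 := ENNReal.toReal_pos hα0.ne' hα
  have hs' : (0 : ℝ) < s := hs0
  have hs1 : (s : ℝ) ≤ 1 := by
    have := hs Set.univ
    rw [Measure.smul_apply, measure_univ, measure_univ, ENNReal.smul_def, smul_eq_mul,
      mul_one] at this
    exact_mod_cast this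
  have hlog : 0 ≤ -Real.log s := neg_nonneg.2 (Real.log_nonpos hs'.le hs1)
  obtain ⟨ν, hν⟩ : ∃ ν, ν = W + R + Q := ⟨_, rfl⟩
  have : IsFiniteMeasure ν := by rw [hν]; infer_instance
  have hWν : W ≪ ν := by rw [hν]; exact (ac_add_left W R).trans (ac_add_left _ _)
  have hRν : R ≪ ν := by rw [hν]; exact (ac_add_right W R).trans (ac_add_left _ _)
  have hQν : Q ≪ ν := by rw [hν]; exact ac_add_right _ _
  have hdens : ∀ᵐ y ∂ν, s * dens Q ν y ≤ dens R ν y := by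
    filter_upwards [dens_mono hRν hs, dens_smul hQν s] with y h1 h2
    rwa [← h2]
  rcases eq_or_ne α 1 with rfl | h1
  · rw [renyiDiv_le_coe_iff one_pos hα W Q hc, ENNReal.toReal_one, level_order_one] at h
    rw [renyiDiv_le_coe_iff one_pos hα W R (by linarith), ENNReal.toReal_one, level_order_one]
    have key : tsallis 1 W R + 1 ≤ tsallis 1 W Q + ENNReal.ofReal (-Real.log s) + 1 := by
      have : ∫⁻ y, (phi 1 (dens W ν y) (dens R ν y) + dens Q ν y) ∂ν ≤
          ∫⁻ y, (phi 1 (dens W ν y) (dens Q ν y) + ENNReal.ofReal (-Real.log s) * dens W ν y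
            + dens R ν y) ∂ν := by
        apply lintegral_mono_ae
        filter_upwards [hdens] with y hy using phi_order_one_le hs0 hy
      rw [lintegral_add_left (measurable_phi_dens one_pos _ _ _),
        lintegral_add_right _ (measurable_dens _ _).coe_nnreal_ennreal,
        lintegral_add_left (measurable_phi_dens one_pos _ _ _),
        lintegral_const_mul _ (measurable_dens _ _).coe_nnreal_ennreal, lintegral_dens hWν,
        lintegral_dens hQν, lintegral_dens hRν, ← tsallis_eq one_pos hWν hRν,
        ← tsallis_eq one_pos hWν hQν] at this
      simpa using this
    calc tsallis 1 W R ≤ tsallis 1 W Q + ENNReal.ofReal (-Real.log s) :=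
          (ENNReal.add_le_add_iff_right ENNReal.one_ne_top).1 key
      _ ≤ ENNReal.ofReal c + ENNReal.ofReal (-Real.log s) := by gcongr
      _ = _ := by rw [← ENNReal.ofReal_add hc hlog, sub_eq_add_neg]
  rw [renyiDiv_of_ne hα h1] at h ⊢
  have h1' := toReal_ne_one h1
  set a := α.toReal
  -- Scaling the second argument by s multiplies the Hellinger integral by s ^ (1 - a), which is the
  -- shift by -log s on the Rényi scale.
  have hexp : ENNReal.ofReal (Real.exp ((c - Real.log s) / (1 / (a - 1))))
      = (s : ℝ≥0∞) ^ (1 - a) * ENNReal.ofReal (Real.exp (c / (1 / (a - 1)))) := by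
    rw [← ENNReal.ofReal_coe_nnreal, ENNReal.ofReal_rpow_of_pos hs', ← ENNReal.ofReal_mul
      (by positivity), Real.rpow_def_of_pos hs', ← Real.exp_add]
    congr 2
    field_simp
    ring
  have hmul : ∀ y, ((s * dens Q ν y : ℝ≥0) : ℝ≥0∞) ^ (1 - a)
      = (s : ℝ≥0∞) ^ (1 - a) * (dens Q ν y : ℝ≥0∞) ^ (1 - a) := fun y => by
    rw [ENNReal.coe_mul]
    exact ENNReal.mul_rpow_of_ne_top ENNReal.coe_ne_top ENNReal.coe_ne_top _
  have hint : (s : ℝ≥0∞) ^ (1 - a) * hellInt a W Q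
      = ∫⁻ y, (dens W ν y : ℝ≥0∞) ^ a * ((s * dens Q ν y : ℝ≥0) : ℝ≥0∞) ^ (1 - a) ∂ν := by
    rw [hellInt_eq ha0 hWν hQν, ← lintegral_const_mul _ (measurable_hell_dens _ _ _ _)]
    refine lintegral_congr fun y => ?_
    rw [hell, hmul, mul_left_comm]
  rcases lt_or_gt_of_ne h1' with h' | h'
  · have hk : 1 / (a - 1) < 0 := by rw [one_div]; exact inv_lt_zero.2 (by linarith)
    rw [coe_mul_log_le_iff_of_neg hk] at h ⊢
    rw [hexp]
    calc _ ≤ (s : ℝ≥0∞) ^ (1 - a) * hellInt a W Q := by gcongr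
      _ ≤ hellInt a W R := by
        rw [hint, hellInt_eq ha0 hWν hRν]
        apply lintegral_mono_ae
        filter_upwards [hdens] with y hy
        have : 0 ≤ 1 - a := by linarith
        rw [hell]
        gcongr
  · have hk : 0 < 1 / (a - 1) := one_div_pos.2 (by linarith)
    rw [coe_mul_log_le_iff hk] at h ⊢
    rw [hexp]
    calc _ ≤ (s : ℝ≥0∞) ^ (1 - a) * hellInt a W Q := by
          rw [hint, hellInt_eq ha0 hWν hRν]
          apply lintegral_mono_ae
          filter_upwards [hdens] with y hy
          have h2 : 0 ≤ a - 1 := by linarith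
          rw [hell, ← neg_sub a 1, ENNReal.rpow_neg, ENNReal.rpow_neg]
          gcongr
      _ ≤ _ := by gcongr

/-! ### Mixtures and mean measures of priors -/

section Mixture

variable (P : ProbabilityMeasure Ω →₀ ℝ≥0)

instance : IsFiniteMeasure (renyiMixture P) := by
  unfold renyiMixture; infer_instance

lemma renyiMixture_apply (A : Set Ω) :
    renyiMixture P A = ∑ W ∈ P.support, (P W : ℝ≥0∞) * (W : Measure Ω) A := by
  simp only [renyiMixture, Measure.coe_finsetSum, Finset.sum_apply, Measure.smul_apply,
    ENNReal.smul_def, smul_eq_mul]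

lemma smul_le_renyiMixture {W : ProbabilityMeasure Ω} (hW : W ∈ P.support) :
    P W • (W : Measure Ω) ≤ renyiMixture P := by
  refine Measure.le_iff.2 fun A _ => ?_
  rw [renyiMixture_apply, Measure.smul_apply, ENNReal.smul_def, smul_eq_mul]
  exact Finset.single_le_sum (f := fun W => (P W : ℝ≥0∞) * (W : Measure Ω) A)
    (fun _ _ => zero_le) hW

lemma ac_renyiMixture {W : ProbabilityMeasure Ω} (hW : W ∈ P.support) :
    (W : Measure Ω) ≪ renyiMixture P := by
  have h0 : P W ≠ 0 := Finsupp.mem_support_iff.1 hW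
  intro A hA
  have := smul_le_renyiMixture P hW A
  rw [hA, Measure.smul_apply, ENNReal.smul_def, smul_eq_mul] at this
  simpa [h0] using this

lemma renyiMixture_ac {ν : Measure Ω} (h : ∀ W ∈ P.support, (W : Measure Ω) ≪ ν) :
    renyiMixture P ≪ ν := by
  intro A hA
  rw [renyiMixture_apply, Finset.sum_eq_zero_iff]
  intro W hW
  rw [h W hW hA, mul_zero]

lemma withDensity_sum_mul_dens {ν : Measure Ω} [IsFiniteMeasure ν]
    (h : ∀ W ∈ P.support, (W : Measure Ω) ≪ ν) :
    ν.withDensity (fun y => ((∑ W ∈ P.support, P W * dens W ν y : ℝ≥0) : ℝ≥0∞))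
      = renyiMixture P := by
  ext A hA
  rw [withDensity_apply _ hA, renyiMixture_apply]
  push_cast
  rw [lintegral_finsetSum]
  · refine Finset.sum_congr rfl fun W hW => ?_
    rw [lintegral_const_mul _ (measurable_dens _ _).coe_nnreal_ennreal, setLIntegral_dens (h W hW) hA]
  · exact fun W _ => (measurable_dens _ _).coe_nnreal_ennreal.const_mul _

variable {P} (hP : ∑ W ∈ P.support, P W = 1)
include hP

lemma isProbabilityMeasure_renyiMixture : IsProbabilityMeasure (renyiMixture P) := by
  constructor
  rw [renyiMixture_apply]
  simp only [measure_univ, mul_one]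
  exact_mod_cast hP

lemma exists_mem_support : ∃ W, W ∈ P.support := by
  by_contra! h
  rw [Finset.sum_eq_zero fun W hW => absurd hW (h W)] at hP
  exact zero_ne_one hP

end Mixture

/-- The power mean of order `a` of the densities with respect to `ν`. -/
noncomputable def meanFun (a : ℝ) (P : ProbabilityMeasure Ω →₀ ℝ≥0) (ν : Measure Ω) (y : Ω) :
    ℝ≥0 := (∑ W ∈ P.support, P W * dens W ν y ^ a) ^ (1 / a)

lemma measurable_meanFun (a : ℝ) (P : ProbabilityMeasure Ω →₀ ℝ≥0) (ν : Measure Ω) :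
    Measurable (meanFun a P ν) := by
  unfold meanFun
  refine (Finset.measurable_sum _ fun W _ => ?_).pow_const _
  exact ((measurable_dens _ _).pow_const _).const_mul _

/-- A power mean is at most the maximum, hence at most the sum; the crude bound is enough for
finiteness of the mean measure. -/
lemma meanFun_le {P : ProbabilityMeasure Ω →₀ ℝ≥0}
    (hP : ∑ W ∈ P.support, P W = 1) {a : ℝ} (ha : 0 < a) (ν : Measure Ω) (y : Ω) :
    meanFun a P ν y ≤ ∑ W ∈ P.support, dens W ν y := by
  rw [meanFun]
  calc (∑ W ∈ P.support, P W * dens W ν y ^ a) ^ (1 / a)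
      ≤ (∑ W ∈ P.support, P W * (∑ V ∈ P.support, dens V ν y) ^ a) ^ (1 / a) := by
        gcongr with W hW
        exact Finset.single_le_sum (f := fun V : ProbabilityMeasure Ω => dens V ν y)
          (fun _ _ => zero_le) hW
    _ = _ := by
        rw [← Finset.sum_mul, hP, one_mul, ← NNReal.rpow_mul, mul_one_div_cancel ha.ne',
          NNReal.rpow_one]

section Mean

variable {α : ℝ≥0∞} (hα0 : 0 < α) (hα : α ≠ ⊤) {P : ProbabilityMeasure Ω →₀ ℝ≥0}
include hα0 hα

/-- The power mean is homogeneous of degree one, so the chain rule makes the mean measure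
independent of the dominating measure. -/
lemma withDensity_meanFun {ν : Measure Ω} [IsFiniteMeasure ν]
    (h : ∀ W ∈ P.support, (W : Measure Ω) ≪ ν) :
    ν.withDensity (fun y => (meanFun α.toReal P ν y : ℝ≥0∞)) = renyiMeanMeasure α P := by
  have ha0 := ENNReal.toReal_pos hα0.ne' hα
  set a := α.toReal
  have hmix := renyiMixture_ac P h
  set μ := renyiMixture P with hμ
  have h1 : renyiMeanMeasure α P = μ.withDensity fun y => (meanFun a P μ y : ℝ≥0∞) := by
    rw [renyiMeanMeasure]
    apply withDensity_congr_ae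
    have : ∀ᵐ y ∂μ, ∀ W ∈ P.support, (dens W μ y : ℝ≥0∞) = (W : Measure Ω).rnDeriv μ y := by
      exact (Filter.eventually_all_finset P.support).2 fun W _ => coe_dens _ _
    filter_upwards [this] with y hy
    rw [renyiMeanDensity, if_neg hα, meanFun, ENNReal.coe_rpow_of_nonneg _ (by positivity)]
    push_cast
    congr 1
    refine Finset.sum_congr rfl fun W hW => ?_
    rw [← hy W hW, ENNReal.coe_rpow_of_nonneg _ ha0.le]
  rw [h1]
  ext A hA
  rw [withDensity_apply _ hA, withDensity_apply _ hA,
    ← lintegral_indicator hA (μ := μ), ← lintegral_dens_mul hmix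
      ((measurable_meanFun a P μ).coe_nnreal_ennreal.indicator hA), ← lintegral_indicator hA]
  apply lintegral_congr_ae
  have : ∀ᵐ y ∂ν, ∀ W ∈ P.support, dens W μ y * dens μ ν y = dens W ν y := by
    exact (Filter.eventually_all_finset P.support).2 fun W hW =>
      dens_mul_dens (ac_renyiMixture P hW)
  filter_upwards [this] with y hy
  by_cases hyA : y ∈ A
  · rw [Set.indicator_of_mem hyA, Set.indicator_of_mem hyA, ← ENNReal.coe_mul, ENNReal.coe_inj,
      meanFun, meanFun]
    have e : dens μ ν y = (dens μ ν y ^ a) ^ (1 / a) := by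
      rw [← NNReal.rpow_mul, mul_one_div_cancel ha0.ne', NNReal.rpow_one]
    conv_rhs => rw [e]
    rw [← NNReal.mul_rpow, Finset.mul_sum]
    congr 1
    refine Finset.sum_congr rfl fun W hW => ?_
    rw [← hy W hW, NNReal.mul_rpow]
    ring
  · rw [Set.indicator_of_notMem hyA, Set.indicator_of_notMem hyA, mul_zero]

lemma le_renyiMeanMeasure_of_ne_top {W : ProbabilityMeasure Ω} (hW : W ∈ P.support) :
    (P W : ℝ≥0∞) ^ (1 / α.toReal) ≤ renyiMeanMeasure α P Set.univ := by
  have ha0 := ENNReal.toReal_pos hα0.ne' hα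
  rw [← withDensity_meanFun hα0 hα (fun W hW => ac_renyiMixture P hW),
    withDensity_apply _ MeasurableSet.univ, Measure.restrict_univ]
  have h1 : ∀ y, P W ^ (1 / α.toReal) * dens W (renyiMixture P) y
      ≤ meanFun α.toReal P (renyiMixture P) y := by
    intro y
    rw [meanFun]
    have e : dens W (renyiMixture P) y
        = (dens W (renyiMixture P) y ^ α.toReal) ^ (1 / α.toReal) := by
      rw [← NNReal.rpow_mul, mul_one_div_cancel ha0.ne', NNReal.rpow_one]
    rw [e, ← NNReal.mul_rpow]
    gcongr
    exact Finset.single_le_sum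
      (f := fun V : ProbabilityMeasure Ω => P V * dens V (renyiMixture P) y ^ α.toReal)
      (fun _ _ => zero_le) hW
  calc (P W : ℝ≥0∞) ^ (1 / α.toReal)
      = ∫⁻ y, ((P W ^ (1 / α.toReal) * dens W (renyiMixture P) y : ℝ≥0) : ℝ≥0∞)
          ∂(renyiMixture P) := by
        push_cast
        rw [lintegral_const_mul _ (measurable_dens _ _).coe_nnreal_ennreal,
          lintegral_dens (ac_renyiMixture P hW), measure_univ, mul_one,
          ENNReal.coe_rpow_of_nonneg _ (by positivity)]
    _ ≤ _ := lintegral_mono fun y => ENNReal.coe_le_coe.2 (h1 y)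

variable (hP : ∑ W ∈ P.support, P W = 1)
include hP

lemma isFiniteMeasure_renyiMeanMeasure_of_ne_top : IsFiniteMeasure (renyiMeanMeasure α P) := by
  have ha0 := ENNReal.toReal_pos hα0.ne' hα
  rw [← withDensity_meanFun hα0 hα (fun W hW => ac_renyiMixture P hW)]
  apply isFiniteMeasure_withDensity
  refine ne_top_of_le_ne_top ?_
    (lintegral_mono fun y => ENNReal.coe_le_coe.2 (meanFun_le hP ha0 (renyiMixture P) y))
  push_cast
  rw [lintegral_finsetSum]
  · refine ENNReal.sum_ne_top.2 fun W hW => ?_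
    rw [lintegral_dens (ac_renyiMixture P hW)]
    exact measure_ne_top _ _
  · exact fun W _ => (measurable_dens _ _).coe_nnreal_ennreal

lemma renyiMeanMeasure_univ_ne_zero_of_ne_top : renyiMeanMeasure α P Set.univ ≠ 0 := by
  obtain ⟨W, hW⟩ := exists_mem_support hP
  have h0 : P W ≠ 0 := Finsupp.mem_support_iff.1 hW
  refine (lt_of_lt_of_le ?_ (le_renyiMeanMeasure_of_ne_top hα0 hα hW)).ne'
  exact ENNReal.rpow_pos (by simpa [pos_iff_ne_zero] using h0) ENNReal.coe_ne_top

lemma isProbabilityMeasure_renyiMean_of_ne_top : IsProbabilityMeasure (renyiMean α P) := by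
  have := isFiniteMeasure_renyiMeanMeasure_of_ne_top hα0 hα hP
  constructor
  rw [renyiMean, Measure.smul_apply, smul_eq_mul]
  exact ENNReal.inv_mul_cancel (renyiMeanMeasure_univ_ne_zero_of_ne_top hα0 hα hP)
    (measure_ne_top _ _)

lemma smul_renyiMean_of_ne_top :
    (renyiMeanMeasure α P Set.univ).toNNReal • renyiMean α P = renyiMeanMeasure α P := by
  have := isFiniteMeasure_renyiMeanMeasure_of_ne_top hα0 hα hP
  ext A _
  rw [Measure.smul_apply, renyiMean, Measure.smul_apply, ENNReal.smul_def, smul_eq_mul, smul_eq_mul,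
    ENNReal.coe_toNNReal (measure_ne_top _ _), ← mul_assoc,
    ENNReal.mul_inv_cancel (renyiMeanMeasure_univ_ne_zero_of_ne_top hα0 hα hP)
      (measure_ne_top _ _), one_mul]

/-! ### Sibson's identity -/

/-- Pointwise, the P-average of the a-th powers of the densities is by definition the a-th power of
the mean density, which is the total mass times the density of the normalized mean. -/
lemma sum_mul_hellInt (Q : Measure Ω) [IsFiniteMeasure Q] :
    ∑ W ∈ P.support, (P W : ℝ≥0∞) * hellInt α.toReal W Q
      = (renyiMeanMeasure α P Set.univ) ^ α.toReal * hellInt α.toReal (renyiMean α P) Q := by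
  have ha0 := ENNReal.toReal_pos hα0.ne' hα
  have hμf := isFiniteMeasure_renyiMeanMeasure_of_ne_top hα0 hα hP
  have hqp := isProbabilityMeasure_renyiMean_of_ne_top hα0 hα hP
  set a := α.toReal
  obtain ⟨ν, hν⟩ : ∃ ν, ν = renyiMixture P + Q := ⟨_, rfl⟩
  have : IsFiniteMeasure ν := by rw [hν]; infer_instance
  have hW : ∀ W ∈ P.support, (W : Measure Ω) ≪ ν := fun W hW => by
    rw [hν]; exact (ac_renyiMixture P hW).trans (ac_add_left _ _)
  have hQ : Q ≪ ν := by rw [hν]; exact ac_add_right _ _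
  have hdμ := dens_ae_eq (measurable_meanFun a P ν) (withDensity_meanFun hα0 hα hW)
  have hμ : renyiMeanMeasure α P ≪ ν := by
    rw [← withDensity_meanFun hα0 hα hW]
    exact withDensity_absolutelyContinuous _ _
  have hq : renyiMean α P ≪ ν := by
    rw [renyiMean]; exact hμ.smul_left _
  have hdq := dens_smul hq (renyiMeanMeasure α P Set.univ).toNNReal
  rw [smul_renyiMean_of_ne_top hα0 hα hP] at hdq
  rw [hellInt_eq ha0 hq hQ, ← lintegral_const_mul _ (measurable_hell_dens _ _ _ _)]
  have e : ∀ W ∈ P.support, (P W : ℝ≥0∞) * hellInt a W Q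
      = ∫⁻ y, P W * hell a (dens W ν y) (dens Q ν y) ∂ν := fun W hW' => by
    rw [hellInt_eq ha0 (hW W hW') hQ, lintegral_const_mul _ (measurable_hell_dens _ _ _ _)]
  rw [Finset.sum_congr rfl e, ← lintegral_finsetSum]
  swap
  · exact fun W _ => (measurable_hell_dens _ _ _ _).const_mul _
  apply lintegral_congr_ae
  filter_upwards [hdμ, hdq] with y h1 h2
  have h3 := hell_smul_left ha0 (renyiMeanMeasure α P Set.univ).toNNReal
    (dens (renyiMean α P) ν y) (dens Q ν y)
  rw [← h2, h1, ENNReal.coe_toNNReal (measure_ne_top _ _)] at h3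
  rw [← h3, hell, ← ENNReal.coe_rpow_of_nonneg _ ha0.le, meanFun, ← NNReal.rpow_mul,
    one_div_mul_cancel ha0.ne', NNReal.rpow_one]
  push_cast
  rw [Finset.sum_mul]
  refine Finset.sum_congr rfl fun W _ => ?_
  rw [hell, ENNReal.coe_rpow_of_nonneg _ ha0.le, mul_assoc]

/-- Insert Hellinger = 1 + (a - 1) T into `sum_mul_hellInt`, and use that the a-th power of the mass
Z of the mean measure is exp((a - 1) I). -/
lemma sibson_of_ne_one (h1 : α ≠ 1) : ∃ I : ℝ, 0 ≤ I ∧ renyiInfo α P = I ∧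
    ∀ Q : Measure Ω, IsProbabilityMeasure Q →
      ∑ W ∈ P.support, (P W : ℝ≥0∞) * tsallis α.toReal W Q
        = ENNReal.ofReal (level α.toReal I)
          + ENNReal.ofReal (Real.exp ((α.toReal - 1) * I)) * tsallis α.toReal (renyiMean α P) Q := by
  have ha0 := ENNReal.toReal_pos hα0.ne' hα
  have hμf := isFiniteMeasure_renyiMeanMeasure_of_ne_top hα0 hα hP
  have hqp := isProbabilityMeasure_renyiMean_of_ne_top hα0 hα hP
  have hH := fun (Q : Measure Ω) (_ : IsFiniteMeasure Q) => sum_mul_hellInt hα0 hα hP Q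
  have hZ0 := renyiMeanMeasure_univ_ne_zero_of_ne_top hα0 hα hP
  have hZt := measure_ne_top (renyiMeanMeasure α P) Set.univ
  have h1' := toReal_ne_one h1
  rw [renyiInfo, if_neg hα, if_neg h1]
  set a := α.toReal
  set Z := renyiMeanMeasure α P Set.univ
  set p := renyiMean α P
  have hZr := ENNReal.toReal_pos hZ0 hZt
  have ha1 : a - 1 ≠ 0 := sub_ne_zero.2 h1'
  have hE : Real.exp ((a - 1) * (a / (a - 1) * Real.log Z.toReal)) = Z.toReal ^ a := by
    rw [Real.rpow_def_of_pos hZr]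
    congr 1
    field_simp
  have hE' : ENNReal.ofReal (Z.toReal ^ a) = Z ^ a := by
    rw [← ENNReal.ofReal_rpow_of_pos hZr, ENNReal.ofReal_toReal hZt]
  refine ⟨a / (a - 1) * Real.log Z.toReal, ?_, ?_, ?_⟩
  rotate_left
  · rw [EReal.coe_mul, ← ENNReal.log_ofReal_of_pos hZr, ENNReal.ofReal_toReal hZt]
  · intro Q _
    rw [level_of_ne h1', hE, hE']
    have hHQ := hH Q inferInstance
    have hHp := hH p inferInstance
    have hPsum : ∑ W ∈ P.support, (P W : ℝ≥0∞) = 1 := by exact_mod_cast hP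
    rcases lt_or_gt_of_ne h1' with h | h
    · have h1a : 0 < 1 - a := by linarith
      have hpos : ENNReal.ofReal (1 - a) ≠ 0 := by simpa using h
      have key : ∀ R : Measure Ω, IsProbabilityMeasure R →
          ∑ W ∈ P.support, (P W : ℝ≥0∞) * hellInt a W R
            + ENNReal.ofReal (1 - a) * ∑ W ∈ P.support, (P W : ℝ≥0∞) * tsallis a W R = 1 := by
        intro R _
        rw [Finset.mul_sum, ← Finset.sum_add_distrib, ← hPsum]
        refine Finset.sum_congr rfl fun W _ => ?_
        rw [mul_left_comm, ← mul_add, hellInt_of_lt_one ha0 h, mul_one]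
      have hpp := hellInt_of_lt_one ha0 h p p
      have hpQ := hellInt_of_lt_one ha0 h p Q
      rw [tsallis_self, mul_zero, add_zero] at hpp
      have k1 := key p inferInstance
      have k2 := key Q inferInstance
      rw [hHp, hpp, mul_one] at k1
      rw [hHQ] at k2
      -- Choosing the mean itself as second argument bounds Z ^ a by 1, so the level of I is
      -- nonnegative and survives `ENNReal.ofReal`.
      have hZle : Z ^ a ≤ 1 := k1 ▸ le_self_add
      have hZle' : Z.toReal ^ a ≤ 1 := by
        rw [← hE', ENNReal.ofReal_le_one] at hZle; exact hZle
      have hlev : ENNReal.ofReal (1 - a) * ENNReal.ofReal ((Z.toReal ^ a - 1) / (a - 1)) + Z ^ a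
          = 1 := by
        rw [← hE', ← ENNReal.ofReal_mul h1a.le, ← ENNReal.ofReal_add _ (by positivity),
          ← ENNReal.ofReal_one]
        · congr 1; field_simp; ring
        · exact mul_nonneg h1a.le (div_nonneg_of_nonpos (by linarith) (by linarith))
      have hfin : Z ^ a * hellInt a p Q ≠ ⊤ := by
        intro ht
        rw [ht, top_add] at k2
        exact ENNReal.one_ne_top k2.symm
      have : Z ^ a * hellInt a p Q + ENNReal.ofReal (1 - a) *
          ∑ W ∈ P.support, (P W : ℝ≥0∞) * tsallis a W Q
          = Z ^ a * hellInt a p Q + ENNReal.ofReal (1 - a) *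
            (ENNReal.ofReal ((Z.toReal ^ a - 1) / (a - 1)) + Z ^ a * tsallis a p Q) := by
        rw [k2, ← hlev]
        nth_rewrite 1 [show Z ^ a = Z ^ a * 1 from (mul_one _).symm]
        rw [← hpQ]
        ring
      rw [ENNReal.add_right_inj hfin, ENNReal.mul_right_inj hpos ENNReal.ofReal_ne_top] at this
      exact this
    · have h1a : 0 < a - 1 := by linarith
      have hpos : ENNReal.ofReal (a - 1) ≠ 0 := by simpa using h
      have key : ∀ R : Measure Ω, IsProbabilityMeasure R →
          ∑ W ∈ P.support, (P W : ℝ≥0∞) * hellInt a W R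
            = 1 + ENNReal.ofReal (a - 1) * ∑ W ∈ P.support, (P W : ℝ≥0∞) * tsallis a W R := by
        intro R _
        rw [Finset.mul_sum, ← hPsum, ← Finset.sum_add_distrib]
        refine Finset.sum_congr rfl fun W _ => ?_
        rw [hellInt_of_one_lt h, mul_left_comm, mul_add, mul_one]
      have hpp := hellInt_of_one_lt h p p
      rw [tsallis_self, mul_zero, add_zero] at hpp
      have k1 := key p inferInstance
      have k2 := key Q inferInstance
      rw [hHp, hpp, mul_one] at k1
      rw [hHQ, hellInt_of_one_lt h] at k2
      have hZle : 1 ≤ Z ^ a := k1 ▸ le_self_add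
      have hZle' : 1 ≤ Z.toReal ^ a := by
        rw [← hE', ENNReal.one_le_ofReal] at hZle; exact hZle
      have hlev : 1 + ENNReal.ofReal (a - 1) * ENNReal.ofReal ((Z.toReal ^ a - 1) / (a - 1))
          = Z ^ a := by
        rw [← hE', ← ENNReal.ofReal_mul h1a.le, ← ENNReal.ofReal_one,
          ← ENNReal.ofReal_add zero_le_one]
        · congr 1; field_simp; ring
        · exact mul_nonneg h1a.le (div_nonneg (by linarith) (by linarith))
      have : 1 + ENNReal.ofReal (a - 1) * ∑ W ∈ P.support, (P W : ℝ≥0∞) * tsallis a W Q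
          = 1 + ENNReal.ofReal (a - 1) *
            (ENNReal.ofReal ((Z.toReal ^ a - 1) / (a - 1)) + Z ^ a * tsallis a p Q) := by
        rw [← k2, mul_add (ENNReal.ofReal (a - 1)), ← add_assoc, hlev]
        ring
      rw [ENNReal.add_right_inj ENNReal.one_ne_top,
        ENNReal.mul_right_inj hpos ENNReal.ofReal_ne_top] at this
      exact this
  -- Nonnegativity of I: Z ^ a is the P-average of Hellinger integrals against the mean, which lie
  -- below 1 for a < 1 and above 1 for a > 1, so log Z has the sign of a - 1 or vanishes.
  · have hHp := hH p inferInstance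
    have hPsum : ∑ W ∈ P.support, (P W : ℝ≥0∞) = 1 := by exact_mod_cast hP
    rcases lt_or_gt_of_ne h1' with h | h
    · have hpp := hellInt_of_lt_one ha0 h p p
      rw [tsallis_self, mul_zero, add_zero] at hpp
      rw [hpp, mul_one] at hHp
      have : Z ^ a ≤ 1 := by
        rw [← hHp, ← hPsum]
        refine Finset.sum_le_sum fun W _ => ?_
        have := hellInt_of_lt_one ha0 h W p
        calc (P W : ℝ≥0∞) * hellInt a W p ≤ P W * 1 := by gcongr; rw [← this]; exact le_self_add
          _ = _ := mul_one _
      rw [← hE', ENNReal.ofReal_le_one] at this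
      have h2 : Real.log Z.toReal ≤ 0 := by
        refine Real.log_nonpos hZr.le ?_
        by_contra! h3
        exact absurd this (not_le.2 (Real.one_lt_rpow h3 ha0))
      exact mul_nonneg_of_nonpos_of_nonpos (div_nonpos_of_nonneg_of_nonpos ha0.le (by linarith)) h2
    · have hpp := hellInt_of_one_lt h p p
      rw [tsallis_self, mul_zero, add_zero] at hpp
      rw [hpp, mul_one] at hHp
      have : 1 ≤ Z ^ a := by
        rw [← hHp, ← hPsum]
        refine Finset.sum_le_sum fun W _ => ?_
        have := hellInt_of_one_lt h W p
        calc (P W : ℝ≥0∞) = P W * 1 := (mul_one _).symm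
          _ ≤ P W * hellInt a W p := by gcongr; rw [this]; exact le_self_add
      rw [← hE', ENNReal.one_le_ofReal] at this
      have h2 : 0 ≤ Real.log Z.toReal := by
        refine Real.log_nonneg ?_
        by_contra! h3
        exact absurd this (not_le.2 (Real.rpow_lt_one hZr.le h3 ha0))
      exact mul_nonneg (div_nonneg ha0.le (by linarith)) h2

end Mean

/-! ### Sibson's identity at order one -/

lemma phi_order_one_of_pos (w : ℝ≥0) {q : ℝ≥0} (hq : q ≠ 0) :
    phi 1 w q = ENNReal.ofReal (w * Real.log w - w * Real.log q + q - w) := by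
  have hq' : (q : ℝ) ≠ 0 := by exact_mod_cast hq
  rw [phi, if_neg hq, tsallisFun_order_one, klFun_apply]
  congr 1
  rcases eq_or_ne w 0 with rfl | hw
  · simp
  have hw' : (w : ℝ) ≠ 0 := by exact_mod_cast hw
  rw [Real.log_div hw' hq']
  field_simp

lemma phi_order_one_real_nonneg (w : ℝ≥0) {q : ℝ≥0} (hq : q ≠ 0) :
    0 ≤ (w * Real.log w - w * Real.log q + q - w : ℝ) := by
  have hq' : (q : ℝ) ≠ 0 := by exact_mod_cast hq
  rcases eq_or_ne w 0 with rfl | hw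
  · simp
  have hw' : (w : ℝ) ≠ 0 := by exact_mod_cast hw
  have := mul_nonneg q.coe_nonneg (klFun_nonneg (x := w / q) (by positivity))
  rw [klFun_apply, Real.log_div hw' hq'] at this
  field_simp at this
  linarith

/-- Pointwise compensation identity: the average of w log w is common to both sides, and the
remaining terms depend only on the average μ. If μ = 0 both sides equal q; if q = 0 < μ both are
`⊤`. -/
lemma sum_mul_phi_order_one {ι : Type*} (s : Finset ι) (p w : ι → ℝ≥0)
    (hp : ∑ i ∈ s, p i = 1) (q : ℝ≥0) :
    ∑ i ∈ s, (p i : ℝ≥0∞) * phi 1 (w i) q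
      = phi 1 (∑ i ∈ s, p i * w i) q
        + ∑ i ∈ s, (p i : ℝ≥0∞) * phi 1 (w i) (∑ j ∈ s, p j * w j) := by
  obtain ⟨μ, hμ⟩ : ∃ μ, μ = ∑ i ∈ s, p i * w i := ⟨_, rfl⟩
  rw [← hμ]
  have hp' : ∑ i ∈ s, (p i : ℝ≥0∞) = 1 := by exact_mod_cast hp
  rcases eq_or_ne μ 0 with h0 | h0
  · have hi : ∀ i ∈ s, p i = 0 ∨ w i = 0 := fun i hi => by
      rw [h0, eq_comm, Finset.sum_eq_zero_iff] at hμ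
      exact mul_eq_zero.1 (hμ i hi)
    have h1 : ∀ r : ℝ≥0, ∑ i ∈ s, (p i : ℝ≥0∞) * phi 1 (w i) r = r := by
      intro r
      calc _ = ∑ i ∈ s, (p i : ℝ≥0∞) * r := by
            refine Finset.sum_congr rfl fun i his => ?_
            rcases hi i his with h | h
            · simp [h]
            · simp [h, phi_zero_left]
        _ = r := by rw [← Finset.sum_mul, hp', one_mul]
    rw [h1, h1, h0, phi_zero_left one_pos]
    simp
  rcases eq_or_ne q 0 with rfl | hq
  · have hr : phi 1 μ 0 = ⊤ := by simp [phi, tsallisSlope, ENNReal.mul_top, h0]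
    obtain ⟨i, his, hi⟩ : ∃ i ∈ s, p i * w i ≠ 0 := by
      by_contra! h
      exact h0 (hμ.trans (Finset.sum_eq_zero h))
    have hl : (p i : ℝ≥0∞) * phi 1 (w i) 0 = ⊤ := by
      have h2 := mul_ne_zero_iff.1 hi
      simp [phi, tsallisSlope, ENNReal.mul_top, h2.1, h2.2]
    rw [hr, top_add, eq_top_iff, ← hl]
    exact Finset.single_le_sum (f := fun i => (p i : ℝ≥0∞) * phi 1 (w i) 0)
      (fun _ _ => zero_le) his
  have key : ∀ r : ℝ≥0, r ≠ 0 → ∑ i ∈ s, (p i : ℝ≥0∞) * phi 1 (w i) r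
      = ENNReal.ofReal (∑ i ∈ s, (p i : ℝ) * (w i * Real.log (w i) - w i * Real.log r + r - w i)) := by
    intro r hr
    rw [ENNReal.ofReal_sum_of_nonneg fun i _ =>
      mul_nonneg (p i).coe_nonneg (phi_order_one_real_nonneg (w i) hr)]
    refine Finset.sum_congr rfl fun i _ => ?_
    rw [phi_order_one_of_pos _ hr, ENNReal.ofReal_mul (p i).coe_nonneg, ENNReal.ofReal_coe_nnreal]
  rw [key q hq, key μ h0, phi_order_one_of_pos _ hq, ← ENNReal.ofReal_add
    (phi_order_one_real_nonneg _ hq) (Finset.sum_nonneg fun i _ =>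
      mul_nonneg (p i).coe_nonneg (phi_order_one_real_nonneg (w i) h0))]
  congr 1
  have hpr : ∑ i ∈ s, (p i : ℝ) = 1 := by exact_mod_cast hp
  have hμr : ∑ i ∈ s, (p i : ℝ) * w i = μ := by rw [hμ]; push_cast; rfl
  have e : ∀ r : ℝ≥0, ∑ i ∈ s, (p i : ℝ) * (w i * Real.log (w i) - w i * Real.log r + r - w i)
      = ∑ i ∈ s, (p i : ℝ) * (w i * Real.log (w i)) - μ * Real.log r + r - μ := by
    intro r
    have : ∀ i ∈ s, (p i : ℝ) * (w i * Real.log (w i) - w i * Real.log r + r - w i)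
        = (p i : ℝ) * (w i * Real.log (w i)) - (p i * w i) * Real.log r + p i * r - p i * w i :=
      fun i _ => by ring
    rw [Finset.sum_congr rfl this, Finset.sum_sub_distrib, Finset.sum_add_distrib,
      Finset.sum_sub_distrib, ← Finset.sum_mul, ← Finset.sum_mul, hpr, hμr, one_mul]
  rw [e, e]
  ring

section

variable {P : ProbabilityMeasure Ω →₀ ℝ≥0} (hP : ∑ W ∈ P.support, P W = 1)

lemma renyiMeanMeasure_order_one : renyiMeanMeasure 1 P = renyiMixture P := by
  rw [← withDensity_meanFun one_pos ENNReal.one_ne_top fun W hW => ac_renyiMixture P hW]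
  conv_rhs => rw [← withDensity_sum_mul_dens P fun W hW => ac_renyiMixture P hW]
  simp [meanFun]

/-- Boundedness of the densities makes x log x of them integrable, so at order one the information
is a finite Bochner integral. -/
lemma dens_renyiMixture_le {W : ProbabilityMeasure Ω} (hW : W ∈ P.support) :
    ∀ᵐ y ∂(renyiMixture P), dens W (renyiMixture P) y ≤ (P W)⁻¹ := by
  have h0 : P W ≠ 0 := Finsupp.mem_support_iff.1 hW
  filter_upwards [dens_mono Measure.AbsolutelyContinuous.rfl (smul_le_renyiMixture P hW),
    dens_smul (ac_renyiMixture P hW) (P W), dens_self (renyiMixture P)] with y h1 h2 h3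
  rw [h2, h3] at h1
  rwa [← one_div, le_div_iff₀ (pos_iff_ne_zero.2 h0), mul_comm]

lemma integrable_mul_log_dens {W : ProbabilityMeasure Ω} (hW : W ∈ P.support) :
    Integrable (fun y => (dens W (renyiMixture P) y : ℝ) * Real.log (dens W (renyiMixture P) y))
      (renyiMixture P) := by
  obtain ⟨B, hB⟩ := (isCompact_Icc (a := (0 : ℝ)) (b := ((P W)⁻¹ : ℝ≥0))).exists_bound_of_continuousOn
    Real.continuous_mul_log.continuousOn
  refine Integrable.of_bound (C := B) ?_ ?_
  · exact (Real.continuous_mul_log.measurable.comp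
      (measurable_dens _ _).coe_nnreal_real).aestronglyMeasurable
  · filter_upwards [dens_renyiMixture_le hW] with y hy
    exact hB _ ⟨NNReal.coe_nonneg _, by exact_mod_cast hy⟩

lemma renyiInfo_order_one :
    renyiInfo 1 P = (∑ W ∈ P.support, (P W : ℝ) *
      ∫ y, (dens W (renyiMixture P) y : ℝ) * Real.log (dens W (renyiMixture P) y)
        ∂(renyiMixture P) : ℝ) := by
  rw [renyiInfo, if_neg ENNReal.one_ne_top, if_pos rfl, renyiMeanMeasure_order_one]
  congr 1
  have e : ∀ y, ∑ W ∈ P.support, renyiPosterior P W y *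
      Real.log (renyiPosterior P W y / (P W : ℝ)) = ∑ W ∈ P.support, (P W : ℝ) *
      ((dens W (renyiMixture P) y : ℝ) * Real.log (dens W (renyiMixture P) y)) := by
    intro y
    refine Finset.sum_congr rfl fun W hW => ?_
    have h0 : (P W : ℝ) ≠ 0 := by exact_mod_cast Finsupp.mem_support_iff.1 hW
    rw [renyiPosterior, renyiMeanMeasure_order_one, mul_div_cancel_left₀ _ h0, mul_assoc]
    rfl
  simp only [e]
  rw [integral_finsetSum]
  · simp only [integral_const_mul]
  · exact fun W hW => (integrable_mul_log_dens hW).const_mul _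

include hP

lemma renyiMean_order_one : renyiMean 1 P = renyiMixture P := by
  have := isProbabilityMeasure_renyiMixture hP
  rw [renyiMean, renyiMeanMeasure_order_one, measure_univ, inv_one, one_smul]

lemma tsallis_one_renyiMixture {W : ProbabilityMeasure Ω} (hW : W ∈ P.support) :
    0 ≤ ∫ y, (dens W (renyiMixture P) y : ℝ) * Real.log (dens W (renyiMixture P) y)
        ∂(renyiMixture P) ∧
    tsallis 1 W (renyiMixture P) = ENNReal.ofReal
      (∫ y, (dens W (renyiMixture P) y : ℝ) * Real.log (dens W (renyiMixture P) y)
        ∂(renyiMixture P)) := by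
  have := isProbabilityMeasure_renyiMixture hP
  have hac := ac_renyiMixture P hW
  have hi := integrable_mul_log_dens hW
  have hfin : ∫⁻ y, (dens W (renyiMixture P) y : ℝ≥0∞) ∂(renyiMixture P) ≠ ⊤ := by
    rw [lintegral_dens hac]; exact measure_ne_top _ _
  have hd : Integrable (fun y => (dens W (renyiMixture P) y : ℝ)) (renyiMixture P) := by
    have := integrable_toReal_of_lintegral_ne_top
      (measurable_dens W (renyiMixture P)).coe_nnreal_ennreal.aemeasurable hfin
    simpa using this
  have hdi : ∫ y, (dens W (renyiMixture P) y : ℝ) ∂(renyiMixture P) = 1 := by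
    have := integral_toReal (μ := renyiMixture P) (measurable_dens W (renyiMixture P)).coe_nnreal_ennreal.aemeasurable
      (ae_of_all _ fun y => ENNReal.coe_lt_top)
    rw [lintegral_dens hac, measure_univ] at this
    simpa using this
  have hk : Integrable (fun y => klFun (dens W (renyiMixture P) y)) (renyiMixture P) := by
    simp only [klFun_apply]
    exact (hi.add (integrable_const 1)).sub hd
  have e : ∫ y, klFun (dens W (renyiMixture P) y) ∂(renyiMixture P) = ∫ y, (dens W (renyiMixture P) y : ℝ) * Real.log (dens W (renyiMixture P) y) ∂(renyiMixture P) := by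
    simp only [klFun_apply]
    have h1 := integral_sub (hi.add (integrable_const (1 : ℝ))) hd
    have h2 := integral_add hi (integrable_const (1 : ℝ))
    simp only [Pi.add_apply] at h1
    rw [h1, h2, hdi]
    simp
  rw [← e]
  refine ⟨integral_nonneg fun y => klFun_nonneg (NNReal.coe_nonneg _), ?_⟩
  rw [tsallis_eq one_pos hac Measure.AbsolutelyContinuous.rfl,
    ofReal_integral_eq_lintegral_ofReal hk (ae_of_all _ fun y => klFun_nonneg (NNReal.coe_nonneg _))]
  apply lintegral_congr_ae
  filter_upwards [dens_self (renyiMixture P)] with y hy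
  rw [hy]
  simp [phi, tsallisFun_order_one]

lemma sum_mul_tsallis_order_one (Q : Measure Ω) [IsProbabilityMeasure Q] :
    ∑ W ∈ P.support, (P W : ℝ≥0∞) * tsallis 1 W Q
      = tsallis 1 (renyiMixture P) Q
        + ∑ W ∈ P.support, (P W : ℝ≥0∞) * tsallis 1 W (renyiMixture P) := by
  have := isProbabilityMeasure_renyiMixture hP
  obtain ⟨ν, hν⟩ : ∃ ν, ν = renyiMixture P + Q := ⟨_, rfl⟩
  have : IsFiniteMeasure ν := by rw [hν]; infer_instance
  have hm : renyiMixture P ≪ ν := by rw [hν]; exact ac_add_left _ _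
  have hW : ∀ W ∈ P.support, (W : Measure Ω) ≪ ν := fun W hW => (ac_renyiMixture P hW).trans hm
  have hQ : Q ≪ ν := by rw [hν]; exact ac_add_right _ _
  have hd := dens_ae_eq (Finset.measurable_sum _ fun W _ => (measurable_dens _ _).const_mul _)
    (withDensity_sum_mul_dens P hW)
  have e : ∀ R : Measure Ω, IsFiniteMeasure R → R ≪ ν →
      ∑ W ∈ P.support, (P W : ℝ≥0∞) * tsallis 1 W R
      = ∫⁻ y, ∑ W ∈ P.support, P W * phi 1 (dens W ν y) (dens R ν y) ∂ν := by
    intro R _ hR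
    rw [lintegral_finsetSum]
    · refine Finset.sum_congr rfl fun W hW' => ?_
      rw [tsallis_eq one_pos (hW W hW') hR, lintegral_const_mul _ (measurable_phi_dens one_pos _ _ _)]
    · exact fun W _ => (measurable_phi_dens one_pos _ _ _).const_mul _
  rw [e Q inferInstance hQ, e _ inferInstance hm, tsallis_eq one_pos hm hQ,
    ← lintegral_add_left (measurable_phi_dens one_pos _ _ _)]
  apply lintegral_congr_ae
  filter_upwards [hd] with y hy
  rw [hy]
  exact sum_mul_phi_order_one _ _ _ hP _

lemma sibson_order_one : ∃ I : ℝ, 0 ≤ I ∧ renyiInfo 1 P = I ∧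
    ∀ Q : Measure Ω, IsProbabilityMeasure Q →
      ∑ W ∈ P.support, (P W : ℝ≥0∞) * tsallis 1 W Q
        = ENNReal.ofReal (level 1 I)
          + ENNReal.ofReal (Real.exp ((1 - 1) * I)) * tsallis 1 (renyiMean 1 P) Q := by
  refine ⟨_, ?_, renyiInfo_order_one, fun Q _ => ?_⟩
  · exact Finset.sum_nonneg fun W hW =>
      mul_nonneg (P W).coe_nonneg (tsallis_one_renyiMixture hP hW).1
  · rw [sum_mul_tsallis_order_one hP, renyiMean_order_one hP, level_order_one, sub_self, zero_mul,
      Real.exp_zero, ENNReal.ofReal_one, one_mul, add_comm, ENNReal.ofReal_sum_of_nonneg fun W hW =>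
      mul_nonneg (P W).coe_nonneg (tsallis_one_renyiMixture hP hW).1]
    congr 1
    refine Finset.sum_congr rfl fun W hW => ?_
    rw [(tsallis_one_renyiMixture hP hW).2, ENNReal.ofReal_mul (P W).coe_nonneg,
      ENNReal.ofReal_coe_nnreal]

/-- The only fact about priors of finite order used from here on, apart from their mean being a
probability measure. -/
lemma sibson {α : ℝ≥0∞} (hα0 : 0 < α) (hα : α ≠ ⊤) : ∃ I : ℝ, 0 ≤ I ∧ renyiInfo α P = I ∧
    ∀ Q : Measure Ω, IsProbabilityMeasure Q →
      ∑ W ∈ P.support, (P W : ℝ≥0∞) * tsallis α.toReal W Q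
        = ENNReal.ofReal (level α.toReal I)
          + ENNReal.ofReal (Real.exp ((α.toReal - 1) * I))
            * tsallis α.toReal (renyiMean α P) Q := by
  rcases eq_or_ne α 1 with rfl | h1
  · simpa only [ENNReal.toReal_one] using sibson_order_one hP
  · exact sibson_of_ne_one hα0 hα hP h1

end

/-! ### Finite order: mixing priors, existence and uniqueness of the center -/

lemma sum_support_mix {X : Type*} (P R : X →₀ ℝ≥0) (s t : ℝ≥0) (F : X → ℝ≥0∞) :
    ∑ x ∈ (s • P + t • R).support, ((s • P + t • R) x : ℝ≥0∞) * F x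
      = s * ∑ x ∈ P.support, (P x : ℝ≥0∞) * F x + t * ∑ x ∈ R.support, (R x : ℝ≥0∞) * F x := by
  classical
  have hz : ∀ (Q : X →₀ ℝ≥0) (S : Finset X), Q.support ⊆ S →
      ∑ x ∈ Q.support, (Q x : ℝ≥0∞) * F x = ∑ x ∈ S, (Q x : ℝ≥0∞) * F x := fun Q S h =>
    Finset.sum_subset h fun x _ hx => by simp [Finsupp.notMem_support_iff.1 hx]
  rw [hz P _ Finset.subset_union_left, hz R _ (Finset.subset_union_right (s₁ := P.support)),
    hz (s • P + t • R) (P.support ∪ R.support), Finset.mul_sum, Finset.mul_sum,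
    ← Finset.sum_add_distrib]
  · refine Finset.sum_congr rfl fun x _ => ?_
    simp only [Finsupp.add_apply, Finsupp.smul_apply, smul_eq_mul]
    push_cast
    ring
  · exact Finsupp.support_add.trans
      (Finset.union_subset_union Finsupp.support_smul Finsupp.support_smul)

lemma mix_mem_renyiFinPMF {X : Type*} {S : Set X} {P R : X →₀ ℝ≥0} (hP : P ∈ renyiFinPMF S)
    (hR : R ∈ renyiFinPMF S) {s t : ℝ≥0} (hst : s + t = 1) : s • P + t • R ∈ renyiFinPMF S := by
  classical
  refine ⟨?_, ?_⟩
  · intro x hx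
    have := (Finsupp.support_add.trans
      (Finset.union_subset_union Finsupp.support_smul Finsupp.support_smul)) (Finset.mem_coe.1 hx)
    rcases Finset.mem_union.1 this with h | h
    · exact hP.1 h
    · exact hR.1 h
  · have h := sum_support_mix P R s t fun _ => 1
    simp only [mul_one] at h
    have h1 := hP.2
    have h2 := hR.2
    rw [← ENNReal.coe_inj, ENNReal.ofNNReal_finsetSum] at h1 h2 ⊢
    rw [h, h1, h2, ENNReal.coe_one, mul_one, mul_one, ← ENNReal.coe_add, hst, ENNReal.coe_one]

lemma single_mem_renyiFinPMF {X : Type*} {S : Set X} {x : X} (hx : x ∈ S) :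
    Finsupp.single x 1 ∈ renyiFinPMF S := by
  classical
  have h : (Finsupp.single x (1 : ℝ≥0)).support = {x} := Finsupp.support_single x one_ne_zero
  refine ⟨?_, ?_⟩
  · rw [h]; simpa using hx
  · rw [h]; simp

lemma le_ofReal_sub_of_add_le {A B : ℝ} (hA : 0 ≤ A) {y : ℝ≥0∞}
    (h : ENNReal.ofReal A + y ≤ ENNReal.ofReal B) : y ≤ ENNReal.ofReal (B - A) := by
  rw [ENNReal.ofReal_sub _ hA]
  exact ENNReal.le_sub_of_add_le_left ENNReal.ofReal_ne_top h

lemma le_ofReal_div_of_mul_le {m B : ℝ} (hm : 0 < m) {y : ℝ≥0∞}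
    (h : ENNReal.ofReal m * y ≤ ENNReal.ofReal B) : y ≤ ENNReal.ofReal (B / m) := by
  rw [ENNReal.ofReal_div_of_pos hm, ENNReal.le_div_iff_mul_le, mul_comm]
  · exact h
  · left; simpa using hm
  · left; exact ENNReal.ofReal_ne_top

/-- A lower bound for the weights in `sibson` for priors of information at most `C`. -/
lemma exp_neg_le {a C I : ℝ} (hI : 0 ≤ I) (hIC : I ≤ C) :
    Real.exp (-(|a - 1| * C)) ≤ Real.exp ((a - 1) * I) := by
  rw [Real.exp_le_exp]
  have h1 := neg_abs_le (a - 1)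
  have h2 := abs_nonneg (a - 1)
  nlinarith

lemma le_capacity {α : ℝ≥0∞} {𝒲 : Set (ProbabilityMeasure Ω)} {C : ℝ}
    (hC : renyiCapacity α 𝒲 = C) {P : ProbabilityMeasure Ω →₀ ℝ≥0} (hP : P ∈ renyiFinPMF 𝒲) {I : ℝ}
    (hI : renyiInfo α P = I) : I ≤ C := by
  have : renyiInfo α P ≤ renyiCapacity α 𝒲 := le_iSup₂ (f := fun P _ => renyiInfo α P) P hP
  rw [hI, hC] at this
  exact_mod_cast this

section Finite

variable {α : ℝ≥0∞} (hα0 : 0 < α) (hα : α ≠ ⊤)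
include hα0 hα

/-- The Rényi information plus the divergence of the mean, bounded above. -/
lemma mul_tsallis_renyiMean_le {P : ProbabilityMeasure Ω →₀ ℝ≥0}
    (hP : ∑ W ∈ P.support, P W = 1) {I : ℝ} (hI : renyiInfo α P = I) {C : ℝ} (hIC : I ≤ C)
    {Q : Measure Ω} [IsProbabilityMeasure Q] {K : ℝ}
    (h : ∑ W ∈ P.support, (P W : ℝ≥0∞) * tsallis α.toReal W Q ≤ ENNReal.ofReal K) :
    tsallis α.toReal (renyiMean α P) Q ≤
      ENNReal.ofReal ((K - level α.toReal I) / Real.exp (-(|α.toReal - 1| * C))) := by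
  obtain ⟨J, hJ0, hJ, hS⟩ := sibson hP hα0 hα
  obtain rfl : I = J := by rw [hI] at hJ; exact_mod_cast hJ
  rw [hS Q inferInstance] at h
  have h1 := le_ofReal_sub_of_add_le (level_nonneg hJ0) h
  refine le_ofReal_div_of_mul_le (Real.exp_pos _) (le_trans ?_ h1)
  exact mul_le_mul' (ENNReal.ofReal_le_ofReal (exp_neg_le hJ0 hIC)) le_rfl

variable {𝒲 : Set (ProbabilityMeasure Ω)} {C : ℝ} (hC : renyiCapacity α 𝒲 = C)
include hC

lemma exists_level_ge {η : ℝ} (hη : 0 < η) : ∃ P ∈ renyiFinPMF 𝒲, ∃ I : ℝ, 0 ≤ I ∧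
    renyiInfo α P = I ∧ level α.toReal C - η ≤ level α.toReal I := by
  have hc := (continuous_level α.toReal).tendsto C
  obtain ⟨ε, hε, h⟩ := Metric.tendsto_nhds_nhds.1 hc η hη
  have hlt : ((C - ε : ℝ) : EReal) < renyiCapacity α 𝒲 := by
    rw [hC]; exact_mod_cast sub_lt_self C hε
  rw [renyiCapacity] at hlt
  simp only [lt_iSup_iff] at hlt
  obtain ⟨P, hP, hlt⟩ := hlt
  obtain ⟨I, hI0, hI, -⟩ := sibson hP.2 hα0 hα
  have hIC := le_capacity hC hP hI
  rw [hI] at hlt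
  have hlt' : C - ε < I := by exact_mod_cast hlt
  refine ⟨P, hP, I, hI0, hI, ?_⟩
  have := h (x := I) (by rw [Real.dist_eq, abs_lt]; constructor <;> linarith)
  rw [Real.dist_eq, abs_lt] at this
  linarith [this.1]

/-- Take for r the mean of the mixed prior. Its divergence from itself is 0, so Sibson's identity
leaves only the level of the information, which the capacity bounds. -/
lemma exists_mix_tsallis_le {P R : ProbabilityMeasure Ω →₀ ℝ≥0} (hP : P ∈ renyiFinPMF 𝒲)
    (hR : R ∈ renyiFinPMF 𝒲) {s t : ℝ≥0} (hst : s + t = 1) :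
    ∃ r : Measure Ω, IsProbabilityMeasure r ∧
      s * ∑ W ∈ P.support, (P W : ℝ≥0∞) * tsallis α.toReal W r
        + t * ∑ W ∈ R.support, (R W : ℝ≥0∞) * tsallis α.toReal W r
        ≤ ENNReal.ofReal (level α.toReal C) := by
  have hM := mix_mem_renyiFinPMF hP hR hst
  obtain ⟨I, hI0, hI, hS⟩ := sibson hM.2 hα0 hα
  have hp := isProbabilityMeasure_renyiMean_of_ne_top hα0 hα hM.2
  refine ⟨renyiMean α (s • P + t • R), hp, ?_⟩
  rw [← sum_support_mix, hS _ hp, tsallis_self, mul_zero, add_zero]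
  exact ENNReal.ofReal_le_ofReal ((level_strictMono _).monotone (le_capacity hC hM hI))

/-- With r the mean of the even mixture, the two averages of T(·‖r) sum to at most 2 level(C), while
each is at least its own nearly maximal level. So both means are close to r, hence to each other. -/
lemma exists_forall_renyiMean_le {δ : ℝ≥0} (hδ : 0 < δ) : ∃ η : ℝ, 0 < η ∧
    ∀ P ∈ renyiFinPMF 𝒲, ∀ R ∈ renyiFinPMF 𝒲, ∀ I J : ℝ, renyiInfo α P = I → renyiInfo α R = J →
      level α.toReal C - η ≤ level α.toReal I → level α.toReal C - η ≤ level α.toReal J →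
      ∀ A, MeasurableSet A → renyiMean α P A ≤ renyiMean α R A + δ := by
  have ha0 := ENNReal.toReal_pos hα0.ne' hα
  obtain ⟨η, hη, hT⟩ := exists_forall_tsallis_le (Ω := Ω) ha0 (δ := δ / 2) (by positivity)
  set a := α.toReal
  set m := Real.exp (-(|a - 1| * C)) with hm
  have hm0 : 0 < m := Real.exp_pos _
  have main : ∀ P ∈ renyiFinPMF 𝒲, ∀ R ∈ renyiFinPMF 𝒲, ∀ I J : ℝ, renyiInfo α P = I →
      renyiInfo α R = J → level a C - m * η / 2 ≤ level a I → level a C - m * η / 2 ≤ level a J →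
      ∀ r : Measure Ω, IsProbabilityMeasure r → ((1 / 2 : ℝ≥0) : ℝ≥0∞) *
        ∑ W ∈ P.support, (P W : ℝ≥0∞) * tsallis α.toReal W r
        + ((1 / 2 : ℝ≥0) : ℝ≥0∞) * ∑ W ∈ R.support, (R W : ℝ≥0∞) * tsallis α.toReal W r
        ≤ ENNReal.ofReal (level α.toReal C) → tsallis a (renyiMean α P) r ≤ ENNReal.ofReal η := by
    intro P hP R hR I J hI hJ hIη hJη r hr h
    have hSR : ENNReal.ofReal (level a J) ≤
        ∑ W ∈ R.support, (R W : ℝ≥0∞) * tsallis α.toReal W r := by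
      obtain ⟨J', hJ0, hJ', hS⟩ := sibson hR.2 hα0 hα
      obtain rfl : J = J' := by rw [hJ] at hJ'; exact_mod_cast hJ'
      rw [hS r hr]; exact le_self_add
    have hJ0 : 0 ≤ J := by
      obtain ⟨J', hJ0, hJ', hS⟩ := sibson hR.2 hα0 hα
      rw [hJ] at hJ'; have : J = J' := by exact_mod_cast hJ'
      rwa [this]
    have h1 : ENNReal.ofReal (level a J) + ∑ W ∈ P.support, (P W : ℝ≥0∞) * tsallis α.toReal W r
        ≤ ENNReal.ofReal (2 * level a C) := by
      calc _ ≤ ∑ W ∈ R.support, (R W : ℝ≥0∞) * tsallis α.toReal W r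
            + ∑ W ∈ P.support, (P W : ℝ≥0∞) * tsallis α.toReal W r := by gcongr
        _ = 2 * (((1 / 2 : ℝ≥0) : ℝ≥0∞) * ∑ W ∈ P.support, (P W : ℝ≥0∞) * tsallis α.toReal W r
          + ((1 / 2 : ℝ≥0) : ℝ≥0∞) * ∑ W ∈ R.support, (R W : ℝ≥0∞) * tsallis α.toReal W r) := by
            have : (2 : ℝ≥0∞) * ((1 / 2 : ℝ≥0) : ℝ≥0∞) = 1 := by
              rw [← ENNReal.coe_ofNat, ← ENNReal.coe_mul]; norm_num
            rw [mul_add, ← mul_assoc, ← mul_assoc, this, one_mul, one_mul, add_comm]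
        _ ≤ 2 * ENNReal.ofReal (level a C) := by gcongr
        _ = _ := by rw [ENNReal.ofReal_mul zero_le_two]; simp
    have h2 := mul_tsallis_renyiMean_le hα0 hα hP.2 hI (le_capacity hC hP hI)
      (le_ofReal_sub_of_add_le (level_nonneg hJ0) h1)
    refine h2.trans (ENNReal.ofReal_le_ofReal ?_)
    rw [div_le_iff₀ (Real.exp_pos _)]
    change _ ≤ η * m
    linarith
  -- The two deficits add up to at most m η, and division by the lower bound m of the Sibson factor
  -- leaves η.
  refine ⟨m * η / 2, by positivity, fun P hP R hR I J hI hJ hIη hJη A hA => ?_⟩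
  obtain ⟨r, hr, h⟩ := exists_mix_tsallis_le hα0 hα hC hP hR
    (show (1 / 2 : ℝ≥0) + 1 / 2 = 1 by norm_num)
  have hp := isProbabilityMeasure_renyiMean_of_ne_top hα0 hα hP.2
  have hq := isProbabilityMeasure_renyiMean_of_ne_top hα0 hα hR.2
  have h1 := hT _ r hp hr (main P hP R hR I J hI hJ hIη hJη r hr h) A hA
  have h2 := hT _ r hq hr (main R hR P hP J I hJ hI hJη hIη r hr (by rw [add_comm]; exact h))
  have h3 := le_add_symm_of_forall h2 hA
  calc renyiMean α P A ≤ renyiMean α R A + (δ / 2 : ℝ≥0) + (δ / 2 : ℝ≥0) := by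
        refine h1.trans ?_
        gcongr
    _ = _ := by rw [add_assoc, ← ENNReal.coe_add, add_halves]

/-- The limit q of nearly optimal means does not depend on W. For given W, weight τ is put on W and
1 - τ on the n-th prior; the mean r of this mixture stays near q while T(W‖r) is at most K + τ. -/
lemma exists_forall_renyiDiv_le_of_ne_top (hC0 : 0 ≤ C) : ∃ q : Measure Ω, IsProbabilityMeasure q ∧
    ∀ W ∈ 𝒲, renyiDiv α (W : Measure Ω) q ≤ C := by
  have ha0 := ENNReal.toReal_pos hα0.ne' hα
  set a := α.toReal with ha
  set K := level a C with hK
  have hK0 : 0 ≤ K := level_nonneg hC0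
  -- The shift by 2 keeps τ ≤ 1 / 2, so 1 - τ can be divided out.
  obtain ⟨τ, hτ⟩ : ∃ τ : ℕ → ℝ≥0, τ = fun n : ℕ => (1 / (n + 2) : ℝ≥0) := ⟨_, rfl⟩
  have hτ0 : ∀ n, 0 < τ n := fun n => by rw [hτ]; positivity
  have hτ2 : ∀ n, τ n ≤ 1 / 2 := fun n => by
    rw [hτ]; dsimp only; gcongr; exact le_add_self
  have hτanti : Antitone τ := fun m n hmn => by
    rw [hτ]; dsimp only; gcongr
  have hτlim : Tendsto (fun n => (τ n : ℝ)) atTop (𝓝 0) := by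
    have h1 := (tendsto_add_atTop_iff_nat 1).2 (tendsto_one_div_add_atTop_nhds_zero_nat (𝕜 := ℝ))
    refine h1.congr fun n => ?_
    rw [hτ]; push_cast; ring
  -- The deficit is τ ^ 2 because isolating the W-term divides it by τ, and the quotient still has
  -- to vanish.
  have hex : ∀ n, ∃ P ∈ renyiFinPMF 𝒲, ∃ I : ℝ, 0 ≤ I ∧
    renyiInfo α P = I ∧ K - (τ n : ℝ) ^ 2 ≤ level a I := fun n =>
    exists_level_ge hα0 hα hC (by have := hτ0 n; positivity)
  choose P hP I hI0 hI hIK using hex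
  have hp := fun n => isProbabilityMeasure_renyiMean_of_ne_top hα0 hα (hP n).2
  obtain ⟨q, hq, hlim⟩ := exists_measure_forall_le_add (p := fun n => renyiMean α (P n)) (by
    intro δ hδ
    obtain ⟨η, hη, h⟩ := exists_forall_renyiMean_le hα0 hα hC hδ
    have : ∀ᶠ n in atTop, (τ n : ℝ) ^ 2 < η := by
      have := hτlim.pow 2
      rw [zero_pow two_ne_zero] at this
      exact this.eventually_lt_const hη
    obtain ⟨N, hN⟩ := eventually_atTop.1 this
    exact ⟨N, fun m hm n hn A hA => h _ (hP m) _ (hP n) _ _ (hI m) (hI n)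
      (by linarith [hN m hm, hIK m]) (by linarith [hN n hn, hIK n]) A hA⟩)
  refine ⟨q, hq, fun W hW => ?_⟩
  rw [renyiDiv_le_coe_iff hα0 hα (W : Measure Ω) q hC0]
  have hex : ∀ n, ∃ r : Measure Ω, IsProbabilityMeasure r ∧
      tsallis a W r ≤ ENNReal.ofReal (K + τ n) ∧
      tsallis a (renyiMean α (P n)) r ≤
        ENNReal.ofReal ((τ n * K + τ n) / (1 / 2) / Real.exp (-(|a - 1| * C))) := by
    intro n
    have hst : (1 - τ n) + τ n = 1 := tsub_add_cancel_of_le ((hτ2 n).trans (by norm_num))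
    have hst' : ((1 - τ n : ℝ≥0) : ℝ) = 1 - τ n := by
      rw [NNReal.coe_sub ((hτ2 n).trans (by norm_num))]; rfl
    have hsc : ((1 - τ n : ℝ≥0) : ℝ≥0∞) = ENNReal.ofReal (1 - τ n) := by
      rw [← hst', ENNReal.ofReal_coe_nnreal]
    have hτr : (τ n : ℝ) ≤ 1 / 2 := by exact_mod_cast hτ2 n
    have hτr0 : (0 : ℝ) < τ n := hτ0 n
    obtain ⟨r, hr, h⟩ := exists_mix_tsallis_le hα0 hα hC (hP n) (single_mem_renyiFinPMF hW) hst
    refine ⟨r, hr, ?_, ?_⟩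
    · classical
      rw [Finsupp.support_single W one_ne_zero, Finset.sum_singleton, Finsupp.single_eq_same,
        ENNReal.coe_one, one_mul] at h
      obtain ⟨J, hJ0, hJ, hS⟩ := sibson (hP n).2 hα0 hα
      have hIJ : I n = J := by have := hI n; rw [hJ] at this; exact_mod_cast this.symm
      have h1 : ENNReal.ofReal ((1 - τ n) * level a (I n)) + τ n * tsallis a W r
          ≤ ENNReal.ofReal K := by
        refine le_trans ?_ h
        rw [ENNReal.ofReal_mul (by linarith), hsc, hS r hr, hIJ]
        gcongr
        exact le_self_add
      have h2 := le_ofReal_sub_of_add_le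
        (mul_nonneg (by linarith) (level_nonneg (hI0 n))) h1
      rw [← ENNReal.ofReal_coe_nnreal] at h2
      refine (le_ofReal_div_of_mul_le hτr0 h2).trans (ENNReal.ofReal_le_ofReal ?_)
      rw [div_le_iff₀ hτr0]
      nlinarith [hIK n, mul_le_mul_of_nonneg_left (hIK n) (show (0 : ℝ) ≤ 1 - τ n by linarith),
        mul_pos hτr0 (mul_pos hτr0 hτr0)]
    · have h1 : ENNReal.ofReal (1 - τ n) *
          ∑ V ∈ (P n).support, (P n V : ℝ≥0∞) * tsallis α.toReal V r ≤ ENNReal.ofReal K := by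
        rw [← hsc]; exact le_self_add.trans h
      have h2 := mul_tsallis_renyiMean_le hα0 hα (hP n).2 (hI n)
        (le_capacity hC (hP n) (hI n)) (le_ofReal_div_of_mul_le (by linarith) h1)
      refine h2.trans (ENNReal.ofReal_le_ofReal ?_)
      gcongr
      rw [sub_le_iff_le_add, div_le_iff₀ (by linarith), add_mul, div_mul_eq_mul_div,
        ← sub_le_iff_le_add, le_div_iff₀ (by norm_num)]
      nlinarith [hIK n, mul_le_mul_of_nonneg_left (hIK n) (show (0 : ℝ) ≤ 1 - τ n by linarith),
        mul_pos hτr0 (mul_pos hτr0 hτr0), mul_nonneg hτr0.le hK0, mul_pos hτr0 hτr0,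
        mul_nonneg (mul_nonneg hτr0.le hK0) (show (0 : ℝ) ≤ 1 / 2 - τ n by linarith),
        mul_nonneg hτr0.le (show (0 : ℝ) ≤ 1 / 2 - τ n by linarith)]
  choose r hr hWr hPr using hex
  refine tsallis_le_of_tendsto ha0 (p := r) ?_ (c := fun n => ENNReal.ofReal (K + τ n)) ?_ hWr
  · intro δ hδ
    have hδ2 : 0 < δ / 2 := by positivity
    obtain ⟨η, hη, hT⟩ := exists_forall_tsallis_le (Ω := Ω) ha0 hδ2
    obtain ⟨N, hN⟩ := hlim _ hδ2
    have hl : Tendsto (fun n => (τ n * K + τ n) / (1 / 2) / Real.exp (-(|a - 1| * C))) atTop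
        (𝓝 ((0 * K + 0) / (1 / 2) / Real.exp (-(|a - 1| * C)))) :=
      (((hτlim.mul_const K).add hτlim).div_const _).div_const _
    rw [zero_mul, add_zero, zero_div, zero_div] at hl
    obtain ⟨M, hM⟩ := eventually_atTop.1 (hl.eventually_lt_const hη)
    refine ⟨max N M, fun n hn A hA => ?_⟩
    have h1 := hT _ (r n) (hp n) (hr n)
      ((hPr n).trans (ENNReal.ofReal_le_ofReal (hM n (le_of_max_le_right hn)).le))
    calc r n A ≤ renyiMean α (P n) A + (δ / 2 : ℝ≥0) := le_add_symm_of_forall h1 hA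
      _ ≤ q A + (δ / 2 : ℝ≥0) + (δ / 2 : ℝ≥0) := by
        gcongr
        exact hN n (le_of_max_le_left hn) A hA
      _ = _ := by rw [add_assoc, ← ENNReal.coe_add, add_halves]
  · have := ENNReal.tendsto_ofReal (hτlim.const_add K)
    rwa [add_zero] at this

/-- Sibson's identity forces the mean of a nearly optimal prior to be close to any such measure, so
q and q' are both close to the same mean. -/
lemma eq_of_forall_renyiDiv_le_of_ne_top (hC0 : 0 ≤ C) {q q' : Measure Ω}
    [IsProbabilityMeasure q] [IsProbabilityMeasure q']
    (hq : ∀ W ∈ 𝒲, renyiDiv α (W : Measure Ω) q ≤ C)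
    (hq' : ∀ W ∈ 𝒲, renyiDiv α (W : Measure Ω) q' ≤ C) : q = q' := by
  have ha0 := ENNReal.toReal_pos hα0.ne' hα
  refine eq_of_forall_le_add fun δ hδ A hA => ?_
  have hδ2 : 0 < δ / 2 := by positivity
  obtain ⟨η, hη, hT⟩ := exists_forall_tsallis_le (Ω := Ω) ha0 hδ2
  set m := Real.exp (-(|α.toReal - 1| * C)) with hm
  have hm0 : 0 < m := Real.exp_pos _
  obtain ⟨P, hP, I, hI0, hI, hIK⟩ := exists_level_ge hα0 hα hC (η := m * η) (by positivity)
  have hp := isProbabilityMeasure_renyiMean_of_ne_top hα0 hα hP.2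
  have key : ∀ r : Measure Ω, IsProbabilityMeasure r → (∀ W ∈ 𝒲, renyiDiv α (W : Measure Ω) r ≤ C) →
      ∀ A, MeasurableSet A → renyiMean α P A ≤ r A + (δ / 2 : ℝ≥0) := by
    intro r _ hr
    refine hT _ r hp inferInstance ?_
    have h1 : ∑ W ∈ P.support, (P W : ℝ≥0∞) * tsallis α.toReal W r
        ≤ ENNReal.ofReal (level α.toReal C) := by
      calc _ ≤ ∑ W ∈ P.support, (P W : ℝ≥0∞) * ENNReal.ofReal (level α.toReal C) := by
            gcongr with W hW
            exact (renyiDiv_le_coe_iff hα0 hα (W : Measure Ω) r hC0).1 (hr W (hP.1 hW))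
        _ = _ := by
            rw [← Finset.sum_mul]
            have : ∑ W ∈ P.support, (P W : ℝ≥0∞) = 1 := by exact_mod_cast hP.2
            rw [this, one_mul]
    refine (mul_tsallis_renyiMean_le hα0 hα hP.2 hI (le_capacity hC hP hI) h1).trans
      (ENNReal.ofReal_le_ofReal ?_)
    rw [div_le_iff₀ hm0]
    linarith
  calc q A ≤ renyiMean α P A + (δ / 2 : ℝ≥0) :=
        le_add_symm_of_forall (key q inferInstance hq) hA
    _ ≤ q' A + (δ / 2 : ℝ≥0) + (δ / 2 : ℝ≥0) := by
        gcongr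
        exact key q' inferInstance hq' A hA
    _ = _ := by rw [add_assoc, ← ENNReal.coe_add, add_halves]

end Finite

/-! ### Finite order: divergence of the mean from a reference measure -/

/-- Average the bounds on T; in Sibson's identity level(c) - level(I) is exp((a - 1) I) times
level(c - I), and the factor cancels. -/
lemma renyiDiv_renyiMean_le_of_ne_top {α : ℝ≥0∞} (hα0 : 0 < α) (hα : α ≠ ⊤)
    {P : ProbabilityMeasure Ω →₀ ℝ≥0} (hP : ∑ W ∈ P.support, P W = 1) {q : Measure Ω}
    [IsProbabilityMeasure q] {I c : ℝ} (hI : renyiInfo α P = I)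
    (h : ∀ W ∈ P.support, renyiDiv α (W : Measure Ω) q ≤ c) :
    renyiDiv α (renyiMean α P) q ≤ (c - I : ℝ) := by
  have hp := isProbabilityMeasure_renyiMean_of_ne_top hα0 hα hP
  obtain ⟨J, hJ0, hJ, hS⟩ := sibson hP hα0 hα
  obtain rfl : I = J := by rw [hI] at hJ; exact_mod_cast hJ
  have hc : 0 ≤ c := by
    obtain ⟨W, hW⟩ := exists_mem_support hP
    exact_mod_cast (renyiDiv_nonneg_of_ne_top hα0 hα (W : Measure Ω) q).trans (h W hW)
  have h1 : ∑ W ∈ P.support, (P W : ℝ≥0∞) * tsallis α.toReal W q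
      ≤ ENNReal.ofReal (level α.toReal c) := by
    calc _ ≤ ∑ W ∈ P.support, (P W : ℝ≥0∞) * ENNReal.ofReal (level α.toReal c) := by
          gcongr with W hW
          exact (renyiDiv_le_coe_iff hα0 hα (W : Measure Ω) q hc).1 (h W hW)
      _ = _ := by
          rw [← Finset.sum_mul]
          have : ∑ W ∈ P.support, (P W : ℝ≥0∞) = 1 := by exact_mod_cast hP
          rw [this, one_mul]
  rw [hS q inferInstance] at h1
  have hIc : I ≤ c := by
    have := le_self_add.trans h1
    rw [ENNReal.ofReal_le_ofReal_iff (level_nonneg hc)] at this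
    exact (level_strictMono _).le_iff_le.1 this
  rw [renyiDiv_le_coe_iff hα0 hα _ q (sub_nonneg.2 hIc)]
  have h2 := le_ofReal_div_of_mul_le (Real.exp_pos _)
    (le_ofReal_sub_of_add_le (level_nonneg hJ0) h1)
  have h3 := level_add α.toReal I (c - I)
  rw [add_sub_cancel] at h3
  rw [h3, add_sub_cancel_left, mul_div_cancel_left₀ _ (Real.exp_pos _).ne'] at h2
  exact h2

lemma le_renyiDiv_renyiMean_of_ne_top {α : ℝ≥0∞} (hα0 : 0 < α) (hα : α ≠ ⊤)
    {P : ProbabilityMeasure Ω →₀ ℝ≥0} (hP : ∑ W ∈ P.support, P W = 1) {q : Measure Ω}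
    [IsProbabilityMeasure q] {I c : ℝ} (hI : renyiInfo α P = I)
    (h : ∀ W ∈ P.support, c ≤ renyiDiv α (W : Measure Ω) q) :
    (c - I : ℝ) ≤ renyiDiv α (renyiMean α P) q := by
  have hp := isProbabilityMeasure_renyiMean_of_ne_top hα0 hα hP
  obtain ⟨J, hJ0, hJ, hS⟩ := sibson hP hα0 hα
  obtain rfl : I = J := by rw [hI] at hJ; exact_mod_cast hJ
  rcases le_total c I with hIc | hIc
  · refine le_trans ?_ (renyiDiv_nonneg_of_ne_top hα0 hα _ _)
    exact_mod_cast sub_nonpos.2 hIc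
  have hc := hJ0.trans hIc
  have h1 : ENNReal.ofReal (level α.toReal c) ≤
      ∑ W ∈ P.support, (P W : ℝ≥0∞) * tsallis α.toReal W q := by
    calc _ = ∑ W ∈ P.support, (P W : ℝ≥0∞) * ENNReal.ofReal (level α.toReal c) := by
          rw [← Finset.sum_mul]
          have : ∑ W ∈ P.support, (P W : ℝ≥0∞) = 1 := by exact_mod_cast hP
          rw [this, one_mul]
      _ ≤ _ := by
          gcongr with W hW
          exact (coe_le_renyiDiv_iff hα0 hα (W : Measure Ω) q hc).1 (h W hW)
  have h3 := level_add α.toReal I (c - I)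
  rw [add_sub_cancel] at h3
  rw [hS q inferInstance, h3, ENNReal.ofReal_add (level_nonneg hJ0)
    (mul_nonneg (Real.exp_pos _).le (level_nonneg (sub_nonneg.2 hIc))),
    ENNReal.add_le_add_iff_left ENNReal.ofReal_ne_top, ENNReal.ofReal_mul (Real.exp_pos _).le,
    ENNReal.mul_le_mul_iff_right (by simpa using Real.exp_pos _) ENNReal.ofReal_ne_top] at h1
  exact (coe_le_renyiDiv_iff hα0 hα _ q (sub_nonneg.2 hIc)).2 h1

/-! ### Finite order: improving a reference measure by mixing -/

lemma isProbabilityMeasure_mix {q q' : Measure Ω} [IsProbabilityMeasure q]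
    [IsProbabilityMeasure q'] {s t : ℝ≥0} (hst : s + t = 1) :
    IsProbabilityMeasure (s • q + t • q') := by
  constructor
  simp only [Measure.add_apply, Measure.smul_apply, measure_univ, ENNReal.smul_def, smul_eq_mul,
    mul_one]
  exact_mod_cast hst

lemma exists_weights_exp_neg {g : ℝ} (hg : 0 < g) :
    ∃ s t : ℝ≥0, 0 < s ∧ 0 < t ∧ s + t = 1 ∧ Real.log s = -g := by
  have h1 : Real.exp (-g) < 1 := Real.exp_lt_one_iff.2 (by linarith)
  refine ⟨⟨Real.exp (-g), (Real.exp_pos _).le⟩, ⟨1 - Real.exp (-g), by linarith⟩, Real.exp_pos _,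
    sub_pos.2 h1, ?_, Real.log_exp _⟩
  ext
  change Real.exp (-g) + (1 - Real.exp (-g)) = 1
  ring

/-- A convex combination of `q` and `q'` improves on `q` when `q'` is better than `q` on the
distributions that are almost extremal for `q`. -/
lemma exists_improvement_of_ne_top {α : ℝ≥0∞} (hα0 : 0 < α) (hα : α ≠ ⊤) {q q' : Measure Ω}
    [IsProbabilityMeasure q] [IsProbabilityMeasure q'] {C C' ε : ℝ} (hC' : 0 ≤ C') (hCC : C' < C)
    (hε : 0 < ε) : ∃ r : Measure Ω, IsProbabilityMeasure r ∧ ∃ c < C,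
      ∀ W : Measure Ω, IsProbabilityMeasure W → renyiDiv α W q ≤ C →
        (renyiDiv α W q' ≤ C' ∨ renyiDiv α W q ≤ (C - ε : ℝ)) → renyiDiv α W r ≤ c := by
  have ha0 := ENNReal.toReal_pos hα0.ne' hα
  have hC0 : 0 ≤ C := hC'.trans hCC.le
  -- The slack below C, cut off at 0 because divergence bounds are translated only at nonnegative
  -- levels. Mixing in q' costs g / 2 and leaves a gain of g / 2.
  obtain ⟨g, hg⟩ : ∃ g, g = C - max (C - ε) 0 := ⟨_, rfl⟩
  have hg0 : 0 < g := by
    rw [hg, sub_pos]; exact max_lt (by linarith) (hC'.trans_lt hCC)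
  obtain ⟨s, t, hs, ht, hst, hlog⟩ := exists_weights_exp_neg (half_pos hg0)
  have hr := isProbabilityMeasure_mix (q := q) (q' := q') hst
  have hmono := level_strictMono α.toReal
  have hlt : level α.toReal C' < level α.toReal C := hmono hCC
  have hst' : (s : ℝ) = 1 - t := eq_sub_of_add_eq (by exact_mod_cast hst)
  have hs' : (0 : ℝ) < s := hs
  have ht' : (0 : ℝ) < t := ht
  have hlam : s * level α.toReal C + t * level α.toReal C' ∈
      Set.Icc (level α.toReal C') (level α.toReal C) := by
    have h1 := mul_pos hs' (sub_pos.2 hlt)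
    have h2 := mul_pos ht' (sub_pos.2 hlt)
    rw [hst'] at h1 ⊢
    constructor <;> linarith
  obtain ⟨c₁, hc₁, hl⟩ := intermediate_value_Icc hCC.le (continuous_level _).continuousOn hlam
  have hc₁C : c₁ < C := by
    rw [← hmono.lt_iff_lt, hl, hst']; linarith [mul_pos ht' (sub_pos.2 hlt)]
  refine ⟨s • q + t • q', hr, max c₁ (C - g / 2), max_lt hc₁C (by linarith), ?_⟩
  rintro W hW hWC (h | h)
  · have : renyiDiv α W (s • q + t • q') ≤ c₁ := by
      rw [renyiDiv_le_coe_iff hα0 hα _ _ (hC'.trans hc₁.1), hl]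
      rw [renyiDiv_le_coe_iff hα0 hα _ _ hC0] at hWC
      rw [renyiDiv_le_coe_iff hα0 hα _ _ hC'] at h
      calc _ ≤ s * tsallis α.toReal W q + t * tsallis α.toReal W q' :=
            tsallis_convex_right ha0 W q q' hst
        _ ≤ s * ENNReal.ofReal (level α.toReal C) + t * ENNReal.ofReal (level α.toReal C') := by
            gcongr
        _ = _ := by
            rw [ENNReal.ofReal_add (mul_nonneg hs'.le (level_nonneg hC0))
              (mul_nonneg ht'.le (level_nonneg hC')), ENNReal.ofReal_mul hs'.le,
              ENNReal.ofReal_mul ht'.le, ENNReal.ofReal_coe_nnreal, ENNReal.ofReal_coe_nnreal]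
    exact this.trans (by exact_mod_cast le_max_left _ _)
  · have h1 : renyiDiv α W q ≤ (max (C - ε) 0 : ℝ) :=
      h.trans (by exact_mod_cast le_max_left _ _)
    have h2 := renyiDiv_le_sub_log_of_smul_le hα0 hα hs
      (show s • q ≤ s • q + t • q' from Measure.le_add_right le_rfl) (le_max_right _ _) h1
    rw [hlog] at h2
    refine h2.trans ?_
    have : max (C - ε) 0 - -(g / 2) ≤ max c₁ (C - g / 2) := by
      refine le_trans ?_ (le_max_right _ _)
      linarith
    exact_mod_cast this

/-! ### Order infinity: divergence and mean through the order of measures -/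

section Top

lemma rnDeriv_mono {W Q ν : Measure Ω} [IsFiniteMeasure W] [IsFiniteMeasure Q]
    [IsFiniteMeasure ν] (h : W ≤ Q) : ∀ᵐ y ∂ν, W.rnDeriv ν y ≤ Q.rnDeriv ν y := by
  have h1 := Measure.rnDeriv_add (Q - W) W ν
  rw [Measure.sub_add_cancel_of_le h] at h1
  filter_upwards [h1] with y hy
  rw [hy]
  exact le_add_self

lemma smul_ofReal_le_iff {c : ℝ} (W Q : Measure Ω) :
    W ≤ ENNReal.ofReal (Real.exp c) • Q ↔ ENNReal.ofReal (Real.exp (-c)) • W ≤ Q := by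
  have h : ENNReal.ofReal (Real.exp (-c)) * ENNReal.ofReal (Real.exp c) = 1 := by
    rw [← ENNReal.ofReal_mul (Real.exp_pos _).le, ← Real.exp_add]; simp
  constructor <;> intro hle <;> refine Measure.le_iff.2 fun A _ => ?_
  · have := mul_le_mul' (le_refl (ENNReal.ofReal (Real.exp (-c)))) (hle A)
    simpa [← mul_assoc, h] using this
  · have := mul_le_mul' (le_refl (ENNReal.ofReal (Real.exp c))) (hle A)
    rw [Measure.smul_apply, smul_eq_mul, ← mul_assoc, mul_comm (ENNReal.ofReal (Real.exp c)), h,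
      one_mul] at this
    exact this

/-- An essential bound on the ratio of densities is an a.e. inequality between densities, that is,
domination of measures. -/
lemma renyiDiv_top_le_coe_iff (W Q : Measure Ω) [IsFiniteMeasure W] [IsFiniteMeasure Q] (c : ℝ) :
    renyiDiv ⊤ W Q ≤ c ↔ W ≤ ENNReal.ofReal (Real.exp c) • Q := by
  have h1 : ∀ x : ℝ≥0∞, ENNReal.log x ≤ c ↔ x ≤ ENNReal.ofReal (Real.exp c) := by
    intro x
    have := coe_mul_log_le_iff one_pos x c
    simpa using this
  rw [renyiDiv, if_pos rfl, h1]
  have h2 : essSup (fun y => W.rnDeriv (W + Q) y / Q.rnDeriv (W + Q) y) (W + Q)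
      ≤ ENNReal.ofReal (Real.exp c) ↔ ∀ᵐ y ∂(W + Q), W.rnDeriv (W + Q) y / Q.rnDeriv (W + Q) y
      ≤ ENNReal.ofReal (Real.exp c) :=
    ⟨fun h => (ENNReal.ae_le_essSup _).mono fun y hy => hy.trans h, fun h => essSup_le_of_ae_le _ h⟩
  have hk0 : ENNReal.ofReal (Real.exp c) ≠ 0 := by simpa using Real.exp_pos c
  have h3 : ∀ y, W.rnDeriv (W + Q) y / Q.rnDeriv (W + Q) y ≤ ENNReal.ofReal (Real.exp c) ↔
      W.rnDeriv (W + Q) y ≤ ENNReal.ofReal (Real.exp c) * Q.rnDeriv (W + Q) y := fun y =>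
    ENNReal.div_le_iff_le_mul (Or.inr ENNReal.ofReal_ne_top) (Or.inr hk0)
  rw [h2]
  simp only [h3]
  constructor
  · intro h
    calc W = (W + Q).withDensity (W.rnDeriv (W + Q)) :=
          (Measure.withDensity_rnDeriv_eq _ _ (ac_add_left W Q)).symm
      _ ≤ (W + Q).withDensity (ENNReal.ofReal (Real.exp c) • Q.rnDeriv (W + Q)) :=
          withDensity_mono h
      _ = _ := by
          rw [withDensity_smul _ (Measure.measurable_rnDeriv _ _),
            Measure.withDensity_rnDeriv_eq _ _ (ac_add_right W Q)]
  · intro h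
    have : IsFiniteMeasure (ENNReal.ofReal (Real.exp c) • Q) :=
      Measure.smul_finite _ ENNReal.ofReal_ne_top
    filter_upwards [rnDeriv_mono (ν := W + Q) h,
      Measure.rnDeriv_smul_left_of_ne_top Q (W + Q) ENNReal.ofReal_ne_top] with y h1 h2
    rw [h2] at h1
    simpa using h1

lemma renyiDiv_top_nonneg (W Q : Measure Ω) [IsProbabilityMeasure W] [IsProbabilityMeasure Q] :
    0 ≤ renyiDiv ⊤ W Q := by
  by_contra! h
  obtain ⟨c, h1, h2⟩ := EReal.lt_iff_exists_real_btwn.1 h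
  have h3 := (renyiDiv_top_le_coe_iff W Q c).1 h1.le Set.univ
  rw [Measure.smul_apply, measure_univ, measure_univ, smul_eq_mul, mul_one,
    ENNReal.one_le_ofReal, Real.one_le_exp_iff] at h3
  have : c < 0 := by exact_mod_cast h2
  linarith

variable {P : ProbabilityMeasure Ω →₀ ℝ≥0}

/-- A pointwise maximum of densities is the least upper bound in the order of measures. This
property takes over the role of Sibson's identity. -/
lemma renyiMeanMeasure_top_le_iff (ρ : Measure Ω) [IsFiniteMeasure ρ] :
    renyiMeanMeasure ⊤ P ≤ ρ ↔ ∀ W ∈ P.support, (W : Measure Ω) ≤ ρ := by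
  constructor
  · intro h W hW
    refine le_trans ?_ h
    rw [renyiMeanMeasure, ← Measure.withDensity_rnDeriv_eq _ _ (ac_renyiMixture P hW)]
    refine withDensity_mono (ae_of_all _ fun y => ?_)
    rw [renyiMeanDensity, if_pos rfl]
    exact Finset.le_sup (f := fun W : ProbabilityMeasure Ω =>
      (W : Measure Ω).rnDeriv (renyiMixture P) y) hW
  · intro h
    refine le_trans ?_ (Measure.withDensity_rnDeriv_le ρ (renyiMixture P))
    refine withDensity_mono ?_
    filter_upwards [(Filter.eventually_all_finset P.support).2 fun W hW =>
      rnDeriv_mono (ν := renyiMixture P) (h W hW)] with y hy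
    rw [renyiMeanDensity, if_pos rfl]
    exact Finset.sup_le hy

lemma isFiniteMeasure_renyiMeanMeasure_top : IsFiniteMeasure (renyiMeanMeasure ⊤ P) := by
  have h : renyiMeanMeasure ⊤ P ≤ ∑ W ∈ P.support, (W : Measure Ω) := by
    rw [renyiMeanMeasure_top_le_iff]
    intro W hW
    exact Finset.single_le_sum (f := fun W : ProbabilityMeasure Ω => (W : Measure Ω))
      (fun _ _ => Measure.zero_le _) hW
  exact isFiniteMeasure_of_le _ h

lemma le_renyiMeanMeasure_top {W : ProbabilityMeasure Ω} (hW : W ∈ P.support) :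
    (W : Measure Ω) ≤ renyiMeanMeasure ⊤ P := by
  have := isFiniteMeasure_renyiMeanMeasure_top (P := P)
  exact (renyiMeanMeasure_top_le_iff _).1 le_rfl W hW

lemma smul_renyiMean_top {I : ℝ}
    (hI : renyiMeanMeasure ⊤ P Set.univ = ENNReal.ofReal (Real.exp I)) :
    ENNReal.ofReal (Real.exp I) • renyiMean ⊤ P = renyiMeanMeasure ⊤ P := by
  rw [renyiMean, hI, smul_smul, ENNReal.mul_inv_cancel (by simpa using Real.exp_pos I)
    ENNReal.ofReal_ne_top, one_smul]

variable (hP : ∑ W ∈ P.support, P W = 1)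
include hP

lemma one_le_renyiMeanMeasure_top : 1 ≤ renyiMeanMeasure ⊤ P Set.univ := by
  obtain ⟨W, hW⟩ := exists_mem_support hP
  rw [← measure_univ (μ := (W : Measure Ω))]
  exact le_renyiMeanMeasure_top hW Set.univ

lemma isProbabilityMeasure_renyiMean_top : IsProbabilityMeasure (renyiMean ⊤ P) := by
  have := isFiniteMeasure_renyiMeanMeasure_top (P := P)
  constructor
  rw [renyiMean, Measure.smul_apply, smul_eq_mul]
  exact ENNReal.inv_mul_cancel (one_pos.trans_le (one_le_renyiMeanMeasure_top hP)).ne'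
    (measure_ne_top _ _)

lemma exists_renyiInfo_top_eq : ∃ I : ℝ, 0 ≤ I ∧ renyiInfo ⊤ P = I ∧
    renyiMeanMeasure ⊤ P Set.univ = ENNReal.ofReal (Real.exp I) := by
  have := isFiniteMeasure_renyiMeanMeasure_top (P := P)
  have h1 := one_le_renyiMeanMeasure_top hP
  have ht := measure_ne_top (renyiMeanMeasure ⊤ P) Set.univ
  have h2 : 1 ≤ (renyiMeanMeasure ⊤ P Set.univ).toReal := by
    rw [← ENNReal.toReal_one]; exact ENNReal.toReal_mono ht h1
  have h3 : 0 < (renyiMeanMeasure ⊤ P Set.univ).toReal := by linarith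
  refine ⟨Real.log (renyiMeanMeasure ⊤ P Set.univ).toReal, Real.log_nonneg h2, ?_, ?_⟩
  · rw [renyiInfo, if_pos rfl, ← ENNReal.log_ofReal_of_pos h3, ENNReal.ofReal_toReal ht]
  · rw [Real.exp_log h3, ENNReal.ofReal_toReal ht]

/-- The mean measure is exp(I) times the mean, so dominating it by exp(c) q is the same as
dominating each member of the support. Being an equivalence, it gives the lower bound from a single
W. -/
lemma renyiDiv_renyiMean_top_le_iff {q : Measure Ω} [IsProbabilityMeasure q] {I : ℝ}
    (hI : renyiInfo ⊤ P = I) (c : ℝ) :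
    renyiDiv ⊤ (renyiMean ⊤ P) q ≤ (c - I : ℝ) ↔
      ∀ W ∈ P.support, renyiDiv ⊤ (W : Measure Ω) q ≤ c := by
  have hp := isProbabilityMeasure_renyiMean_top hP
  obtain ⟨J, hJ0, hJ, hZ⟩ := exists_renyiInfo_top_eq hP
  obtain rfl : I = J := by rw [hI] at hJ; exact_mod_cast hJ
  have : IsFiniteMeasure (ENNReal.ofReal (Real.exp c) • q) :=
    Measure.smul_finite _ ENNReal.ofReal_ne_top
  simp only [renyiDiv_top_le_coe_iff]
  rw [← renyiMeanMeasure_top_le_iff, ← smul_renyiMean_top hZ]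
  have h := smul_ofReal_le_iff (c := -I) (renyiMean ⊤ P) (ENNReal.ofReal (Real.exp c) • q)
  rw [neg_neg, smul_smul, ← ENNReal.ofReal_mul (Real.exp_pos _).le, ← Real.exp_add,
    neg_add_eq_sub] at h
  exact h

lemma le_renyiDiv_renyiMean_top {q : Measure Ω} [IsProbabilityMeasure q] {I c : ℝ}
    (hI : renyiInfo ⊤ P = I) (h : ∃ W ∈ P.support, c ≤ renyiDiv ⊤ (W : Measure Ω) q) :
    (c - I : ℝ) ≤ renyiDiv ⊤ (renyiMean ⊤ P) q := by
  by_contra! hlt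
  obtain ⟨d, h1, h2⟩ := EReal.lt_iff_exists_real_btwn.1 hlt
  obtain ⟨W, hW, hc⟩ := h
  have h3 := (renyiDiv_renyiMean_top_le_iff hP (q := q) hI (d + I)).1
    (by rw [add_sub_cancel_right]; exact h1.le) W hW
  have h4 : c ≤ d + I := by exact_mod_cast hc.trans h3
  have h5 : d < c - I := by exact_mod_cast h2
  linarith

end Top

/-! ### Order infinity: existence and uniqueness of the center -/

section Top

variable {𝒲 : Set (ProbabilityMeasure Ω)} {C : ℝ} (hC : renyiCapacity ⊤ 𝒲 = C)
include hC

lemma renyiMeanMeasure_top_univ_le {P : ProbabilityMeasure Ω →₀ ℝ≥0} (hP : P ∈ renyiFinPMF 𝒲) :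
    renyiMeanMeasure ⊤ P Set.univ ≤ ENNReal.ofReal (Real.exp C) := by
  obtain ⟨I, hI0, hI, hZ⟩ := exists_renyiInfo_top_eq hP.2
  rw [hZ]
  exact ENNReal.ofReal_le_ofReal (Real.exp_le_exp.2 (le_capacity hC hP hI))

lemma exists_le_renyiMeanMeasure_top {η : ℝ≥0} (hη : 0 < η) : ∃ P ∈ renyiFinPMF 𝒲,
    ENNReal.ofReal (Real.exp C) ≤ renyiMeanMeasure ⊤ P Set.univ + η := by
  obtain ⟨ε, hε, h⟩ := Metric.tendsto_nhds_nhds.1 (Real.continuous_exp.tendsto C) η hη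
  have hlt : ((C - ε : ℝ) : EReal) < renyiCapacity ⊤ 𝒲 := by
    rw [hC]; exact_mod_cast sub_lt_self C hε
  rw [renyiCapacity] at hlt
  simp only [lt_iSup_iff] at hlt
  obtain ⟨P, hP, hlt⟩ := hlt
  obtain ⟨I, hI0, hI, hZ⟩ := exists_renyiInfo_top_eq hP.2
  have hIC := le_capacity hC hP hI
  rw [hI] at hlt
  have hlt' : C - ε < I := by exact_mod_cast hlt
  refine ⟨P, hP, ?_⟩
  have := h (x := I) (by rw [Real.dist_eq, abs_lt]; constructor <;> linarith)
  rw [Real.dist_eq, abs_lt] at this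
  rw [hZ, ← ENNReal.ofReal_coe_nnreal, ← ENNReal.ofReal_add (Real.exp_pos _).le η.coe_nonneg]
  exact ENNReal.ofReal_le_ofReal (by linarith [this.1])

/-- The mean measure of the mixture dominates both, and its mass exceeds that of P by at most η; so
on any event its excess over P is at most η. The weights of the mixture play no role. -/
lemma renyiMeanMeasure_top_le_add {P R : ProbabilityMeasure Ω →₀ ℝ≥0} (hP : P ∈ renyiFinPMF 𝒲)
    (hR : R ∈ renyiFinPMF 𝒲) {η : ℝ≥0}
    (hη : ENNReal.ofReal (Real.exp C) ≤ renyiMeanMeasure ⊤ P Set.univ + η) {A : Set Ω}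
    (hA : MeasurableSet A) : renyiMeanMeasure ⊤ R A ≤ renyiMeanMeasure ⊤ P A + η := by
  have hM := mix_mem_renyiFinPMF hP hR (show (1 / 2 : ℝ≥0) + 1 / 2 = 1 by norm_num)
  set S := (1 / 2 : ℝ≥0) • P + (1 / 2 : ℝ≥0) • R
  have fP := isFiniteMeasure_renyiMeanMeasure_top (P := P)
  have fS := isFiniteMeasure_renyiMeanMeasure_top (P := S)
  have hPS : renyiMeanMeasure ⊤ P ≤ renyiMeanMeasure ⊤ S := by
    rw [renyiMeanMeasure_top_le_iff]
    intro W hW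
    refine le_renyiMeanMeasure_top ?_
    rw [Finsupp.mem_support_iff] at hW ⊢
    simp [S, hW]
  have hRS : renyiMeanMeasure ⊤ R ≤ renyiMeanMeasure ⊤ S := by
    rw [renyiMeanMeasure_top_le_iff]
    intro W hW
    refine le_renyiMeanMeasure_top ?_
    rw [Finsupp.mem_support_iff] at hW ⊢
    simp [S, hW]
  have hK := renyiMeanMeasure_top_univ_le hC hM
  refine (hRS A).trans ?_
  refine (ENNReal.add_le_add_iff_right (measure_ne_top (renyiMeanMeasure ⊤ P) Aᶜ)).1 ?_
  calc renyiMeanMeasure ⊤ S A + renyiMeanMeasure ⊤ P Aᶜ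
      ≤ renyiMeanMeasure ⊤ S A + renyiMeanMeasure ⊤ S Aᶜ := by gcongr
    _ = renyiMeanMeasure ⊤ S Set.univ := measure_add_measure_compl hA
    _ ≤ renyiMeanMeasure ⊤ P Set.univ + η := hK.trans hη
    _ = renyiMeanMeasure ⊤ P A + η + renyiMeanMeasure ⊤ P Aᶜ := by
      rw [← measure_add_measure_compl hA, add_right_comm]

/-- The two normalizing constants differ by at most η, which costs a second η; both are at least 1,
so dividing does no harm. -/
lemma renyiMean_top_le_add {P R : ProbabilityMeasure Ω →₀ ℝ≥0} (hP : P ∈ renyiFinPMF 𝒲)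
    (hR : R ∈ renyiFinPMF 𝒲) {η : ℝ≥0}
    (hη : ENNReal.ofReal (Real.exp C) ≤ renyiMeanMeasure ⊤ P Set.univ + η)
    (hη' : ENNReal.ofReal (Real.exp C) ≤ renyiMeanMeasure ⊤ R Set.univ + η) {A : Set Ω}
    (hA : MeasurableSet A) : renyiMean ⊤ R A ≤ renyiMean ⊤ P A + (2 * η : ℝ≥0) := by
  have fP := isFiniteMeasure_renyiMeanMeasure_top (P := P)
  have fR := isFiniteMeasure_renyiMeanMeasure_top (P := R)
  have hp := isProbabilityMeasure_renyiMean_top hP.2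
  have hr := isProbabilityMeasure_renyiMean_top hR.2
  obtain ⟨I, hI0, hI, hZ⟩ := exists_renyiInfo_top_eq hP.2
  obtain ⟨J, hJ0, hJ, hY⟩ := exists_renyiInfo_top_eq hR.2
  have h := renyiMeanMeasure_top_le_add hC hP hR hη hA
  rw [← smul_renyiMean_top hZ, ← smul_renyiMean_top hY, Measure.smul_apply, Measure.smul_apply,
    smul_eq_mul, smul_eq_mul] at h
  have hZY : ENNReal.ofReal (Real.exp I) ≤ ENNReal.ofReal (Real.exp J) + η := by
    rw [← hZ, ← hY]
    exact (renyiMeanMeasure_top_univ_le hC hP).trans hη'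
  have hJ1 : 1 ≤ ENNReal.ofReal (Real.exp J) := by
    rw [ENNReal.one_le_ofReal]; exact Real.one_le_exp hJ0
  refine (ENNReal.mul_le_mul_iff_right (one_pos.trans_le hJ1).ne' ENNReal.ofReal_ne_top).1 ?_
  calc _ ≤ ENNReal.ofReal (Real.exp I) * renyiMean ⊤ P A + η := h
    _ ≤ (ENNReal.ofReal (Real.exp J) + η) * renyiMean ⊤ P A + η := by gcongr
    _ ≤ ENNReal.ofReal (Real.exp J) * renyiMean ⊤ P A + η * 1 + η := by
      rw [add_mul]; gcongr; exact prob_le_one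
    _ = ENNReal.ofReal (Real.exp J) * renyiMean ⊤ P A + 1 * (2 * η : ℝ≥0) := by
      push_cast; ring
    _ ≤ _ := by rw [mul_add]; gcongr

/-- Comparing a nearly optimal prior with the point mass at W bounds W A by the mean measure plus a
small error, uniformly in A; the limit of the means then gives domination directly. -/
lemma exists_forall_renyiDiv_top_le : ∃ q : Measure Ω, IsProbabilityMeasure q ∧
    ∀ W ∈ 𝒲, renyiDiv ⊤ (W : Measure Ω) q ≤ C := by
  have hex : ∀ n : ℕ, ∃ P ∈ renyiFinPMF 𝒲,
      ENNReal.ofReal (Real.exp C) ≤ renyiMeanMeasure ⊤ P Set.univ + (1 / (n + 1) : ℝ≥0) :=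
    fun n => exists_le_renyiMeanMeasure_top hC (by positivity)
  choose P hP hPK using hex
  have hp := fun n => isProbabilityMeasure_renyiMean_top (hP n).2
  have hsmall : ∀ δ : ℝ≥0, 0 < δ → ∃ N, ∀ n ≥ N, (1 / ((n : ℕ) + 1) : ℝ≥0) ≤ δ := by
    intro δ hδ
    obtain ⟨N, hN⟩ := exists_nat_one_div_lt (K := ℝ≥0) hδ
    refine ⟨N, fun n hn => le_trans ?_ hN.le⟩
    gcongr
  obtain ⟨q, hq, hlim⟩ := exists_measure_forall_le_add (p := fun n => renyiMean ⊤ (P n)) (by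
    intro δ hδ
    obtain ⟨N, hN⟩ := hsmall (δ / 2) (by positivity)
    refine ⟨N, fun m hm n hn A hA => ?_⟩
    have h1 : ∀ k ≥ N, ENNReal.ofReal (Real.exp C)
        ≤ renyiMeanMeasure ⊤ (P k) Set.univ + (δ / 2 : ℝ≥0) := fun k hk =>
      (hPK k).trans (add_le_add le_rfl (ENNReal.coe_le_coe.2 (hN k hk)))
    have := renyiMean_top_le_add hC (hP n) (hP m) (h1 n hn) (h1 m hm) hA
    rwa [mul_div_cancel₀ δ two_ne_zero] at this)
  refine ⟨q, hq, fun W hW => ?_⟩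
  rw [renyiDiv_top_le_coe_iff]
  refine Measure.le_iff.2 fun A hA => ?_
  rw [Measure.smul_apply, smul_eq_mul]
  refine ENNReal.le_of_forall_pos_le_add fun δ hδ _ => ?_
  obtain ⟨K, hK⟩ : ∃ K : ℝ≥0, (K : ℝ) = Real.exp C := ⟨⟨_, (Real.exp_pos C).le⟩, rfl⟩
  have hK0 : 0 < K := by rw [← NNReal.coe_pos, hK]; exact Real.exp_pos C
  obtain ⟨N, hN⟩ := hsmall (δ / 2) (by positivity)
  obtain ⟨M, hM⟩ := hlim (δ / 2 / K) (by positivity)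
  obtain ⟨n, hn⟩ : ∃ n, n = max N M := ⟨_, rfl⟩
  obtain ⟨I, hI0, hI, hZ⟩ := exists_renyiInfo_top_eq (hP n).2
  have hIC := le_capacity hC (hP n) hI
  classical
  have hWs : W ∈ (Finsupp.single W (1 : ℝ≥0)).support := by
    rw [Finsupp.support_single W one_ne_zero]; simp
  have h1 := renyiMeanMeasure_top_le_add hC (hP n) (single_mem_renyiFinPMF hW) (hPK n) hA
  rw [← smul_renyiMean_top hZ, Measure.smul_apply, smul_eq_mul] at h1
  calc (W : Measure Ω) A ≤ _ := le_renyiMeanMeasure_top hWs A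
    _ ≤ _ := h1
    _ ≤ ENNReal.ofReal (Real.exp C) * (q A + (δ / 2 / K : ℝ≥0)) + (δ / 2 : ℝ≥0) :=
      add_le_add (mul_le_mul' (ENNReal.ofReal_le_ofReal (Real.exp_le_exp.2 hIC))
        (hM n (by rw [hn]; exact le_max_right _ _) A hA))
        (ENNReal.coe_le_coe.2 (hN n (by rw [hn]; exact le_max_left _ _)))
    _ = _ := by
      rw [← hK, ENNReal.ofReal_coe_nnreal, mul_add, ← ENNReal.coe_mul,
        mul_div_cancel₀ _ hK0.ne', add_assoc, ← ENNReal.coe_add, add_halves]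

/-- Both exp(C) q and exp(C) q' dominate the mean measure of a nearly optimal prior and have nearly
the same mass as it. -/
lemma eq_of_forall_renyiDiv_top_le (hC0 : 0 ≤ C) {q q' : Measure Ω} [IsProbabilityMeasure q]
    [IsProbabilityMeasure q'] (hq : ∀ W ∈ 𝒲, renyiDiv ⊤ (W : Measure Ω) q ≤ C)
    (hq' : ∀ W ∈ 𝒲, renyiDiv ⊤ (W : Measure Ω) q' ≤ C) : q = q' := by
  refine eq_of_forall_le_add fun δ hδ A hA => ?_
  obtain ⟨P, hP, hK⟩ := exists_le_renyiMeanMeasure_top hC hδ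
  have fP := isFiniteMeasure_renyiMeanMeasure_top (P := P)
  have hK1 : 1 ≤ ENNReal.ofReal (Real.exp C) := by
    rw [ENNReal.one_le_ofReal]; exact Real.one_le_exp hC0
  have key : ∀ r : Measure Ω, IsProbabilityMeasure r → (∀ W ∈ 𝒲, renyiDiv ⊤ (W : Measure Ω) r ≤ C) →
      renyiMeanMeasure ⊤ P ≤ ENNReal.ofReal (Real.exp C) • r := by
    intro r _ hr
    have : IsFiniteMeasure (ENNReal.ofReal (Real.exp C) • r) :=
      Measure.smul_finite _ ENNReal.ofReal_ne_top
    rw [renyiMeanMeasure_top_le_iff]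
    exact fun W hW => (renyiDiv_top_le_coe_iff _ _ _).1 (hr W (hP.1 hW))
  have h1 := key q inferInstance hq Aᶜ
  have h2 := key q' inferInstance hq' A
  rw [Measure.smul_apply, smul_eq_mul] at h1 h2
  refine (ENNReal.mul_le_mul_iff_right (one_pos.trans_le hK1).ne' ENNReal.ofReal_ne_top).1 ?_
  have h3 : ENNReal.ofReal (Real.exp C) * q A ≤ renyiMeanMeasure ⊤ P A + δ := by
    refine (ENNReal.add_le_add_iff_right (measure_ne_top (renyiMeanMeasure ⊤ P) Aᶜ)).1 ?_
    calc _ ≤ ENNReal.ofReal (Real.exp C) * q A + ENNReal.ofReal (Real.exp C) * q Aᶜ := by gcongr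
      _ = ENNReal.ofReal (Real.exp C) := by rw [← mul_add, prob_add_prob_compl hA, mul_one]
      _ ≤ renyiMeanMeasure ⊤ P Set.univ + δ := hK
      _ = _ := by rw [← measure_add_measure_compl hA, add_right_comm]
  calc _ ≤ renyiMeanMeasure ⊤ P A + δ := h3
    _ ≤ ENNReal.ofReal (Real.exp C) * q' A + 1 * δ := by rw [one_mul]; gcongr
    _ ≤ _ := by rw [mul_add]; gcongr

end Top

/-- In the form exp(-c) W ≤ q the bounds can be averaged: the constants exp(-C) and exp(-C') combine
linearly with the weights of the mixture. -/
lemma exists_improvement_top {q q' : Measure Ω} [IsProbabilityMeasure q]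
    [IsProbabilityMeasure q'] {C C' ε : ℝ} (hCC : C' < C) (hε : 0 < ε) :
    ∃ r : Measure Ω, IsProbabilityMeasure r ∧ ∃ c < C,
      ∀ W : Measure Ω, IsProbabilityMeasure W → renyiDiv ⊤ W q ≤ C →
        (renyiDiv ⊤ W q' ≤ C' ∨ renyiDiv ⊤ W q ≤ (C - ε : ℝ)) → renyiDiv ⊤ W r ≤ c := by
  obtain ⟨s, t, hs, ht, hst, hlog⟩ := exists_weights_exp_neg (half_pos hε)
  have hr := isProbabilityMeasure_mix (q := q) (q' := q') hst
  have hst' : (s : ℝ) = 1 - t := eq_sub_of_add_eq (by exact_mod_cast hst)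
  have hs' : (0 : ℝ) < s := hs
  have ht' : (0 : ℝ) < t := ht
  have hE : Real.exp (-C) < Real.exp (-C') := Real.exp_lt_exp.2 (by linarith)
  have hpos : 0 < s * Real.exp (-C) + t * Real.exp (-C') := by positivity
  obtain ⟨c₁, hc₁⟩ : ∃ c₁, Real.exp (-c₁) = s * Real.exp (-C) + t * Real.exp (-C') :=
    ⟨-Real.log (s * Real.exp (-C) + t * Real.exp (-C')), by rw [neg_neg, Real.exp_log hpos]⟩
  have hc₁C : c₁ < C := by
    have : Real.exp (-C) < Real.exp (-c₁) := by
      rw [hc₁, hst']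
      linarith [mul_pos ht' (sub_pos.2 hE)]
    have := Real.exp_lt_exp.1 this
    linarith
  refine ⟨s • q + t • q', hr, max c₁ (C - ε / 2), max_lt hc₁C (by linarith), ?_⟩
  rintro W hW hWC (h | h)
  · have : renyiDiv ⊤ W (s • q + t • q') ≤ c₁ := by
      rw [renyiDiv_top_le_coe_iff, smul_ofReal_le_iff] at hWC h ⊢
      refine Measure.le_iff.2 fun A _ => ?_
      have h1 := hWC A
      have h2 := h A
      simp only [Measure.smul_apply, Measure.add_apply, smul_eq_mul, ENNReal.smul_def] at h1 h2 ⊢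
      rw [hc₁, ENNReal.ofReal_add (by positivity) (by positivity), ENNReal.ofReal_mul hs'.le,
        ENNReal.ofReal_mul ht'.le, ENNReal.ofReal_coe_nnreal, ENNReal.ofReal_coe_nnreal, add_mul,
        mul_assoc, mul_assoc]
      gcongr
    exact this.trans (by exact_mod_cast le_max_left _ _)
  · have : renyiDiv ⊤ W (s • q + t • q') ≤ (C - ε / 2 : ℝ) := by
      rw [renyiDiv_top_le_coe_iff, smul_ofReal_le_iff] at h ⊢
      refine Measure.le_iff.2 fun A _ => ?_
      have h1 := h A
      simp only [Measure.smul_apply, Measure.add_apply, smul_eq_mul, ENNReal.smul_def] at h1 ⊢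
      have e : ENNReal.ofReal (Real.exp (-(C - ε / 2)))
          = s * ENNReal.ofReal (Real.exp (-(C - ε))) := by
        rw [← ENNReal.ofReal_coe_nnreal, ← ENNReal.ofReal_mul hs'.le, ← Real.exp_log hs', hlog,
          ← Real.exp_add]
        congr 2; ring
      rw [e, mul_assoc]
      exact le_add_right (by gcongr)
    exact this.trans (by exact_mod_cast le_max_right _ _)

/-! ### All orders: capacity, center and subfamilies -/

section

variable {α : ℝ≥0∞} (hα : 0 < α)
include hα

lemma renyiDiv_nonneg (W Q : Measure Ω) [IsProbabilityMeasure W] [IsProbabilityMeasure Q] :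
    0 ≤ renyiDiv α W Q := by
  rcases eq_or_ne α ⊤ with rfl | h
  · exact renyiDiv_top_nonneg W Q
  · exact renyiDiv_nonneg_of_ne_top hα h W Q

lemma exists_improvement {q q' : Measure Ω} [IsProbabilityMeasure q] [IsProbabilityMeasure q']
    {C C' ε : ℝ} (hC' : 0 ≤ C') (hCC : C' < C) (hε : 0 < ε) :
    ∃ r : Measure Ω, IsProbabilityMeasure r ∧ ∃ c < C,
      ∀ W : Measure Ω, IsProbabilityMeasure W → renyiDiv α W q ≤ C →
        (renyiDiv α W q' ≤ C' ∨ renyiDiv α W q ≤ (C - ε : ℝ)) → renyiDiv α W r ≤ c := by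
  rcases eq_or_ne α ⊤ with rfl | h
  · exact exists_improvement_top hCC hε
  · exact exists_improvement_of_ne_top hα h hC' hCC hε

lemma isProbabilityMeasure_renyiMean {P : ProbabilityMeasure Ω →₀ ℝ≥0}
    (hP : ∑ W ∈ P.support, P W = 1) : IsProbabilityMeasure (renyiMean α P) := by
  rcases eq_or_ne α ⊤ with rfl | h
  · exact isProbabilityMeasure_renyiMean_top hP
  · exact isProbabilityMeasure_renyiMean_of_ne_top hα h hP

lemma exists_renyiInfo_eq {P : ProbabilityMeasure Ω →₀ ℝ≥0} (hP : ∑ W ∈ P.support, P W = 1) :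
    ∃ I : ℝ, 0 ≤ I ∧ renyiInfo α P = I := by
  rcases eq_or_ne α ⊤ with rfl | h
  · obtain ⟨I, h0, h1, -⟩ := exists_renyiInfo_top_eq hP
    exact ⟨I, h0, h1⟩
  · obtain ⟨I, h0, h1, -⟩ := sibson hP hα h
    exact ⟨I, h0, h1⟩

lemma renyiDiv_renyiMean_le {P : ProbabilityMeasure Ω →₀ ℝ≥0} (hP : ∑ W ∈ P.support, P W = 1)
    {q : Measure Ω} [IsProbabilityMeasure q] {I c : ℝ} (hI : renyiInfo α P = I)
    (h : ∀ W ∈ P.support, renyiDiv α (W : Measure Ω) q ≤ c) :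
    renyiDiv α (renyiMean α P) q ≤ (c - I : ℝ) := by
  rcases eq_or_ne α ⊤ with rfl | ht
  · exact (renyiDiv_renyiMean_top_le_iff hP hI c).2 h
  · exact renyiDiv_renyiMean_le_of_ne_top hα ht hP hI h

lemma le_renyiDiv_renyiMean {P : ProbabilityMeasure Ω →₀ ℝ≥0} (hP : ∑ W ∈ P.support, P W = 1)
    {q : Measure Ω} [IsProbabilityMeasure q] {I c : ℝ} (hI : renyiInfo α P = I)
    (h : ∀ W ∈ P.support, c ≤ renyiDiv α (W : Measure Ω) q) :
    (c - I : ℝ) ≤ renyiDiv α (renyiMean α P) q := by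
  rcases eq_or_ne α ⊤ with rfl | ht
  · obtain ⟨W, hW⟩ := exists_mem_support hP
    exact le_renyiDiv_renyiMean_top hP hI ⟨W, hW, h W hW⟩
  · exact le_renyiDiv_renyiMean_of_ne_top hα ht hP hI h

/-- The easy half of the minimax theorem: the divergence of the mean is nonnegative and at most c -
I. -/
lemma renyiCapacity_le {𝒲 : Set (ProbabilityMeasure Ω)} {q : Measure Ω} [IsProbabilityMeasure q]
    {c : ℝ} (h : ∀ W ∈ 𝒲, renyiDiv α (W : Measure Ω) q ≤ c) : renyiCapacity α 𝒲 ≤ c := by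
  refine iSup₂_le fun P hP => ?_
  obtain ⟨I, hI0, hI⟩ := exists_renyiInfo_eq hα hP.2
  have hp := isProbabilityMeasure_renyiMean hα hP.2
  have h1 := renyiDiv_renyiMean_le hα hP.2 hI fun W hW => h W (hP.1 hW)
  have h2 : 0 ≤ c - I := by exact_mod_cast (renyiDiv_nonneg hα _ q).trans h1
  rw [hI]
  exact_mod_cast sub_nonneg.1 h2

lemma exists_renyiCapacity_eq {𝒲 : Set (ProbabilityMeasure Ω)} (hne : 𝒲.Nonempty)
    (hC : renyiCapacity α 𝒲 < ⊤) : ∃ C : ℝ, 0 ≤ C ∧ renyiCapacity α 𝒲 = C := by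
  obtain ⟨W, hW⟩ := hne
  have hP := single_mem_renyiFinPMF hW
  obtain ⟨I, hI0, hI⟩ := exists_renyiInfo_eq hα hP.2
  have h0 : 0 ≤ renyiCapacity α 𝒲 := by
    refine le_trans ?_ (le_iSup₂ (f := fun P _ => renyiInfo α P) _ hP)
    rw [hI]; exact_mod_cast hI0
  refine ⟨(renyiCapacity α 𝒲).toReal, EReal.toReal_nonneg h0, (EReal.coe_toReal hC.ne ?_).symm⟩
  rintro h
  rw [h] at h0
  exact absurd h0 (by simp)

lemma exists_forall_renyiDiv_le {𝒲 : Set (ProbabilityMeasure Ω)} {C : ℝ} (hC0 : 0 ≤ C)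
    (hC : renyiCapacity α 𝒲 = C) : ∃ q : ProbabilityMeasure Ω,
    ∀ W ∈ 𝒲, renyiDiv α (W : Measure Ω) (q : Measure Ω) ≤ C := by
  rcases eq_or_ne α ⊤ with rfl | ht
  · obtain ⟨q, hq, h⟩ := exists_forall_renyiDiv_top_le hC
    exact ⟨⟨q, hq⟩, h⟩
  · obtain ⟨q, hq, h⟩ := exists_forall_renyiDiv_le_of_ne_top hα ht hC hC0
    exact ⟨⟨q, hq⟩, h⟩

/-- The upper bound C suffices, since a supremum below C would contradict `renyiCapacity_le`. Hence
q passes to any subfamily of the same capacity. -/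
lemma isRenyiCenter_of_forall_le {𝒲 : Set (ProbabilityMeasure Ω)} {C : ℝ} (hC0 : 0 ≤ C)
    (hC : renyiCapacity α 𝒲 = C) {q : ProbabilityMeasure Ω}
    (hq : ∀ W ∈ 𝒲, renyiDiv α (W : Measure Ω) (q : Measure Ω) ≤ C) : IsRenyiCenter α 𝒲 q := by
  refine ⟨le_antisymm ?_ ?_, fun q' hq' => ?_⟩
  · by_contra! hlt
    obtain ⟨c, h1, h2⟩ := EReal.lt_iff_exists_real_btwn.1 hlt
    refine absurd (renyiCapacity_le hα (q := (q : Measure Ω)) (c := c) fun W hW => ?_) (not_le.2 h2)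
    exact (le_iSup₂ (f := fun (W : ProbabilityMeasure Ω) (_ : W ∈ 𝒲) =>
      renyiDiv α (W : Measure Ω) (q : Measure Ω)) W hW).trans h1.le
  · rw [hC]
    exact iSup₂_le hq
  · have hq'' : ∀ W ∈ 𝒲, renyiDiv α (W : Measure Ω) (q' : Measure Ω) ≤ C := fun W hW => by
      rw [← hC, hq']
      exact le_iSup₂ (f := fun (W : ProbabilityMeasure Ω) (_ : W ∈ 𝒲) =>
        renyiDiv α (W : Measure Ω) (q' : Measure Ω)) W hW
    apply Subtype.ext
    change (q' : Measure Ω) = (q : Measure Ω)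
    rcases eq_or_ne α ⊤ with rfl | ht
    · exact eq_of_forall_renyiDiv_top_le hC hC0 hq'' hq
    · exact eq_of_forall_renyiDiv_le_of_ne_top hα ht hC hC0 hq'' hq

lemma renyiCapacity_renyiSubfamily_of_pos {𝒲 : Set (ProbabilityMeasure Ω)} {C : ℝ}
    (hC : renyiCapacity α 𝒲 = C) {q : ProbabilityMeasure Ω}
    (hq : ∀ W ∈ 𝒲, renyiDiv α (W : Measure Ω) (q : Measure Ω) ≤ C) {ε : ℝ} (hε : 0 < ε) :
    C ≤ renyiCapacity α (renyiSubfamily α 𝒲 q ε) := by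
  by_contra! hlt
  have hout : ∀ W ∈ 𝒲, W ∉ renyiSubfamily α 𝒲 q ε →
      renyiDiv α (W : Measure Ω) (q : Measure Ω) ≤ (C - ε : ℝ) := by
    intro W hW hn
    by_contra! h
    refine hn ⟨hW, ?_⟩
    rw [hC, ← EReal.coe_sub]
    exact h.le
  -- The empty subfamily has capacity `⊥` and admits no real C'; there q itself already improves on
  -- C.
  rcases (renyiSubfamily α 𝒲 q ε).eq_empty_or_nonempty with he | hne
  · have := renyiCapacity_le hα (𝒲 := 𝒲) (q := (q : Measure Ω)) (c := C - ε)
      fun W hW => hout W hW (by simp [he])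
    rw [hC] at this
    have : C ≤ C - ε := by exact_mod_cast this
    linarith
  · obtain ⟨C', hC0', hC'⟩ := exists_renyiCapacity_eq hα hne (hlt.trans (EReal.coe_lt_top C))
    rw [hC'] at hlt
    obtain ⟨q', hq'⟩ := exists_forall_renyiDiv_le hα hC0' hC'
    obtain ⟨r, hr, c, hc, h⟩ := exists_improvement hα (q := (q : Measure Ω))
      (q' := (q' : Measure Ω)) hC0' (by exact_mod_cast hlt) hε
    have := renyiCapacity_le hα (𝒲 := 𝒲) (q := r) (c := c) fun W hW => by
      refine h W inferInstance (hq W hW) ?_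
      by_cases hWs : W ∈ renyiSubfamily α 𝒲 q ε
      · exact Or.inl (hq' W hWs)
      · exact Or.inr (hout W hW hWs)
    rw [hC] at this
    have : C ≤ c := by exact_mod_cast this
    linarith

end

lemma renyiCapacity_mono (α : ℝ≥0∞) {𝒲 𝒱 : Set (ProbabilityMeasure Ω)} (h : 𝒲 ⊆ 𝒱) :
    renyiCapacity α 𝒲 ≤ renyiCapacity α 𝒱 :=
  iSup₂_le fun P hP =>
    le_iSup₂ (f := fun P (_ : P ∈ renyiFinPMF 𝒱) => renyiInfo α P) P ⟨hP.1.trans h, hP.2⟩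

/-- Among finitely many members, those with divergence below C stay below it by a common positive
gap. -/
lemma exists_renyiSubfamily_subset {α : ℝ≥0∞} {𝒲 : Set (ProbabilityMeasure Ω)} (hfin : 𝒲.Finite)
    {C : ℝ} (hC : renyiCapacity α 𝒲 = C) (q : ProbabilityMeasure Ω) :
    ∃ ε : ℝ, 0 < ε ∧ renyiSubfamily α 𝒲 q ε ⊆ renyiSubfamily α 𝒲 q 0 := by
  have h : ∀ᶠ ε in 𝓝[>] (0 : ℝ), ∀ W ∈ 𝒲, W ∈ renyiSubfamily α 𝒲 q ε →
      W ∈ renyiSubfamily α 𝒲 q 0 := by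
    rw [eventually_all_finite hfin]
    intro W hW
    rcases lt_or_ge (renyiDiv α (W : Measure Ω) (q : Measure Ω)) C with hlt | hge
    · obtain ⟨d, h1, h2⟩ := EReal.lt_iff_exists_real_btwn.1 hlt
      have h2 : d < C := by exact_mod_cast h2
      filter_upwards [Ioo_mem_nhdsGT (sub_pos.2 h2)] with ε hε hWε
      exfalso
      have h3 := hWε.2.le.trans_lt h1
      rw [hC, ← EReal.coe_sub] at h3
      have h4 : C - ε < d := by exact_mod_cast h3
      linarith [hε.2]
    · refine Eventually.of_forall fun ε _ => ⟨hW, ?_⟩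
      rw [hC, EReal.coe_zero, sub_zero]
      exact hge
  obtain ⟨ε, hε, h0⟩ := (h.and self_mem_nhdsWithin).exists
  exact ⟨ε, h0, fun W hW => hε W hW.1 hW⟩

/-- The two bounds make D finite, after which the `EReal` subtractions are real ones. -/
lemma sub_sub_mem_of_le {C I ε : ℝ} {D : EReal} (h1 : D ≤ (C - I : ℝ))
    (h2 : ((C - ε - I : ℝ) : EReal) ≤ D) :
    (0 : EReal) ≤ C - I - D ∧ (C : EReal) - I - D ≤ ε := by
  have ht : D ≠ ⊤ := ne_top_of_le_ne_top (EReal.coe_ne_top _) h1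
  have hb : D ≠ ⊥ := ne_bot_of_le_ne_bot (EReal.coe_ne_bot _) h2
  lift D to ℝ using ⟨ht, hb⟩
  have h1 : D ≤ C - I := by exact_mod_cast h1
  have h2 : C - ε - I ≤ D := by exact_mod_cast h2
  rw [← EReal.coe_sub, ← EReal.coe_sub]
  constructor
  · have : 0 ≤ C - I - D := by linarith
    exact_mod_cast this
  · have : C - I - D ≤ ε := by linarith
    exact_mod_cast this

end RenyiCenter

/-! ### The main theorem -/

open RenyiCenter

theorem mainTheorem10 {Ω : Type*} [MeasurableSpace Ω] (α : ℝ≥0∞) (hα : 0 < α)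
    (𝒲 : Set (ProbabilityMeasure Ω)) (hne : 𝒲.Nonempty) (hC : renyiCapacity α 𝒲 < ⊤) :
    ∃ q : ProbabilityMeasure Ω, IsRenyiCenter α 𝒲 q ∧
      ∀ ε : ℝ, (0 < ε ∨ (ε = 0 ∧ 𝒲.Finite)) →
        renyiCapacity α (renyiSubfamily α 𝒲 q ε) = renyiCapacity α 𝒲 ∧
        IsRenyiCenter α (renyiSubfamily α 𝒲 q ε) q ∧
        (∀ P ∈ renyiFinPMF (renyiSubfamily α 𝒲 q ε),
          0 ≤ renyiCapacity α 𝒲 - renyiInfo α P - renyiDiv α (renyiMean α P) (q : Measure Ω) ∧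
          renyiCapacity α 𝒲 - renyiInfo α P - renyiDiv α (renyiMean α P) (q : Measure Ω)
            ≤ (ε : EReal)) ∧
        (α = ⊤ → ∀ P ∈ renyiFinPMF 𝒲, (∃ W ∈ renyiSubfamily α 𝒲 q ε, 0 < P W) →
          0 ≤ renyiCapacity α 𝒲 - renyiInfo α P - renyiDiv α (renyiMean α P) (q : Measure Ω) ∧
          renyiCapacity α 𝒲 - renyiInfo α P - renyiDiv α (renyiMean α P) (q : Measure Ω)
            ≤ (ε : EReal)) := by
  obtain ⟨C, hC0, hCe⟩ := exists_renyiCapacity_eq hα hne hC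
  obtain ⟨q, hq⟩ := exists_forall_renyiDiv_le hα hC0 hCe
  refine ⟨q, isRenyiCenter_of_forall_le hα hC0 hCe hq, fun ε hε => ?_⟩
  have hsub : ∀ ε, renyiSubfamily α 𝒲 q ε ⊆ 𝒲 := fun ε W hW => hW.1
  have hcap : renyiCapacity α (renyiSubfamily α 𝒲 q ε) = C := by
    refine le_antisymm (hCe ▸ renyiCapacity_mono α (hsub ε)) ?_
    rcases hε with hε | ⟨rfl, hfin⟩
    · exact renyiCapacity_renyiSubfamily_of_pos hα hCe hq hε
    · obtain ⟨ε, hε, hle⟩ := exists_renyiSubfamily_subset hfin hCe q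
      exact (renyiCapacity_renyiSubfamily_of_pos hα hCe hq hε).trans (renyiCapacity_mono α hle)
  have hge : ∀ W ∈ renyiSubfamily α 𝒲 q ε,
      ((C - ε : ℝ) : EReal) ≤ renyiDiv α (W : Measure Ω) (q : Measure Ω) := fun W hW => by
    have := hW.2
    rwa [hCe, ← EReal.coe_sub] at this
  refine ⟨by rw [hcap, hCe],
    isRenyiCenter_of_forall_le hα hC0 hcap fun W hW => hq W (hsub ε hW), ?_, ?_⟩
  · intro P hP
    obtain ⟨I, -, hI⟩ := exists_renyiInfo_eq hα hP.2
    rw [hCe, hI]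
    exact sub_sub_mem_of_le
      (renyiDiv_renyiMean_le hα hP.2 hI fun W hW => hq W (hsub ε (hP.1 hW)))
      (le_renyiDiv_renyiMean hα hP.2 hI fun W hW => hge W (hP.1 hW))
  · rintro rfl P hP ⟨W, hW, hPW⟩
    obtain ⟨I, -, hI⟩ := exists_renyiInfo_eq hα hP.2
    rw [hCe, hI]
    exact sub_sub_mem_of_le
      (renyiDiv_renyiMean_le hα hP.2 hI fun W hW => hq W (hP.1 hW))
      -- One member of the subfamily with positive mass is enough at order infinity.
      (le_renyiDiv_renyiMean_top hP.2 hI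
        ⟨W, Finsupp.mem_support_iff.2 hPW.ne', hge W hW⟩)
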